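/- Work over $\mathbb C$. Let $U$ be a finite-dimensional vector space and let $R(x)=\sum_{n\ge 0}R_nx^n\in(\mathrm{End}\,U)[[x]]$ with $R_iR_j=R_jR_i$ for all $i,j\ge 0$ and $R_0=R(0)=1$. Define $R^*(x)\in(\mathrm{End}\,U^*)[[x]]$ by $\langle R^*(x)u^*,u\rangle=\langle u^*,R^{-1}(x)u\rangle$. Let $H=U\oplus U^*$ with the skew-symmetric form $\langle u+u^*,v+v^*\rangle=\langle u^*,v\rangle-\langle v^*,u\rangle$, and let $\mathcal S(x):H\otimes H\to H\otimes H\otimes\mathbb C[[x]]$ be given, for $u,v\in U$, $u^*,v^*\in U^*$, by $$\mathcal S(x)(u\otimes v)=R(-x)u\otimes R^{-1}(x)v,\quad \mathcal S(x)(u^*\otimes v^*)=(R^*)^{-1}(-x)u^*\otimes R^*(x)v^*,$$ $$\mathcal S(x)(v^*\otimes u)=R^*(-x)v^*\otimes R(x)u,\quad \mathcal S(x)(u\otimes v^*)=R^{-1}(-x)u\otimes (R^*)^{-1}(x)v^*.$$ *$(H,\mathcal S)$-modules.* An $(H,\mathcal S)$-module is a module $W$ for the tensor algebra $T=T(H\otimes\mathbb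 C[t,t^{-1}])$, where $a(n)$ denotes the action of $a\otimes t^n$ and $a(x)=\sum_{n\in\mathbb Z} a(n)x^{-n-1}$, such that for $a\in H$, $w\in W$ one has $a(m)w=0$ for $m$ sufficiently large, and such that for $a,b\in H$, $w\in W$ $$a(x_1)b(x_2)w-\sum_i f_i(x_2-x_1)\,b^{(i)}(x_2)a^{(i)}(x_1)w=x_2^{-1}\delta\left(\frac{x_1}{x_2}\right)\langle a,b\rangle w,\qquad (*)$$ where $\mathcal S(x)(b\otimes a)=\sum_i b^{(i)}\otimes a^{(i)}\otimes f_i(x)$. It is a vacuum $(H,\mathcal S)$-module with generator $e$ if $W=Te$ and $a(m)e=0$ for all $a\in H$, $m\ge 0$. Then let $W[k]$ be the span of the vectors $a^{(1)}(-m_1)\cdots a^{(r)}(-m_r)e$ with $r\ge 0$, $a^{(i)}\in H$, $m_i\ge 1$, $m_1+\cdots+m_r\le k$. Call $W$ of PBW type if $a(-m)(w+W[k-1])=a(-m)w+W[k+m-1]$ ($a\in H$, $m\ge 1$, $w\in W[k]$) makes $\mathrm{gr}\,W=\coprod_{k\ge 0}W[k]/W[k-1]$ a free module over the symmetric algebra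 $S(H\otimes t^{-1}\mathbb C[t^{-1}])$. Let $J\subset T$ be the left ideal generated by all $(a^{(1)}\otimes t^{n_1})\cdots(a^{(r)}\otimes t^{n_r})$ with $r\ge 1$ and $n_1+\cdots+n_r\ge 0$. Let $V(H,\mathcal S)$ be the quotient of the $T$-module $T/J$ by the submodule generated by the coefficients of the relations $(*)$ for $a,b\in H$, $w\in T/J$, and let $\mathbf 1\in V(H,\mathcal S)$ be the image of $1$. *The Heisenberg vertex algebra.* Let $\mathcal H=H\otimes\mathbb C[t,t^{-1}]\oplus\mathbb Cc$ be the Lie algebra with $c$ central and $[a\otimes t^m,b\otimes t^n]=\langle a,b\rangle\delta_{m+n+1,0}\,c$. Let $V_{\mathcal H}$ be the $\mathcal H$-module induced from the one-dimensional module $\mathbb C$ of $H\otimes\mathbb C[t]\oplus\mathbb Cc$ on which $H\otimes\mathbb C[t]$ acts as $0$ and $c$ acts as $1$, let $\mathbf 1=1\otimes 1$, let $a(n)$ be the action of $a\otimes t^n$ on $V_{\mathcal H}$, and identify $a\in H$ with $a(-1)\mathbf 1\in V_{\mathcal H}$. **Theorem.** 1. $V(H,\mathcal S)$ is a universal vacuum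 $(H,\mathcal S)$-module: it is a vacuum $(H,\mathcal S)$-module with generator $\mathbf 1$, and for every vacuum $(H,\mathcal S)$-module $W$ with generator $e$ there is a unique homomorphism $V(H,\mathcal S)\to W$ with $\mathbf 1\mapsto e$. It is of PBW type. 2. $V_{\mathcal H}$ has a unique vertex algebra structure $Y$ with vacuum vector $\mathbf 1$ and $Y(a,x)=a(x)=\sum_n a(n)x^{-n-1}$ for $a\in H$. 3. There exist unique $\Delta_R^{\pm}(x)\in\mathrm{Hom}(V_{\mathcal H},V_{\mathcal H}\otimes\mathbb C[[x]])\subset(\mathrm{End}\,V_{\mathcal H})[[x]]$ such that $$\Delta_R^{\pm}(x)u=R^{\pm1}(x)u,\quad \Delta_R^{\pm}(x)u^*=(R^*)^{\pm1}(x)u^*\quad(u\in U,\ u^*\in U^*),\qquad \Delta_R^{\pm}(x)\mathbf 1=\mathbf 1,$$ $$\Delta_R^{\pm}(x)Y(v,x_1)=Y(\Delta_R^{\pm}(x-x_1)v,x_1)\Delta_R^{\pm}(x)\quad(v\in V_{\mathcal H}),$$ $$\Delta_R^{\pm}(x_1)\Delta_R^{\pm}(x_2)=\Delta_R^{\pm}(x_2)\Delta_R^{\pm}(x_1),\quad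 \Delta_R^{\pm}(x_1)\Delta_R^{\mp}(x_2)=\Delta_R^{\mp}(x_2)\Delta_R^{\pm}(x_1),\quad \Delta_R^{\pm}(x)\Delta_R^{\mp}(x)=1.$$ 4. Let $a\otimes t^n$ act on $V_{\mathcal H}$ as $a_R(n)$, where $a_R(x)=\sum_n a_R(n)x^{-n-1}$ is given by $u_R(x)=Y(u,x)\Delta_R^{+}(x)$ for $u\in U$ and $u^*_R(x)=Y(u^*,x)\Delta_R^{-}(x)$ for $u^*\in U^*$. Then $V_{\mathcal H}$ is a vacuum $(H,\mathcal S)$-module with generator $\mathbf 1$, it is of PBW type, and it is isomorphic to $V(H,\mathcal S)$ as an $(H,\mathcal S)$-module. -/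

import Mathlib

open scoped TensorProduct DirectSum VertexOperator

noncomputable section

namespace ZF

universe u v w

/-! ### Representations of `T(H ⊗ ℂ[t,t⁻¹])` and `(H,𝒮)`-modules -/

section Modules

variable {H : Type u} [AddCommGroup H] [Module ℂ H]
variable {W : Type v} [AddCommGroup W] [Module ℂ W]
variable {W' : Type w} [AddCommGroup W'] [Module ℂ W']

/-- The tensor algebra `T(H ⊗ ℂ[t,t⁻¹])`. The space `H ⊗ ℂ[t,t⁻¹]` of Laurent polynomials with
coefficients in `H` is realized as `ℤ →₀ H`, and `a ⊗ tⁿ` is `Finsupp.single n a`. -/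
abbrev LoopAlg (H : Type u) [AddCommGroup H] [Module ℂ H] : Type u := TensorAlgebra ℂ (ℤ →₀ H)

/-- A `T(H ⊗ ℂ[t,t⁻¹])`-module structure on the vector space `W`. -/
abbrev LoopRep (H : Type u) [AddCommGroup H] [Module ℂ H]
    (W : Type v) [AddCommGroup W] [Module ℂ W] : Type (max u v) :=
  LoopAlg H →ₐ[ℂ] Module.End ℂ W

/-- The element `a ⊗ tⁿ` of `T(H ⊗ ℂ[t,t⁻¹])`. -/
def gen (n : ℤ) (a : H) : LoopAlg H := TensorAlgebra.ι ℂ (Finsupp.single n a)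

/-- The operator `a(n)` on `W`, by which `a ⊗ tⁿ` acts. -/
def mode (ρ : LoopRep H W) (n : ℤ) : H →ₗ[ℂ] Module.End ℂ W :=
  ρ.toLinearMap ∘ₗ TensorAlgebra.ι ℂ ∘ₗ Finsupp.lsingle n

/-- The linear map `H ⊗ H → End W`, `b ⊗ a ↦ b(m) a(n)`. -/
def modePair (ρ : LoopRep H W) (m n : ℤ) : H ⊗[ℂ] H →ₗ[ℂ] Module.End ℂ W :=
  TensorProduct.lift ((LinearMap.mul ℂ (Module.End ℂ W)).compl₁₂ (mode ρ m) (mode ρ n))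

/-- The coefficient of `x₁^(-m-1) x₂^(-n-1)` in
`a(x₁)b(x₂)w - ∑ᵢ fᵢ(x₂-x₁) b⁽ⁱ⁾(x₂)a⁽ⁱ⁾(x₁)w - x₂⁻¹δ(x₁/x₂)⟨a,b⟩w`, where
`𝒮(x)(b ⊗ a) = ∑ᵢ b⁽ⁱ⁾ ⊗ a⁽ⁱ⁾ ⊗ fᵢ(x)` and `a(x) = ∑ₙ a(n) x^(-n-1)`. For finite-dimensional `H`,
a linear map `𝒮(x) : H ⊗ H → H ⊗ H ⊗ ℂ[[x]]` is the same as a power series `∑ₖ Sₖ xᵏ` over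
`End (H ⊗ H)`; the `k`-th summand below is the contribution of
`Sₖ (b ⊗ a) (x₂ - x₁)ᵏ = ∑ⱼ (-1)ʲ (k choose j) Sₖ (b ⊗ a) x₁ʲ x₂^(k-j)`. -/
def relVec (form : LinearMap.BilinForm ℂ H) (S : PowerSeries (Module.End ℂ (H ⊗[ℂ] H)))
    (ρ : LoopRep H W) (a b : H) (m n : ℤ) (w : W) : W :=
  mode ρ m a (mode ρ n b w)
    - (∑ᶠ k : ℕ, ∑ j ∈ Finset.range (k + 1), ((-1 : ℂ) ^ j * (k.choose j : ℂ)) •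
        modePair ρ (n + k - j) (m + j) (PowerSeries.coeff k S (b ⊗ₜ[ℂ] a)) w)
    - (if m + n + 1 = 0 then form a b else 0) • w

/-- `W` is an `(H,𝒮)`-module (for finite-dimensional `H`). -/
structure IsHSModule (form : LinearMap.BilinForm ℂ H)
    (S : PowerSeries (Module.End ℂ (H ⊗[ℂ] H))) (ρ : LoopRep H W) : Prop where
  truncation : ∀ (a : H) (w : W), ∃ N : ℤ, ∀ m : ℤ, N ≤ m → mode ρ m a w = 0
  relation : ∀ (a b : H) (m n : ℤ) (w : W), relVec form S ρ a b m n w = 0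

/-- `e` is a vacuum-like vector: `a(m)e = 0` for all `a ∈ H` and `m ≥ 0`. -/
def IsVacuumLike (ρ : LoopRep H W) (e : W) : Prop :=
  ∀ (a : H) (m : ℤ), 0 ≤ m → mode ρ m a e = 0

/-- `W` is a vacuum `(H,𝒮)`-module, cyclic on the vacuum-like vector `e`. -/
structure IsVacuumModule (form : LinearMap.BilinForm ℂ H)
    (S : PowerSeries (Module.End ℂ (H ⊗[ℂ] H))) (ρ : LoopRep H W) (e : W) : Prop where
  isHSModule : IsHSModule form S ρ
  vacuumLike : IsVacuumLike ρ e
  cyclic : ∀ w : W, ∃ t : LoopAlg H, ρ t e = w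

/-- `f` is a homomorphism of `T(H ⊗ ℂ[t,t⁻¹])`-modules. -/
def IsLoopHom (ρ : LoopRep H W) (ρ' : LoopRep H W') (f : W →ₗ[ℂ] W') : Prop :=
  ∀ (t : LoopAlg H) (w : W), f (ρ t w) = ρ' t (f w)

/-- The subspace `W[k]`, spanned by the vectors `a⁽¹⁾(-m₁) ⋯ a⁽ʳ⁾(-mᵣ) e` with `r ≥ 0`, `mᵢ ≥ 1` and
`m₁ + ⋯ + mᵣ ≤ k`. It is `0` for `k < 0`. -/
def filt (ρ : LoopRep H W) (e : W) (k : ℤ) : Submodule ℂ W :=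
  Submodule.span ℂ {w | ∃ l : List (H × ℕ+), (l.map fun p => ((p.2 : ℕ) : ℤ)).sum ≤ k ∧
    w = (l.map fun p => mode ρ (-((p.2 : ℕ) : ℤ)) p.1).prod e}

theorem mode_mem_filt (ρ : LoopRep H W) (e : W) (a : H) (m : ℕ+) (k : ℕ) (w : W)
    (hw : w ∈ filt ρ e (k : ℤ)) :
    mode ρ (-((m : ℕ) : ℤ)) a w ∈ filt ρ e ((k + (m : ℕ) : ℕ) : ℤ) := by
  have h : filt ρ e (k : ℤ) ≤
      (filt ρ e ((k + (m : ℕ) : ℕ) : ℤ)).comap (mode ρ (-((m : ℕ) : ℤ)) a) := by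
    refine Submodule.span_le.2 ?_
    rintro _ ⟨l, hl, rfl⟩
    refine Submodule.subset_span ⟨(a, m) :: l, ?_, ?_⟩
    · simp only [List.map_cons, List.sum_cons]
      push_cast
      linarith
    · simp only [List.map_cons, List.prod_cons, Module.End.mul_apply]
  exact h hw

/-- `W[k]/W[k-1]`. -/
abbrev GrPiece (ρ : LoopRep H W) (e : W) (k : ℕ) : Type v :=
  filt ρ e (k : ℤ) ⧸ (filt ρ e ((k : ℤ) - 1)).submoduleOf (filt ρ e (k : ℤ))

/-- `gr W = ∐_{k ≥ 0} W[k]/W[k-1]`. -/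
abbrev Gr (ρ : LoopRep H W) (e : W) : Type v := ⨁ k : ℕ, GrPiece ρ e k

/-- The class `w + W[k-1]` in `gr W` of `w ∈ W[k]`. -/
def grClass (ρ : LoopRep H W) (e : W) (k : ℕ) (w : filt ρ e (k : ℤ)) : Gr ρ e :=
  DirectSum.of (GrPiece ρ e) k (Submodule.Quotient.mk w)

/-- `W` is of PBW type: `gr W` is free as a module over the symmetric algebra
`S(H ⊗ t⁻¹ℂ[t⁻¹])`, whose generators `a ⊗ t⁻ᵐ`, `m ≥ 1`, act by
`a(-m)(w + W[k-1]) = a(-m)w + W[k+m-1]`. Here `H ⊗ t⁻¹ℂ[t⁻¹]` is realized as `ℕ+ →₀ H`, and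
`a ⊗ t⁻ᵐ` is `Finsupp.single m a`. The action `σ` is determined by its values on the generators. -/
def IsPBW (ρ : LoopRep H W) (e : W) : Prop :=
  ∃ σ : SymmetricAlgebra ℂ (ℕ+ →₀ H) →ₐ[ℂ] Module.End ℂ (Gr ρ e),
    (∀ (a : H) (m : ℕ+) (k : ℕ) (w : filt ρ e (k : ℤ)),
      σ (SymmetricAlgebra.ι ℂ (ℕ+ →₀ H) (Finsupp.single m a)) (grClass ρ e k w) =
        grClass ρ e (k + (m : ℕ))
          ⟨mode ρ (-((m : ℕ) : ℤ)) a w, mode_mem_filt ρ e a m k w w.2⟩) ∧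
    @Module.Free (SymmetricAlgebra ℂ (ℕ+ →₀ H)) (Gr ρ e) _ _
      (Module.compHom (Gr ρ e) σ.toRingHom)

end Modules

/-! ### The universal vacuum `(H,𝒮)`-module -/

section Universal

variable (H : Type u) [AddCommGroup H] [Module ℂ H]

/-- The left ideal `J = T(H ⊗ ℂ[t,t⁻¹]) T(H ⊗ ℂ[t,t⁻¹])⁺`, generated by the products
`(a⁽¹⁾ ⊗ t^{n₁}) ⋯ (a⁽ʳ⁾ ⊗ t^{nᵣ})` with `r ≥ 1` and `n₁ + ⋯ + nᵣ ≥ 0`. -/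
def leftIdealJ : Submodule (LoopAlg H) (LoopAlg H) :=
  Submodule.span (LoopAlg H) {t | ∃ l : List (H × ℤ), l ≠ [] ∧ 0 ≤ (l.map Prod.snd).sum ∧
    t = (l.map fun p => gen p.2 p.1).prod}

/-- `Ṽ(H,𝒮) = T(H ⊗ ℂ[t,t⁻¹])/J`. -/
abbrev PreV : Type u := LoopAlg H ⧸ leftIdealJ H

/-- The left multiplication action on `Ṽ(H,𝒮)`. -/
def preVRep : LoopRep H (PreV H) := Algebra.lsmul ℂ ℂ (PreV H)

variable {H}
variable (form : LinearMap.BilinForm ℂ H) (S : PowerSeries (Module.End ℂ (H ⊗[ℂ] H)))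

/-- The submodule of `Ṽ(H,𝒮)` generated by all coefficients of the defining relations. -/
def relSubmodule : Submodule (LoopAlg H) (PreV H) :=
  Submodule.span (LoopAlg H) {z | ∃ (a b : H) (m n : ℤ) (w : PreV H),
    z = relVec form S (preVRep H) a b m n w}

/-- `V(H,𝒮)`, the quotient of `Ṽ(H,𝒮)` by the defining relations. -/
abbrev VHS : Type u := PreV H ⧸ relSubmodule form S

/-- The `T(H ⊗ ℂ[t,t⁻¹])`-module structure of `V(H,𝒮)`. -/
def vhsRep : LoopRep H (VHS form S) := Algebra.lsmul ℂ ℂ (VHS form S)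

/-- The vector `𝟏` of `V(H,𝒮)`. -/
def vhsOne : VHS form S := Submodule.Quotient.mk (Submodule.Quotient.mk 1)

end Universal

/-! ### Vertex algebras -/

section VertexAlgebra

variable {V : Type v} [AddCommGroup V] [Module ℂ V]

/-- `(V, Y, 𝟏)` is a vertex algebra, where `Y(v,x) = ∑ₙ vₙ x^(-n-1) ∈ Hom(V, V((x)))` and
`vₙ = (Y v)[[n]]`. The last axiom is the coefficient of `x₀^(-l-1) x₁^(-m-1) x₂^(-n-1)` in the
Jacobi identity
`x₀⁻¹δ((x₁-x₂)/x₀)Y(u,x₁)Y(v,x₂) - x₀⁻¹δ((x₂-x₁)/(-x₀))Y(v,x₂)Y(u,x₁)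
  = x₂⁻¹δ((x₁-x₀)/x₂)Y(Y(u,x₀)v,x₂)`
applied to `w`; all sums in it are finite. -/
structure IsVertexAlgebra (one : V) (Y : V →ₗ[ℂ] VertexOperator ℂ V) : Prop where
  vacuum : ∀ n : ℤ, (Y one)[[n]] = if n = -1 then 1 else 0
  creation_nonneg : ∀ (v : V) (n : ℤ), 0 ≤ n → ((Y v)[[n]]) one = 0
  creation : ∀ v : V, ((Y v)[[-1]]) one = v
  jacobi : ∀ (u v w : V) (l m n : ℤ),
    (∑ᶠ i : ℕ, ((-1 : ℂ) ^ i * ((Ring.choose l i : ℤ) : ℂ)) •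
        ((Y u)[[m + l - i]]) (((Y v)[[n + i]]) w))
      - (∑ᶠ i : ℕ, ((-1 : ℂ) ^ l * (-1 : ℂ) ^ i * ((Ring.choose l i : ℤ) : ℂ)) •
        ((Y v)[[n + l - i]]) (((Y u)[[m + i]]) w))
      = ∑ᶠ i : ℕ, ((Ring.choose m i : ℤ) : ℂ) • ((Y (((Y u)[[l + i]]) v))[[m + n - i]]) w

/-- The coefficient `Δₙ ∈ End V` of `xⁿ` in `Δ(x) ∈ Hom(V, V ⊗ ℂ[[x]]) ⊂ (End V)[[x]]`. -/
def dcoeff (Δ : V →ₗ[ℂ] V ⊗[ℂ] PowerSeries ℂ) (n : ℕ) : Module.End ℂ V :=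
  (TensorProduct.rid ℂ V).toLinearMap ∘ₗ
    LinearMap.lTensor V (PowerSeries.coeff (R := ℂ) n) ∘ₗ Δ

/-- `Δ(x)𝟏 = 𝟏` and `Δ(x)Y(v,x₁) = Y(Δ(x-x₁)v,x₁)Δ(x)` for all `v ∈ V`. The second condition is
the comparison of the coefficients of `xᵖ x₁^(-q-1)` on `w`, using
`(x-x₁)ᵏ = ∑ⱼ (-1)ʲ (k choose j) x₁ʲ x^(k-j)` with `k - j + i = p`; the sums over `j` are finite
because `Δ(x)v ∈ V ⊗ ℂ[[x]]`. -/
structure IsPseudoEnd (one : V) (Y : V →ₗ[ℂ] VertexOperator ℂ V)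
    (Δ : V →ₗ[ℂ] V ⊗[ℂ] PowerSeries ℂ) : Prop where
  map_one : Δ one = one ⊗ₜ[ℂ] (1 : PowerSeries ℂ)
  map_Y : ∀ (v w : V) (p : ℕ) (q : ℤ),
    dcoeff Δ p (((Y v)[[q]]) w) =
      ∑ i ∈ Finset.range (p + 1), ∑ᶠ j : ℕ, ((-1 : ℂ) ^ j * ((p - i + j).choose j : ℂ)) •
        ((Y (dcoeff Δ (p - i + j) v))[[q + j]]) (dcoeff Δ i w)

/-- For `A(x) ∈ Hom(V, V((x)))`, the linear map `V ⊗ ℂ[[x]] → V((x))`, `v ⊗ f(x) ↦ f(x) A(x)v`. -/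
def extendSeries (A : VertexOperator ℂ V) :
    V ⊗[ℂ] PowerSeries ℂ →ₗ[ℂ] HahnModule ℤ ℂ V :=
  TensorProduct.lift (LinearMap.mk₂ ℂ
    (fun v f => (HahnSeries.ofPowerSeries ℤ ℂ f) • A v)
    (fun v v' f => by simp only [map_add, smul_add])
    (fun c v f => by
      rw [map_smul]
      exact (smul_comm c (HahnSeries.ofPowerSeries ℤ ℂ f) (A v)).symm)
    (fun v f f' => by simp only [map_add, add_smul])
    (fun c v f => by
      rw [PowerSeries.smul_eq_C_mul, map_mul, mul_smul, HahnSeries.ofPowerSeries_C,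
        HahnSeries.C_apply]
      exact HahnModule.single_zero_smul_eq_smul ℤ))

/-- The product `A(x)Δ(x) ∈ Hom(V, V((x)))`. -/
def twistField (Δ : V →ₗ[ℂ] V ⊗[ℂ] PowerSeries ℂ) :
    VertexOperator ℂ V →ₗ[ℂ] VertexOperator ℂ V where
  toFun A := extendSeries A ∘ₗ Δ
  map_add' A B := by
    have : extendSeries (A + B) = extendSeries A + extendSeries B := by
      refine TensorProduct.ext' fun v f => ?_
      simp [extendSeries]
    rw [this, LinearMap.add_comp]
  map_smul' c A := by
    have : extendSeries (c • A) = c • extendSeries A := by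
      refine TensorProduct.ext' fun v f => ?_
      simp only [extendSeries, TensorProduct.lift.tmul, LinearMap.mk₂_apply, LinearMap.smul_apply]
      exact (smul_comm c (HahnSeries.ofPowerSeries ℤ ℂ f) (A v)).symm
    rw [this, LinearMap.smul_comp]; rfl

end VertexAlgebra

/-! ### The data `(H,𝒮)` attached to `R(x)` -/

section Data

variable (U : Type u) [AddCommGroup U] [Module ℂ U]

/-- `H = U ⊕ U*`. -/
abbrev HSpace : Type u := U × Module.Dual ℂ U

/-- `⟨u + u*, v + v*⟩ = ⟨u*, v⟩ - ⟨v*, u⟩`. -/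
def symp : LinearMap.BilinForm ℂ (HSpace U) :=
  LinearMap.mk₂ ℂ (fun p q => p.2 q.1 - q.2 p.1)
    (fun p p' q => by simp; ring) (fun c p q => by simp; ring)
    (fun p q q' => by simp; ring) (fun c p q => by simp; ring)

variable {U}

/-- `A⁻¹(x)` for a power series `A(x)` with `A(0) = 1`. -/
def seriesInv {E : Type v} [Ring E] (A : PowerSeries E) : PowerSeries E :=
  PowerSeries.invOfUnit A 1

/-- `R*(x) ∈ (End U*)[[x]]`, given by `⟨R*(x)u*, u⟩ = ⟨u*, R⁻¹(x)u⟩`. -/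
def dualSeries (R : PowerSeries (Module.End ℂ U)) :
    PowerSeries (Module.End ℂ (Module.Dual ℂ U)) :=
  PowerSeries.mk fun n => (PowerSeries.coeff n (seriesInv R)).dualMap

/-- An endomorphism of `U`, extended by zero on `U*` to an endomorphism of `H`. -/
def onU (f : Module.End ℂ U) : Module.End ℂ (HSpace U) :=
  LinearMap.inl ℂ U (Module.Dual ℂ U) ∘ₗ f ∘ₗ LinearMap.fst ℂ U (Module.Dual ℂ U)

/-- An endomorphism of `U*`, extended by zero on `U` to an endomorphism of `H`. -/
def onDual (f : Module.End ℂ (Module.Dual ℂ U)) : Module.End ℂ (HSpace U) :=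
  LinearMap.inr ℂ U (Module.Dual ℂ U) ∘ₗ f ∘ₗ LinearMap.snd ℂ U (Module.Dual ℂ U)

/-- `𝒮(x) = ∑ₙ Sₙ xⁿ`, given for `u, v ∈ U` and `u*, v* ∈ U*` by
`𝒮(x)(u ⊗ v) = R(-x)u ⊗ R⁻¹(x)v`, `𝒮(x)(u* ⊗ v*) = (R*)⁻¹(-x)u* ⊗ R*(x)v*`,
`𝒮(x)(v* ⊗ u) = R*(-x)v* ⊗ R(x)u`, `𝒮(x)(u ⊗ v*) = R⁻¹(-x)u ⊗ (R*)⁻¹(x)v*`. -/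
def SOp (R : PowerSeries (Module.End ℂ U)) :
    PowerSeries (Module.End ℂ (HSpace U ⊗[ℂ] HSpace U)) :=
  PowerSeries.mk fun n => ∑ p ∈ Finset.HasAntidiagonal.antidiagonal n, (-1 : ℂ) ^ p.1 •
    (TensorProduct.map (onU (PowerSeries.coeff p.1 R))
        (onU (PowerSeries.coeff p.2 (seriesInv R)))
      + TensorProduct.map (onDual (PowerSeries.coeff p.1 (seriesInv (dualSeries R))))
        (onDual (PowerSeries.coeff p.2 (dualSeries R)))
      + TensorProduct.map (onDual (PowerSeries.coeff p.1 (dualSeries R)))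
        (onU (PowerSeries.coeff p.2 R))
      + TensorProduct.map (onU (PowerSeries.coeff p.1 (seriesInv R)))
        (onDual (PowerSeries.coeff p.2 (seriesInv (dualSeries R)))))

end Data

/-! ### The Heisenberg Lie algebra and `V_ℋ` -/

section Heisenberg

attribute [local instance 100] LieRing.ofAssociativeRing

variable (U : Type u) [AddCommGroup U] [Module ℂ U]

/-- The Heisenberg Lie algebra `ℋ = (U ⊕ U*) ⊗ ℂ[t,t⁻¹] ⊕ ℂc`; the element `a ⊗ tⁿ` is
`(Finsupp.single n a, 0)` and `c` is `(0, 1)`. -/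
def Heis : Type u := (ℤ →₀ HSpace U) × ℂ

instance : AddCommGroup (Heis U) := inferInstanceAs (AddCommGroup ((ℤ →₀ HSpace U) × ℂ))

instance : Module ℂ (Heis U) := inferInstanceAs (Module ℂ ((ℤ →₀ HSpace U) × ℂ))

/-- The bilinear form with value `⟨a,b⟩ δ_{m+n+1,0}` on `(a ⊗ tᵐ, b ⊗ tⁿ)`. -/
def cocycle : (ℤ →₀ HSpace U) →ₗ[ℂ] (ℤ →₀ HSpace U) →ₗ[ℂ] ℂ :=
  Finsupp.lsum ℂ fun m : ℤ =>
    (Finsupp.lapply (R := ℂ) (M := HSpace U) (-m - 1)).dualMap ∘ₗ symp U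

theorem cocycle_single (m n : ℤ) (a b : HSpace U) :
    cocycle U (Finsupp.single m a) (Finsupp.single n b) =
      if m + n + 1 = 0 then symp U a b else 0 := by
  have h : (n = -m - 1) ↔ (m + n + 1 = 0) := by omega
  simp only [cocycle, Finsupp.lsum_single, LinearMap.comp_apply, LinearMap.dualMap_apply,
    Finsupp.lapply_apply, Finsupp.single_apply, h]
  split_ifs <;> simp

theorem cocycle_skew (f g : ℤ →₀ HSpace U) : cocycle U f g = -cocycle U g f := by
  induction f using Finsupp.induction_linear with
  | zero => simp
  | add f f' hf hf' => simp only [map_add, LinearMap.add_apply, hf, hf']; ring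
  | single m a =>
    induction g using Finsupp.induction_linear with
    | zero => simp
    | add g g' hg hg' => simp only [map_add, LinearMap.add_apply, hg, hg']; ring
    | single n b =>
      rw [cocycle_single, cocycle_single, show n + m + 1 = m + n + 1 by ring]
      split_ifs
      · simp [symp]
      · simp

theorem cocycle_self (f : ℤ →₀ HSpace U) : cocycle U f f = 0 := by
  have h := cocycle_skew U f f
  linear_combination h / 2

/-- `c` is central and `[a ⊗ tᵐ, b ⊗ tⁿ] = ⟨a,b⟩ δ_{m+n+1,0} c`. -/
instance : LieRing (Heis U) where
  bracket x y := ((0, cocycle U x.1 y.1) : (ℤ →₀ HSpace U) × ℂ)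
  add_lie x y z := by
    refine Prod.ext (by exact (add_zero _).symm) ?_
    change cocycle U (x.1 + y.1) z.1 = cocycle U x.1 z.1 + cocycle U y.1 z.1
    simp
  lie_add x y z := by
    refine Prod.ext (by exact (add_zero _).symm) ?_
    change cocycle U x.1 (y.1 + z.1) = cocycle U x.1 y.1 + cocycle U x.1 z.1
    simp
  lie_self x := Prod.ext rfl (cocycle_self U x.1)
  leibniz_lie x y z := by
    refine Prod.ext (by exact (add_zero _).symm) ?_
    change cocycle U x.1 0 = cocycle U 0 z.1 + cocycle U y.1 0
    simp

instance : LieAlgebra ℂ (Heis U) where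
  lie_smul c x y := by
    refine Prod.ext (by exact (smul_zero _).symm) ?_
    change cocycle U x.1 (c • y.1) = c • cocycle U x.1 y.1
    simp

/-- The universal enveloping algebra `U(ℋ)`. -/
abbrev UHeis : Type u := UniversalEnvelopingAlgebra ℂ (Heis U)

/-- The inclusion of `(U ⊕ U*) ⊗ ℂ[t,t⁻¹]` into `ℋ`. -/
def heisLoop : (ℤ →₀ HSpace U) →ₗ[ℂ] Heis U := LinearMap.inl ℂ (ℤ →₀ HSpace U) ℂ

/-- The central element `c` of `ℋ`. -/
def heisC : Heis U := ((0, 1) : (ℤ →₀ HSpace U) × ℂ)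

/-- The left ideal of `U(ℋ)` generated by `a ⊗ tⁿ` for `a ∈ U ⊕ U*`, `n ≥ 0`, and by `c - 1`. -/
def heisIdeal : Submodule (UHeis U) (UHeis U) :=
  Submodule.span (UHeis U)
    ({z | ∃ (a : HSpace U) (n : ℤ), 0 ≤ n ∧
        z = UniversalEnvelopingAlgebra.ι ℂ (heisLoop U (Finsupp.single n a))} ∪
      {UniversalEnvelopingAlgebra.ι ℂ (heisC U) - 1})

/-- The induced module `V_ℋ = U(ℋ) ⊗_{U(ℋ^{≥0})} ℂ`, where `(U ⊕ U*) ⊗ ℂ[t]` acts on `ℂ` as zero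
and `c` acts as the identity, presented as the quotient of `U(ℋ)` by the left ideal generated by
the kernel of the character `U(ℋ^{≥0}) → ℂ`. -/
abbrev VHeis : Type u := UHeis U ⧸ heisIdeal U

/-- The vacuum vector `𝟏 = 1 ⊗ 1` of `V_ℋ`. -/
def vac : VHeis U := Submodule.Quotient.mk 1

/-- The operator `a(n)` on `V_ℋ`, by which `a ⊗ tⁿ ∈ ℋ` acts. -/
def heisMode (n : ℤ) : HSpace U →ₗ[ℂ] Module.End ℂ (VHeis U) :=
  (Algebra.lsmul ℂ ℂ (VHeis U) : UHeis U →ₐ[ℂ] Module.End ℂ (VHeis U)).toLinearMap ∘ₗ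
    (UniversalEnvelopingAlgebra.ι (L := Heis U) ℂ).toLinearMap ∘ₗ
    heisLoop U ∘ₗ Finsupp.lsingle n

/-- The embedding `U ⊕ U* → V_ℋ`, `a ↦ a(-1)𝟏`. -/
def state : HSpace U →ₗ[ℂ] VHeis U := (heisMode U (-1)).flip (vac U)

/-- `Y` is a vertex algebra structure on `V_ℋ` with vacuum vector `𝟏` such that
`Y(a,x) = a(x) = ∑ₙ a(n) x^(-n-1)` for `a ∈ U ⊕ U*`. -/
def IsHeisVA (Y : VHeis U →ₗ[ℂ] VertexOperator ℂ (VHeis U)) : Prop :=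
  IsVertexAlgebra (vac U) Y ∧ ∀ (a : HSpace U) (n : ℤ), (Y (state U a))[[n]] = heisMode U n a

variable {U}

/-- The characterizing properties of the pair `Δ⁺(x) = Δ_R⁺(x)`, `Δ⁻(x) = Δ_R⁻(x)` of
pseudo-endomorphisms of `(V_ℋ, Y)`. -/
structure IsDeltaPair (R : PowerSeries (Module.End ℂ U))
    (Y : VHeis U →ₗ[ℂ] VertexOperator ℂ (VHeis U))
    (Δp Δm : VHeis U →ₗ[ℂ] VHeis U ⊗[ℂ] PowerSeries ℂ) : Prop where
  /-- `Δ⁺(x)u = R(x)u` -/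
  plus_U : ∀ (u : U) (n : ℕ),
    dcoeff Δp n (state U (u, 0)) = state U (PowerSeries.coeff n R u, 0)
  /-- `Δ⁻(x)u = R⁻¹(x)u` -/
  minus_U : ∀ (u : U) (n : ℕ),
    dcoeff Δm n (state U (u, 0)) = state U (PowerSeries.coeff n (seriesInv R) u, 0)
  /-- `Δ⁺(x)u* = R*(x)u*` -/
  plus_dual : ∀ (f : Module.Dual ℂ U) (n : ℕ),
    dcoeff Δp n (state U (0, f)) = state U (0, PowerSeries.coeff n (dualSeries R) f)
  /-- `Δ⁻(x)u* = (R*)⁻¹(x)u*` -/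
  minus_dual : ∀ (f : Module.Dual ℂ U) (n : ℕ),
    dcoeff Δm n (state U (0, f)) = state U (0, PowerSeries.coeff n (seriesInv (dualSeries R)) f)
  plus_pseudo : IsPseudoEnd (vac U) Y Δp
  minus_pseudo : IsPseudoEnd (vac U) Y Δm
  /-- `Δ⁺(x₁)Δ⁺(x₂) = Δ⁺(x₂)Δ⁺(x₁)` -/
  comm_plus : ∀ m n : ℕ, dcoeff Δp m * dcoeff Δp n = dcoeff Δp n * dcoeff Δp m
  /-- `Δ⁻(x₁)Δ⁻(x₂) = Δ⁻(x₂)Δ⁻(x₁)` -/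
  comm_minus : ∀ m n : ℕ, dcoeff Δm m * dcoeff Δm n = dcoeff Δm n * dcoeff Δm m
  /-- `Δ⁺(x₁)Δ⁻(x₂) = Δ⁻(x₂)Δ⁺(x₁)` -/
  comm_mixed : ∀ m n : ℕ, dcoeff Δp m * dcoeff Δm n = dcoeff Δm n * dcoeff Δp m
  /-- `Δ⁺(x)Δ⁻(x) = 1` -/
  plus_minus : PowerSeries.mk (dcoeff Δp) * PowerSeries.mk (dcoeff Δm) = 1
  /-- `Δ⁻(x)Δ⁺(x) = 1` -/
  minus_plus : PowerSeries.mk (dcoeff Δm) * PowerSeries.mk (dcoeff Δp) = 1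

/-- The operators `a_R(n)`, where `a_R(x) = ∑ₙ a_R(n) x^(-n-1)` is given by
`u_R(x) = Y(u,x)Δ⁺(x)` for `u ∈ U` and `u*_R(x) = Y(u*,x)Δ⁻(x)` for `u* ∈ U*`. -/
def twistMode (Y : VHeis U →ₗ[ℂ] VertexOperator ℂ (VHeis U))
    (Δp Δm : VHeis U →ₗ[ℂ] VHeis U ⊗[ℂ] PowerSeries ℂ) (n : ℤ) :
    HSpace U →ₗ[ℂ] Module.End ℂ (VHeis U) :=
  LinearMap.proj n ∘ₗ VertexOperator.ncoeff ∘ₗ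
    (twistField Δp ∘ₗ Y ∘ₗ state U ∘ₗ
        LinearMap.inl ℂ U (Module.Dual ℂ U) ∘ₗ LinearMap.fst ℂ U (Module.Dual ℂ U)
      + twistField Δm ∘ₗ Y ∘ₗ state U ∘ₗ
        LinearMap.inr ℂ U (Module.Dual ℂ U) ∘ₗ LinearMap.snd ℂ U (Module.Dual ℂ U))

/-- The `T(H ⊗ ℂ[t,t⁻¹])`-module structure on `V_ℋ` in which `a ⊗ tⁿ` acts as `a_R(n)`. -/
def twistRep (Y : VHeis U →ₗ[ℂ] VertexOperator ℂ (VHeis U))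
    (Δp Δm : VHeis U →ₗ[ℂ] VHeis U ⊗[ℂ] PowerSeries ℂ) : LoopRep (HSpace U) (VHeis U) :=
  TensorAlgebra.lift ℂ (Finsupp.lsum ℂ (twistMode Y Δp Δm))

end Heisenberg

end ZF

end

/-!
# The universal vacuum `(H,𝒮)`-module attached to `R(x)`

The space `V_ℋ` carries both structures that the theorem compares: it is a vertex algebra, and the
twisted fields `a_R(x) = Y(a,x)Δ_R^±(x)` make it a vacuum `(H,𝒮)`-module whose associated graded module
is that of the Fock space. Universality of `V(H,𝒮)` and a generator count then give the isomorphism.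

*Vertex algebra.* For locally finite fields, the products `A₍ₖ₎B` satisfy the commutator formula
satisfied by the modes of the fields (`fieldProd_commutator`). Hence the space of all fields on `V_ℋ`,
with `a ⊗ tⁿ` acting as `a(x)₍ₙ₎`, is a module over the Heisenberg algebra, with vacuum vector the
field `1`, and the universal property of `V_ℋ` (`exists_heisHom`) yields the state-field correspondence
`heisY`. The Jacobi identity follows by induction on the second vector (`jacobiAt`), starting from
`Y(v₋ᵣ₋₁𝟏,x) = ∂⁽ʳ⁾Y(v,x)`.

*Pseudo-endomorphisms.* A map `Δ(x)` with `Δ(x)Y(v,z) = Y(Δ(x-z)v,z)Δ(x)` is a homomorphism from `V_ℋ` to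
the tensor product of `V_ℋ` with the commutative vertex algebra `ℂ[[x]]` with derivation `-d/dx`
(`tensorY`, `tensorY_iterate`). By the universal property of `V_ℋ`, any `P(x) ∈ (End H)[[x]]` that
preserves the form on `H` extends to such a map (`deltaMap`). Both `(R, R*)` and its inverse preserve
the form, and identities between pseudo-endomorphisms can be checked on `H`.

*The relation.* Moving `Δ^ε(x)` past `Y(b,y)` gives
`a_R(x)b_R(y) = Y(a,x)Y(Δ^ε(x-y)b,y)Δ^ε(x)Δ^η(y)` (`twistedProd_eq`). The series `𝒮` is made such that it
cancels the factor `Δ^ε(x-y)` in the product in the opposite order (`sum_subVar_pow_twistedProd`).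
What remains is the commutator of `Y(a,x)` and `Y(b,y)`, which is `⟨a,b⟩` times a delta function, and
`Δ^ε(x)Δ^η(x) = 1` whenever `⟨a,b⟩` does not vanish (`twistedProd_relation`).

*PBW type and the isomorphism.* In a vacuum `(H,𝒮)`-module, `a(n)` maps `W[k]` to `W[k-n]`, and the
operators `a(-m)` commute up to lower terms since `𝒮(0) = 1`. So `gr W` is always a cyclic module over
`S(H ⊗ t⁻¹ℂ[t⁻¹])`, and it is free as soon as there is a homomorphism from it to the symmetric algebra
with `e ↦ 1` (`IsSymbol`, `IsSymbol.isPBW`). Such a symbol map for `V_ℋ` comes from the Fock space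
realization (`heisSymbol`); it is also one for the twisted action because `a_R(-m)` and `a(-m)` agree
up to lower terms (`twistedRep_isSymbol`). Its pullback along the homomorphism `V(H,𝒮) → V_ℋ` is a
symbol map for `V(H,𝒮)`, which proves the PBW property of `V(H,𝒮)` and the injectivity of that
homomorphism at the same time.
-/

open scoped TensorProduct DirectSum VertexOperator
open Finset.HasAntidiagonal (antidiagonal)

noncomputable section

namespace ZF

universe u v w

/-! ### Locally finite sums -/

section LocallyFinite

theorem finsum_eq_sum_range {M : Type*} [AddCommMonoid M] {f : ℕ → M} {n : ℕ}
    (h : ∀ j, n ≤ j → f j = 0) : ∑ᶠ j, f j = ∑ j ∈ Finset.range n, f j := by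
  refine finsum_eq_sum_of_support_subset _ fun j hj => ?_
  by_contra hn
  exact hj (h j (by simpa using hn))

theorem finsum_finsum_eq_sum_antidiagonal {M : Type*} [AddCommMonoid M] {f : ℕ → ℕ → M} {n : ℕ}
    (h : ∀ i j, n ≤ i + j → f i j = 0) :
    ∑ᶠ i, ∑ᶠ j, f i j =
      ∑ t ∈ Finset.range n, ∑ p ∈ antidiagonal t, f p.1 p.2 := by
  have h1 : ∀ i, ∑ᶠ j, f i j = ∑ j ∈ Finset.range (n - i), f i j := fun i =>
    finsum_eq_sum_range fun j hj => h i j (by omega)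
  simp only [h1]
  rw [finsum_eq_sum_range (n := n)]
  · rw [Finset.sum_sigma', Finset.sum_sigma']
    refine Finset.sum_bij' (fun x _ => ⟨x.1 + x.2, (x.1, x.2)⟩) (fun x _ => ⟨x.2.1, x.2.2⟩)
      ?_ ?_ ?_ ?_ ?_
    · rintro ⟨i, j⟩ hx
      simp only [Finset.mem_sigma, Finset.mem_range] at hx ⊢
      exact ⟨by omega, Finset.HasAntidiagonal.mem_antidiagonal.2 rfl⟩
    · rintro ⟨t, i, j⟩ hx
      simp only [Finset.mem_sigma, Finset.mem_range, Finset.HasAntidiagonal.mem_antidiagonal] at hx ⊢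
      omega
    · rintro ⟨i, j⟩ _
      rfl
    · rintro ⟨t, i, j⟩ hx
      simp only [Finset.mem_sigma, Finset.mem_range, Finset.HasAntidiagonal.mem_antidiagonal] at hx
      obtain ⟨_, rfl⟩ := hx
      rfl
    · rintro ⟨i, j⟩ _
      rfl
  · intro j hj
    simp [Nat.sub_eq_zero_of_le hj]

variable {M : Type*} {N : Type*} [AddCommGroup M] [Module ℂ M] [AddCommGroup N] [Module ℂ N]

theorem map_finsum_of_eventually {f : ℕ → M} (h : ∃ n, ∀ j, n ≤ j → f j = 0) (g : M →ₗ[ℂ] N) :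
    g (∑ᶠ j, f j) = ∑ᶠ j, g (f j) := by
  obtain ⟨n, hn⟩ := h
  rw [finsum_eq_sum_range hn, finsum_eq_sum_range (f := fun j => g (f j)) (n := n)
    (fun j hj => by rw [hn j hj, map_zero]), map_sum]

theorem finsum_add_of_eventually {M : Type*} [AddCommGroup M] {f g : ℕ → M} (hf : ∃ n, ∀ j, n ≤ j → f j = 0)
    (hg : ∃ n, ∀ j, n ≤ j → g j = 0) : ∑ᶠ j, (f j + g j) = ∑ᶠ j, f j + ∑ᶠ j, g j := by
  obtain ⟨n, hn⟩ := hf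
  obtain ⟨m, hm⟩ := hg
  rw [finsum_eq_sum_range (f := f) (n := max n m) (fun j hj => hn j (by omega)),
    finsum_eq_sum_range (f := g) (n := max n m) (fun j hj => hm j (by omega)),
    finsum_eq_sum_range (n := max n m) (fun j hj => by
      rw [hn j (by omega), hm j (by omega), add_zero]), Finset.sum_add_distrib]

theorem finsum_smul_of_eventually {f : ℕ → M} (hf : ∃ n, ∀ j, n ≤ j → f j = 0) (c : ℂ) :
    ∑ᶠ j, c • f j = c • ∑ᶠ j, f j :=
  (map_finsum_of_eventually hf (c • LinearMap.id)).symm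

/-- The sum of a sequence of linear maps of which only finitely many are non-zero on any given
vector. -/
def locSum (f : ℕ → M →ₗ[ℂ] N) (h : ∀ v, ∃ n, ∀ j, n ≤ j → f j v = 0) : M →ₗ[ℂ] N where
  toFun v := ∑ᶠ j, f j v
  map_add' v w := by
    simp only [map_add]
    exact finsum_add_of_eventually (h v) (h w)
  map_smul' c v := by
    simp only [map_smul, RingHom.id_apply]
    exact finsum_smul_of_eventually (h v) c

theorem locSum_apply (f : ℕ → M →ₗ[ℂ] N) (h : ∀ v, ∃ n, ∀ j, n ≤ j → f j v = 0) (v : M) :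
    locSum f h v = ∑ᶠ j, f j v := rfl

/-- Two locally finite sums may be interchanged. -/
theorem finsum_comm_of_bounded {M : Type*} [AddCommMonoid M] {f : ℕ → ℕ → M} {n : ℕ} (h : ∀ i j, n ≤ i + j → f i j = 0) :
    ∑ᶠ i, ∑ᶠ j, f i j = ∑ᶠ j, ∑ᶠ i, f i j := by
  rw [finsum_finsum_eq_sum_antidiagonal h,
    finsum_finsum_eq_sum_antidiagonal (f := fun j i => f i j) (n := n)
      (fun i j hij => h j i (by omega))]
  refine Finset.sum_congr rfl fun t _ => ?_
  rw [← Finset.Nat.sum_antidiagonal_swap]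
  rfl

end LocallyFinite

/-! ### Binomial coefficients with integral upper argument -/

section Binomial

/-- The binomial coefficient `(k choose i)` for `k ∈ ℤ`, as a complex number. -/
def bin (k : ℤ) (i : ℕ) : ℂ := ((Ring.choose k i : ℤ) : ℂ)

@[simp] theorem bin_zero (k : ℤ) : bin k 0 = 1 := by simp [bin]

@[simp] theorem bin_one (k : ℤ) : bin k 1 = k := by simp [bin]

theorem bin_natCast (k i : ℕ) : bin k i = (k.choose i : ℂ) := by
  simp [bin, Ring.choose_natCast]

theorem bin_zero_succ (i : ℕ) : bin 0 (i + 1) = 0 := by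
  simp [bin, Ring.choose_zero_succ]

theorem bin_zero_left (i : ℕ) : bin 0 i = if i = 0 then 1 else 0 := by
  cases i with
  | zero => simp
  | succ i => simp [bin_zero_succ]

/-- The Vandermonde identity. -/
theorem bin_add (k l : ℤ) (t : ℕ) :
    bin (k + l) t = ∑ p ∈ antidiagonal t, bin k p.1 * bin l p.2 := by
  simp only [bin]
  rw [Ring.add_choose_eq t (Commute.all k l)]
  push_cast
  rfl

/-- Upper negation. -/
theorem bin_neg (k : ℤ) (i : ℕ) : bin (-k) i = (-1) ^ i * bin (k + i - 1) i := by
  simp only [bin]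
  rw [Ring.choose_neg, Int.negOnePow_def, Units.smul_def]
  simp

/-- Trinomial revision. -/
theorem bin_mul_bin (k : ℤ) (i s : ℕ) :
    bin k (i + s) * ((i + s).choose s : ℂ) = bin k s * bin (k - s) i := by
  have h := Ring.choose_smul_choose k (Nat.le_add_left s i)
  rw [Nat.add_sub_cancel, nsmul_eq_mul] at h
  simp only [bin]
  rw [mul_comm]
  exact_mod_cast h

theorem bin_mul_bin_sub (k : ℤ) (i s : ℕ) :
    bin k i * bin (k - i) s = bin k s * bin (k - s) i := by
  rw [← bin_mul_bin, ← bin_mul_bin, add_comm s i, Nat.choose_symm_add]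

/-- Trinomial revision, for `i` not assumed to be at least `s`. -/
theorem bin_mul_bin_natCast (k : ℤ) (i s : ℕ) :
    bin k i * bin i s = if s ≤ i then bin k s * bin (k - s) (i - s) else 0 := by
  split_ifs with h
  · obtain ⟨j, rfl⟩ := Nat.exists_eq_add_of_le' h
    rw [Nat.add_sub_cancel, ← bin_mul_bin, bin_natCast]
  · rw [bin_natCast, Nat.choose_eq_zero_of_lt (by omega)]
    simp

end Binomial

/-! ### Products of fields -/

section Fields

variable {V : Type v} [AddCommGroup V] [Module ℂ V]

theorem exists_ncoeff_eq_zero (A : VertexOperator ℂ V) (w : V) :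
    ∃ N : ℤ, ∀ n : ℤ, N ≤ n → (A[[n]]) w = 0 :=
  ⟨-HahnSeries.order ((HahnModule.of ℂ).symm (A w)), fun n hn =>
    VertexOperator.ncoeff_eq_zero_of_lt_order A n w (by omega)⟩

theorem exists_ncoeff_add_eq_zero (A : VertexOperator ℂ V) (n : ℤ) (w : V) :
    ∃ N : ℕ, ∀ j : ℕ, N ≤ j → (A[[n + j]]) w = 0 := by
  obtain ⟨N, hN⟩ := exists_ncoeff_eq_zero A w
  exact ⟨(N - n).toNat, fun j hj => hN _ (by omega)⟩

theorem vertexOperator_ext {A B : VertexOperator ℂ V} (h : ∀ n w, (A[[n]]) w = (B[[n]]) w) :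
    A = B := by
  apply HVertexOperator.coeff_inj
  funext n
  ext w
  rw [VertexOperator.coeff_eq_ncoeff, VertexOperator.coeff_eq_ncoeff]
  exact h _ w

/-- The field with prescribed modes. -/
def ofModes (f : ℤ → Module.End ℂ V) (h : ∀ w, ∃ N : ℤ, ∀ n : ℤ, N ≤ n → f n w = 0) :
    VertexOperator ℂ V :=
  VertexOperator.of_coeff (fun n => f (-n - 1)) fun w => by
    obtain ⟨N, hN⟩ := h w
    refine ⟨-N - 1, fun n hn => ?_⟩
    by_contra hlt
    exact hn (hN _ (by omega))

@[simp] theorem ofModes_ncoeff (f : ℤ → Module.End ℂ V)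
    (h : ∀ w, ∃ N : ℤ, ∀ n : ℤ, N ≤ n → f n w = 0) (n : ℤ) : (ofModes f h)[[n]] = f n := by
  rw [ofModes, VertexOperator.ncoeff_of_coeff]
  congr 1
  ring

/-- The field `1`. -/
def oneField : VertexOperator ℂ V :=
  ofModes (fun n => if n = -1 then 1 else 0) fun w => ⟨0, fun n hn => by
    rw [if_neg (by omega)]; rfl⟩

theorem oneField_ncoeff (n : ℤ) :
    (oneField : VertexOperator ℂ V)[[n]] = if n = -1 then 1 else 0 := by
  rw [oneField, ofModes_ncoeff]

/-- Multiplication of a field by `zᵐ`. -/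
def shift (m : ℤ) : VertexOperator ℂ V →ₗ[ℂ] VertexOperator ℂ V where
  toFun A := ofModes (fun n => A[[n + m]]) fun w => by
    obtain ⟨N, hN⟩ := exists_ncoeff_eq_zero A w
    exact ⟨N - m, fun n hn => hN _ (by omega)⟩
  map_add' A B := vertexOperator_ext fun n w => by simp
  map_smul' c A := vertexOperator_ext fun n w => by simp

@[simp] theorem shift_ncoeff (m n : ℤ) (A : VertexOperator ℂ V) :
    (shift m A)[[n]] = A[[n + m]] := by
  rw [shift]; simp

/-- The first half of the `k`-th product: the field `B ↦ Res_x (x - z)ᵏ A(x) B(z)`, with `(x - z)ᵏ` expanded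
in nonnegative powers of `z`. -/
def leftProd (A : VertexOperator ℂ V) (k : ℤ) : VertexOperator ℂ V →ₗ[ℂ] VertexOperator ℂ V where
  toFun B := ofModes (fun n => locSum
      (fun j : ℕ => ((-1 : ℂ) ^ j * bin k j) • (A[[k - j]] * B[[n + j]])) fun w => by
        obtain ⟨N, hN⟩ := exists_ncoeff_add_eq_zero B n w
        exact ⟨N, fun j hj => by simp [hN j hj]⟩) fun w => by
    obtain ⟨N, hN⟩ := exists_ncoeff_eq_zero B w
    refine ⟨N, fun n hn => ?_⟩
    rw [locSum_apply]
    exact finsum_eq_zero_of_forall_eq_zero fun j => by simp [hN (n + j) (by omega)]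
  map_add' B B' := vertexOperator_ext fun n w => by
    simp only [ofModes_ncoeff, locSum_apply, map_add, LinearMap.add_apply, Pi.add_apply]
    rw [← finsum_add_of_eventually]
    · refine finsum_congr fun j => ?_
      simp
    · obtain ⟨N, hN⟩ := exists_ncoeff_add_eq_zero B n w
      exact ⟨N, fun j hj => by simp [hN j hj]⟩
    · obtain ⟨N, hN⟩ := exists_ncoeff_add_eq_zero B' n w
      exact ⟨N, fun j hj => by simp [hN j hj]⟩
  map_smul' c B := vertexOperator_ext fun n w => by
    simp only [ofModes_ncoeff, locSum_apply, map_smul, LinearMap.smul_apply, Pi.smul_apply,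
      RingHom.id_apply]
    rw [← finsum_smul_of_eventually]
    · refine finsum_congr fun j => ?_
      simp [smul_smul, mul_comm c]
    · obtain ⟨N, hN⟩ := exists_ncoeff_add_eq_zero B n w
      exact ⟨N, fun j hj => by simp [hN j hj]⟩

theorem leftProd_apply (A B : VertexOperator ℂ V) (k n : ℤ) (w : V) :
    ((leftProd A k B)[[n]]) w =
      ∑ᶠ j : ℕ, ((-1 : ℂ) ^ j * bin k j) • (A[[k - j]]) ((B[[n + j]]) w) := by
  rw [leftProd]
  simp [locSum_apply]

/-- The second half of the `k`-th product: the field `B ↦ Res_x (-z + x)ᵏ B(z) A(x)`, with `(-z + x)ᵏ` expanded in nonnegative powers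
of `x`. -/
def rightProd (A : VertexOperator ℂ V) (k : ℤ) :
    VertexOperator ℂ V →ₗ[ℂ] VertexOperator ℂ V where
  toFun B := ofModes (fun n => locSum
      (fun j : ℕ => ((-1 : ℂ) ^ k * (-1 : ℂ) ^ j * bin k j) • (B[[n + k - j]] * A[[(j : ℤ)]]))
      fun w => by
        obtain ⟨N, hN⟩ := exists_ncoeff_add_eq_zero A 0 w
        refine ⟨N, fun j hj => ?_⟩
        have := hN j hj
        rw [zero_add] at this
        simp [this]) fun w => by
    obtain ⟨N, hN⟩ := exists_ncoeff_add_eq_zero A 0 w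
    have h1 : ∀ j : ℕ, ∃ M : ℤ, ∀ n : ℤ, M ≤ n → (B[[n + k - j]]) ((A[[(j : ℤ)]]) w) = 0 := by
      intro j
      obtain ⟨M, hM⟩ := exists_ncoeff_eq_zero B ((A[[(j : ℤ)]]) w)
      exact ⟨M - k + j, fun n hn => hM _ (by omega)⟩
    choose M hM using h1
    refine ⟨∑ j ∈ Finset.range N, |M j|, fun n hn => ?_⟩
    rw [locSum_apply]
    refine finsum_eq_zero_of_forall_eq_zero fun j => ?_
    by_cases hj : N ≤ j
    · have := hN j hj
      rw [zero_add] at this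
      simp [this]
    · have h2 : |M j| ≤ ∑ j ∈ Finset.range N, |M j| :=
        Finset.single_le_sum (f := fun j => |M j|) (fun i _ => abs_nonneg (M i)) (by simpa using hj)
      simp [hM j n (by have := le_abs_self (M j); omega)]
  map_add' B B' := vertexOperator_ext fun n w => by
    simp only [ofModes_ncoeff, locSum_apply, map_add, LinearMap.add_apply, Pi.add_apply]
    obtain ⟨N, hN⟩ := exists_ncoeff_add_eq_zero A 0 w
    simp only [zero_add] at hN
    rw [← finsum_add_of_eventually]
    · refine finsum_congr fun j => ?_
      simp
    · exact ⟨N, fun j hj => by simp [hN j hj]⟩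
    · exact ⟨N, fun j hj => by simp [hN j hj]⟩
  map_smul' c B := vertexOperator_ext fun n w => by
    simp only [ofModes_ncoeff, locSum_apply, map_smul, LinearMap.smul_apply, Pi.smul_apply,
      RingHom.id_apply]
    obtain ⟨N, hN⟩ := exists_ncoeff_add_eq_zero A 0 w
    simp only [zero_add] at hN
    rw [← finsum_smul_of_eventually]
    · refine finsum_congr fun j => ?_
      simp [smul_smul, mul_comm c]
    · exact ⟨N, fun j hj => by simp [hN j hj]⟩

theorem rightProd_apply (A B : VertexOperator ℂ V) (k n : ℤ) (w : V) :
    ((rightProd A k B)[[n]]) w =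
      ∑ᶠ j : ℕ, ((-1 : ℂ) ^ k * (-1 : ℂ) ^ j * bin k j) •
        (B[[n + k - j]]) ((A[[(j : ℤ)]]) w) := by
  rw [rightProd]
  simp [locSum_apply]

/-- The `k`-th product of fields,
`A₍ₖ₎B(z) = Res_x ((x - z)ᵏ A(x) B(z) - (-z + x)ᵏ B(z) A(x))`. -/
def fieldProd (A : VertexOperator ℂ V) (k : ℤ) :
    VertexOperator ℂ V →ₗ[ℂ] VertexOperator ℂ V :=
  leftProd A k - rightProd A k

theorem fieldProd_apply (A B : VertexOperator ℂ V) (k n : ℤ) (w : V) :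
    ((fieldProd A k B)[[n]]) w =
      ∑ᶠ j : ℕ, ((-1 : ℂ) ^ j * bin k j) • (A[[k - j]]) ((B[[n + j]]) w) -
      ∑ᶠ j : ℕ, ((-1 : ℂ) ^ k * (-1 : ℂ) ^ j * bin k j) •
        (B[[n + k - j]]) ((A[[(j : ℤ)]]) w) := by
  rw [← leftProd_apply, ← rightProd_apply, fieldProd]
  simp

theorem leftProd_rightProd_comm (A B X : VertexOperator ℂ V) (k l : ℤ) :
    leftProd A k (rightProd B l X) = rightProd B l (leftProd A k X) := by
  refine vertexOperator_ext fun n w => ?_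
  obtain ⟨J, hJ⟩ := exists_ncoeff_add_eq_zero B 0 w
  simp only [zero_add] at hJ
  have h1 : ∀ j : ℕ, ∃ M : ℕ, ∀ i : ℕ, M ≤ i → (X[[n + l - j + i]]) ((B[[(j : ℤ)]]) w) = 0 :=
    fun j => exists_ncoeff_add_eq_zero X (n + l - j) _
  choose M hM using h1
  have h2 : ∀ i j : ℕ, J + ∑ j ∈ Finset.range J, M j ≤ i + j →
      (X[[n + l - j + i]]) ((B[[(j : ℤ)]]) w) = 0 := by
    intro i j hij
    by_cases hj : J ≤ j
    · rw [hJ j hj, map_zero]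
    · have h2 : M j ≤ ∑ j ∈ Finset.range J, M j :=
        Finset.single_le_sum (f := fun j => M j) (fun i _ => Nat.zero_le _) (by simpa using hj)
      exact hM j i (by omega)
  have hl : ((leftProd A k (rightProd B l X))[[n]]) w =
      ∑ᶠ i : ℕ, ∑ᶠ j : ℕ, (((-1 : ℂ) ^ i * bin k i) * ((-1 : ℂ) ^ l * (-1 : ℂ) ^ j * bin l j)) •
        (A[[k - i]]) ((X[[n + l - j + i]]) ((B[[(j : ℤ)]]) w)) := by
    rw [leftProd_apply]
    refine finsum_congr fun i => ?_
    rw [rightProd_apply, map_finsum_of_eventually, ← finsum_smul_of_eventually]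
    · refine finsum_congr fun j => ?_
      rw [map_smul, smul_smul, show n + (i : ℤ) + l - j = n + l - j + i by ring]
    · exact ⟨J, fun j hj => by simp [hJ j hj]⟩
    · exact ⟨J, fun j hj => by simp [hJ j hj]⟩
  have hr : ((rightProd B l (leftProd A k X))[[n]]) w =
      ∑ᶠ j : ℕ, ∑ᶠ i : ℕ, (((-1 : ℂ) ^ i * bin k i) * ((-1 : ℂ) ^ l * (-1 : ℂ) ^ j * bin l j)) •
        (A[[k - i]]) ((X[[n + l - j + i]]) ((B[[(j : ℤ)]]) w)) := by
    rw [rightProd_apply]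
    refine finsum_congr fun j => ?_
    rw [leftProd_apply, ← finsum_smul_of_eventually]
    · refine finsum_congr fun i => ?_
      rw [smul_smul, mul_comm]
    · exact ⟨M j, fun i hi => by rw [hM j i hi, map_zero, smul_zero]⟩
  rw [hl, hr]
  exact finsum_comm_of_bounded fun i j hij => by rw [h2 i j hij, map_zero, smul_zero]

end Fields

/-! ### Commutator formulas for products of fields -/

section FieldCommutators

variable {V : Type v} [AddCommGroup V] [Module ℂ V]

theorem exists_add_bound {M : Type*} [Zero M] {f : ℕ → ℕ → M}
    (h1 : ∃ I, ∀ i, I ≤ i → ∀ j, f i j = 0) (h2 : ∀ i, ∃ J, ∀ j, J ≤ j → f i j = 0) :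
    ∃ N, ∀ i j, N ≤ i + j → f i j = 0 := by
  obtain ⟨I, hI⟩ := h1
  choose J hJ using h2
  refine ⟨I + ∑ i ∈ Finset.range I, J i, fun i j hij => ?_⟩
  by_cases hi : I ≤ i
  · exact hI i hi j
  · have h : J i ≤ ∑ i ∈ Finset.range I, J i :=
      Finset.single_le_sum (f := fun i => J i) (fun i _ => Nat.zero_le _) (by simpa using hi)
    exact hJ i j (by omega)

/-- The commutator formula `[A(p), B(q)] = ∑ₛ (p choose s) Cₛ(p + q - s)`, where `s < S`. -/
def HasCommutator (A B : VertexOperator ℂ V) (C : ℕ → VertexOperator ℂ V) (S : ℕ) : Prop :=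
  ∀ (p q : ℤ) (w : V), (A[[p]]) ((B[[q]]) w) - (B[[q]]) ((A[[p]]) w) =
    ∑ s ∈ Finset.range S, bin p s • ((C s)[[p + q - s]]) w

theorem HasCommutator.shift_right {A B : VertexOperator ℂ V} {C : ℕ → VertexOperator ℂ V} {S : ℕ}
    (h : HasCommutator A B C S) (m : ℤ) :
    HasCommutator A (shift m B) (fun s => shift m (C s)) S := by
  intro p q w
  simp only [shift_ncoeff]
  rw [h]
  refine Finset.sum_congr rfl fun s _ => ?_
  rw [show p + (q + m) - s = p + q - s + m by ring]

theorem leftProd_eq_sum (A X : VertexOperator ℂ V) (k n : ℤ) (w : V) {N : ℕ}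
    (hN : ∀ t : ℕ, N ≤ t → (X[[n + t]]) w = 0) :
    ((leftProd A k X)[[n]]) w = ∑ t ∈ Finset.range N,
      ((-1 : ℂ) ^ t * bin k t) • (A[[k - t]]) ((X[[n + t]]) w) := by
  rw [leftProd_apply]
  exact finsum_eq_sum_range fun t ht => by rw [hN t ht, map_zero, smul_zero]

theorem leftProd_leftProd_eq_sum (A B X : VertexOperator ℂ V) (k l n : ℤ) (w : V) {N : ℕ}
    (hN : ∀ t : ℕ, N ≤ t → (X[[n + t]]) w = 0) :
    ((leftProd A k (leftProd B l X))[[n]]) w = ∑ t ∈ Finset.range N, ∑ p ∈ antidiagonal t,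
      ((-1 : ℂ) ^ t * bin k p.1 * bin l p.2) •
        (A[[k - p.1]]) ((B[[l - p.2]]) ((X[[n + t]]) w)) := by
  have h : ((leftProd A k (leftProd B l X))[[n]]) w = ∑ᶠ i : ℕ, ∑ᶠ j : ℕ,
      ((-1 : ℂ) ^ (i + j) * bin k i * bin l j) •
        (A[[k - i]]) ((B[[l - j]]) ((X[[n + (i + j : ℕ)]]) w)) := by
    rw [leftProd_apply]
    refine finsum_congr fun i => ?_
    have hb : ∀ j : ℕ, N ≤ j → (X[[n + (i : ℤ) + j]]) w = 0 := fun j hj => by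
      rw [add_assoc, ← Nat.cast_add]
      exact hN _ (by omega)
    rw [leftProd_apply, map_finsum_of_eventually, ← finsum_smul_of_eventually]
    · refine finsum_congr fun j => ?_
      rw [map_smul, smul_smul]
      congr 1
      · ring
      · push_cast
        rw [add_assoc]
    · exact ⟨N, fun j hj => by simp [hb j hj]⟩
    · exact ⟨N, fun j hj => by simp [hb j hj]⟩
  rw [h, finsum_finsum_eq_sum_antidiagonal (n := N)]
  · refine Finset.sum_congr rfl fun t _ => Finset.sum_congr rfl fun p hp => ?_
    rw [Finset.HasAntidiagonal.mem_antidiagonal.1 hp]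
  · intro i j hij
    rw [hN _ hij, map_zero, map_zero, smul_zero]

/-- The commutator formula for left products. -/
theorem leftProd_commutator {A B : VertexOperator ℂ V} {C : ℕ → VertexOperator ℂ V} {S : ℕ}
    (h : HasCommutator A B C S) (k l : ℤ) (X : VertexOperator ℂ V) :
    leftProd A k (leftProd B l X) - leftProd B l (leftProd A k X) =
      ∑ s ∈ Finset.range S, bin k s • leftProd (C s) (k + l - s) X := by
  refine vertexOperator_ext fun n w => ?_
  obtain ⟨N, hN⟩ := exists_ncoeff_add_eq_zero X n w
  have h1 : (((leftProd A k (leftProd B l X) - leftProd B l (leftProd A k X)))[[n]]) w =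
      ∑ t ∈ Finset.range N, ∑ p ∈ antidiagonal t,
      ((-1 : ℂ) ^ t * bin k p.1 * bin l p.2) •
        ∑ s ∈ Finset.range S, bin (k - p.1) s • ((C s)[[k + l - s - t]]) ((X[[n + t]]) w) := by
    simp only [map_sub, Pi.sub_apply, LinearMap.sub_apply]
    rw [leftProd_leftProd_eq_sum A B X k l n w hN, leftProd_leftProd_eq_sum B A X l k n w hN,
      ← Finset.sum_sub_distrib]
    refine Finset.sum_congr rfl fun t _ => ?_
    rw [← Finset.Nat.sum_antidiagonal_swap, ← Finset.sum_sub_distrib]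
    rw [← Finset.Nat.sum_antidiagonal_swap]
    refine Finset.sum_congr rfl fun p hp => ?_
    have hp' := Finset.HasAntidiagonal.mem_antidiagonal.1 hp
    simp only [Prod.fst_swap, Prod.snd_swap]
    rw [mul_right_comm _ (bin l p.2), ← smul_sub, h]
    congr 1
    refine Finset.sum_congr rfl fun s _ => ?_
    rw [show k - (p.1 : ℤ) + (l - p.2) - s = k + l - s - t by omega]
  have h2 : ((∑ s ∈ Finset.range S, bin k s • leftProd (C s) (k + l - s) X)[[n]]) w =
      ∑ s ∈ Finset.range S, bin k s • ∑ t ∈ Finset.range N,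
        ((-1 : ℂ) ^ t * bin (k + l - s) t) • ((C s)[[k + l - s - t]]) ((X[[n + t]]) w) := by
    simp only [map_sum, Finset.sum_apply, LinearMap.sum_apply, map_smul, Pi.smul_apply,
      LinearMap.smul_apply]
    refine Finset.sum_congr rfl fun s _ => ?_
    rw [leftProd_eq_sum _ _ _ _ _ hN]
  rw [h1, h2]
  -- the coefficients of `(C s)(k + l - s - t) X(n + t)` agree by trinomial revision and Vandermonde
  simp only [Finset.smul_sum, smul_smul]
  rw [Finset.sum_comm (s := Finset.range S)]
  refine Finset.sum_congr rfl fun t _ => ?_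
  rw [Finset.sum_comm]
  refine Finset.sum_congr rfl fun s _ => ?_
  rw [← Finset.sum_smul]
  congr 1
  rw [show k + l - (s : ℤ) = (k - s) + l by ring, bin_add, Finset.mul_sum, Finset.mul_sum]
  refine Finset.sum_congr rfl fun p _ => ?_
  linear_combination ((-1 : ℂ) ^ t * bin l p.2) * bin_mul_bin_sub k p.1 s

theorem rightProd_eq_sum (A X : VertexOperator ℂ V) (k n : ℤ) (w : V) {N : ℕ}
    (hN : ∀ t : ℕ, N ≤ t → (A[[(t : ℤ)]]) w = 0) :
    ((rightProd A k X)[[n]]) w = ∑ t ∈ Finset.range N,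
      ((-1 : ℂ) ^ k * (-1 : ℂ) ^ t * bin k t) • (X[[n + k - t]]) ((A[[(t : ℤ)]]) w) := by
  rw [rightProd_apply]
  exact finsum_eq_sum_range fun t ht => by rw [hN t ht, map_zero, smul_zero]

theorem rightProd_rightProd_eq_sum (A B X : VertexOperator ℂ V) (k l n : ℤ) (w : V) {N : ℕ}
    (hN : ∀ i j : ℕ, N ≤ i + j → (B[[(j : ℤ)]]) ((A[[(i : ℤ)]]) w) = 0) :
    ((rightProd A k (rightProd B l X))[[n]]) w = ∑ t ∈ Finset.range N, ∑ p ∈ antidiagonal t,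
      ((-1 : ℂ) ^ (k + l) * (-1 : ℂ) ^ t * bin k p.1 * bin l p.2) •
        (X[[n + (k + l) - t]]) ((B[[(p.2 : ℤ)]]) ((A[[(p.1 : ℤ)]]) w)) := by
  have h : ((rightProd A k (rightProd B l X))[[n]]) w = ∑ᶠ i : ℕ, ∑ᶠ j : ℕ,
      ((-1 : ℂ) ^ (k + l) * (-1 : ℂ) ^ (i + j) * bin k i * bin l j) •
        (X[[n + (k + l) - (i + j : ℕ)]]) ((B[[(j : ℤ)]]) ((A[[(i : ℤ)]]) w)) := by
    rw [rightProd_apply]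
    refine finsum_congr fun i => ?_
    rw [rightProd_apply, ← finsum_smul_of_eventually]
    · refine finsum_congr fun j => ?_
      rw [smul_smul]
      congr 1
      · rw [zpow_add₀ (by norm_num)]
        ring
      · push_cast
        rw [show n + k - (i : ℤ) + l - j = n + (k + l) - (i + j) by ring]
    · exact ⟨N, fun j hj => by rw [hN i j (by omega), map_zero, smul_zero]⟩
  rw [h, finsum_finsum_eq_sum_antidiagonal (n := N)]
  · refine Finset.sum_congr rfl fun t _ => Finset.sum_congr rfl fun p hp => ?_
    rw [Finset.HasAntidiagonal.mem_antidiagonal.1 hp]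
  · intro i j hij
    rw [hN i j hij, map_zero, smul_zero]

theorem exists_ncoeff_ncoeff_eq_zero (A B : VertexOperator ℂ V) (w : V) :
    ∃ N : ℕ, ∀ i j : ℕ, N ≤ i + j → (B[[(j : ℤ)]]) ((A[[(i : ℤ)]]) w) = 0 := by
  refine exists_add_bound (f := fun i j : ℕ => (B[[(j : ℤ)]]) ((A[[(i : ℤ)]]) w)) ?_ fun i => ?_
  · obtain ⟨N, hN⟩ := exists_ncoeff_add_eq_zero A 0 w
    simp only [zero_add] at hN
    exact ⟨N, fun i hi j => by rw [hN i hi, map_zero]⟩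
  · obtain ⟨N, hN⟩ := exists_ncoeff_add_eq_zero B 0 ((A[[(i : ℤ)]]) w)
    simp only [zero_add] at hN
    exact ⟨N, hN⟩

/-- The sum `∑_{i + j = t} (k choose i) (l choose j) (i choose s)`, by trinomial revision and the
Vandermonde identity. -/
theorem sum_bin_mul_bin_mul_bin (k l : ℤ) (s t : ℕ) :
    ∑ p ∈ antidiagonal t, bin k p.1 * bin l p.2 * bin p.1 s =
      if s ≤ t then bin k s * bin (k + l - s) (t - s) else 0 := by
  have h : ∀ p ∈ antidiagonal t, bin k p.1 * bin l p.2 * bin p.1 s =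
      if s ≤ p.1 then bin k s * bin (k - s) (p.1 - s) * bin l p.2 else 0 := by
    intro p _
    rw [mul_right_comm, bin_mul_bin_natCast]
    split_ifs <;> simp
  rw [Finset.sum_congr rfl h]
  split_ifs with hst
  · obtain ⟨r, rfl⟩ := Nat.exists_eq_add_of_le' hst
    rw [show k + l - (s : ℤ) = (k - s) + l by ring, Nat.add_sub_cancel, bin_add, Finset.mul_sum,
      ← Finset.sum_filter]
    refine Finset.sum_bij' (fun p _ => (p.1 - s, p.2)) (fun p _ => (p.1 + s, p.2)) ?_ ?_ ?_ ?_ ?_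
    · rintro ⟨i, j⟩ hp
      simp only [Finset.mem_filter, Finset.HasAntidiagonal.mem_antidiagonal] at hp ⊢
      omega
    · rintro ⟨i, j⟩ hp
      simp only [Finset.mem_filter, Finset.HasAntidiagonal.mem_antidiagonal] at hp ⊢
      omega
    · rintro ⟨i, j⟩ hp
      simp only [Finset.mem_filter] at hp
      simp only [Prod.mk.injEq, and_true]
      omega
    · rintro ⟨i, j⟩ hp
      simp
    · rintro ⟨i, j⟩ hp
      simp only [mul_assoc]
  · refine Finset.sum_eq_zero fun p hp => ?_
    have := Finset.HasAntidiagonal.mem_antidiagonal.1 hp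
    rw [if_neg (by omega)]

/-- The commutator formula for right products. -/
theorem rightProd_commutator {A B : VertexOperator ℂ V} {C : ℕ → VertexOperator ℂ V} {S : ℕ}
    (h : HasCommutator A B C S) (k l : ℤ) (X : VertexOperator ℂ V) :
    rightProd A k (rightProd B l X) - rightProd B l (rightProd A k X) =
      -∑ s ∈ Finset.range S, bin k s • rightProd (C s) (k + l - s) X := by
  refine vertexOperator_ext fun n w => ?_
  obtain ⟨N1, hN1⟩ := exists_ncoeff_ncoeff_eq_zero A B w
  obtain ⟨N2, hN2⟩ := exists_ncoeff_ncoeff_eq_zero B A w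
  have hC : ∀ s : ℕ, ∃ M : ℕ, ∀ t : ℕ, M ≤ t → ((C s)[[(t : ℤ)]]) w = 0 := fun s => by
    obtain ⟨N, hN⟩ := exists_ncoeff_add_eq_zero (C s) 0 w
    simp only [zero_add] at hN
    exact ⟨N, hN⟩
  choose M hM using hC
  have hMs : ∀ s ∈ Finset.range S, M s ≤ ∑ s ∈ Finset.range S, M s := fun s hs =>
    Finset.single_le_sum (f := fun s => M s) (fun i _ => Nat.zero_le _) hs
  -- `N` bounds all sums over `t`, also after the shift of `t` by `s < S` below
  set T := ∑ s ∈ Finset.range S, M s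
  set N := N1 + N2 + T + S
  have h1 : ((rightProd A k (rightProd B l X) - rightProd B l (rightProd A k X))[[n]]) w =
      ∑ t ∈ Finset.range N, ∑ p ∈ antidiagonal t,
      ((-1 : ℂ) ^ (k + l) * (-1 : ℂ) ^ t * bin k p.1 * bin l p.2) •
        -(X[[n + (k + l) - t]])
          (∑ s ∈ Finset.range S, bin p.1 s • ((C s)[[(t : ℤ) - s]]) w) := by
    simp only [map_sub, Pi.sub_apply, LinearMap.sub_apply]
    rw [rightProd_rightProd_eq_sum A B X k l n w (N := N) fun i j hij => hN1 i j (by omega),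
      rightProd_rightProd_eq_sum B A X l k n w (N := N) fun i j hij => hN2 i j (by omega),
      ← Finset.sum_sub_distrib]
    refine Finset.sum_congr rfl fun t _ => ?_
    rw [← Finset.Nat.sum_antidiagonal_swap, ← Finset.sum_sub_distrib]
    rw [← Finset.Nat.sum_antidiagonal_swap]
    refine Finset.sum_congr rfl fun p hp => ?_
    have hp' := Finset.HasAntidiagonal.mem_antidiagonal.1 hp
    simp only [Prod.fst_swap, Prod.snd_swap]
    rw [mul_right_comm _ (bin l p.2), add_comm l k, ← smul_sub, ← map_sub, ← map_neg]
    congr 2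
    rw [← neg_sub, h]
    congr 1
    refine Finset.sum_congr rfl fun s _ => ?_
    rw [show (p.1 : ℤ) + p.2 - s = t - s by omega]
  have h2 : ((-∑ s ∈ Finset.range S, bin k s • rightProd (C s) (k + l - s) X)[[n]]) w =
      -∑ s ∈ Finset.range S, bin k s • ∑ t ∈ Finset.range N, if s ≤ t then
        ((-1 : ℂ) ^ (k + l) * (-1 : ℂ) ^ t * bin (k + l - s) (t - s)) •
          (X[[n + (k + l) - t]]) (((C s)[[(t : ℤ) - s]]) w) else 0 := by
    simp only [map_neg, map_sum, Finset.sum_apply, LinearMap.sum_apply, map_smul, Pi.smul_apply,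
      LinearMap.smul_apply, Pi.neg_apply, LinearMap.neg_apply]
    congr 1
    refine Finset.sum_congr rfl fun s hs => ?_
    congr 1
    have hs' : s < S := by simpa using hs
    have := hMs s hs
    rw [rightProd_eq_sum _ _ _ _ _ (N := N - s) fun t ht => hM s t (by omega),
      ← Finset.sum_filter]
    refine Finset.sum_bij' (fun t _ => t + s) (fun t _ => t - s) ?_ ?_ ?_ ?_ ?_
    · intro t ht
      simp only [Finset.mem_filter, Finset.mem_range] at ht ⊢
      omega
    · intro t ht
      simp only [Finset.mem_filter, Finset.mem_range] at ht ⊢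
      omega
    · intro t _
      simp
    · intro t ht
      simp only [Finset.mem_filter] at ht
      omega
    · intro t _
      rw [Nat.add_sub_cancel]
      push_cast
      rw [show n + (k + l - (s : ℤ)) - t = n + (k + l) - (t + s) by ring, add_sub_cancel_right]
      congr 2
      have hsq : ((-1 : ℂ) ^ s) * ((-1 : ℂ) ^ s) = 1 := by
        rw [← mul_pow]; simp
      rw [zpow_sub₀ (by norm_num), zpow_natCast, pow_add, div_eq_mul_inv,
        inv_eq_of_mul_eq_one_right hsq]
      ring
  rw [h1, h2]
  simp only [Finset.smul_sum, smul_neg, Finset.sum_neg_distrib, map_sum, map_smul, smul_smul]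
  rw [Finset.sum_comm (s := Finset.range S)]
  congr 1
  refine Finset.sum_congr rfl fun t _ => ?_
  rw [Finset.sum_comm]
  refine Finset.sum_congr rfl fun s _ => ?_
  rw [← Finset.sum_smul]
  have hsum : ∑ p ∈ antidiagonal t,
      (-1 : ℂ) ^ (k + l) * (-1 : ℂ) ^ t * bin k p.1 * bin l p.2 * bin p.1 s =
      (-1 : ℂ) ^ (k + l) * (-1 : ℂ) ^ t *
        if s ≤ t then bin k s * bin (k + l - s) (t - s) else 0 := by
    rw [← sum_bin_mul_bin_mul_bin, Finset.mul_sum]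
    refine Finset.sum_congr rfl fun p _ => ?_
    ring
  rw [hsum]
  split_ifs
  · rw [smul_smul]
    congr 1
    ring
  · simp

/-- The products of two fields satisfy the commutator formula satisfied by the fields. -/
theorem fieldProd_commutator {A B : VertexOperator ℂ V} {C : ℕ → VertexOperator ℂ V} {S : ℕ}
    (h : HasCommutator A B C S) (k l : ℤ) (X : VertexOperator ℂ V) :
    fieldProd A k (fieldProd B l X) - fieldProd B l (fieldProd A k X) =
      ∑ s ∈ Finset.range S, bin k s • fieldProd (C s) (k + l - s) X := by
  have h1 := leftProd_commutator h k l X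
  have h2 := rightProd_commutator h k l X
  have h3 := leftProd_rightProd_comm A B X k l
  have h4 := leftProd_rightProd_comm B A X l k
  simp only [fieldProd, LinearMap.sub_apply, map_sub, smul_sub, Finset.sum_sub_distrib]
  rw [← h1, h3, ← h4, sub_eq_add_neg _ (∑ s ∈ Finset.range S, _), ← h2]
  abel

end FieldCommutators

/-! ### The module `V_ℋ` -/

section HeisModule

attribute [local instance 100] LieRing.ofAssociativeRing

variable {U : Type u} [AddCommGroup U] [Module ℂ U]

theorem heisMode_apply_mk (n : ℤ) (a : HSpace U) (x : UHeis U) :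
    heisMode U n a (Submodule.Quotient.mk x) = Submodule.Quotient.mk
      (UniversalEnvelopingAlgebra.ι ℂ (heisLoop U (Finsupp.single n a)) * x) := rfl

theorem heis_decomp (x : Heis U) : x = heisLoop U x.1 + x.2 • heisC U := by
  refine Prod.ext ?_ ?_
  · change x.1 = x.1 + x.2 • (0 : ℤ →₀ HSpace U)
    simp
  · change x.2 = 0 + x.2 • (1 : ℂ)
    simp

theorem heisC_comm (x : Heis U) :
    UniversalEnvelopingAlgebra.ι ℂ (heisC U) * UniversalEnvelopingAlgebra.ι ℂ x =
      UniversalEnvelopingAlgebra.ι ℂ x * UniversalEnvelopingAlgebra.ι ℂ (heisC U) := by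
  have h : ⁅heisC U, x⁆ = 0 := by
    refine Prod.ext rfl ?_
    change cocycle U 0 x.1 = 0
    simp
  have h2 := LieHom.map_lie (UniversalEnvelopingAlgebra.ι ℂ (L := Heis U)) (heisC U) x
  rw [h, map_zero, LieRing.of_associative_ring_bracket] at h2
  exact (sub_eq_zero.1 h2.symm)

theorem uheis_induction {P : UHeis U → Prop} (one : P 1) (add : ∀ x y, P x → P y → P (x + y))
    (smul : ∀ (c : ℂ) x, P x → P (c • x))
    (mul : ∀ (h : Heis U) x, P x → P (UniversalEnvelopingAlgebra.ι ℂ h * x)) (x : UHeis U) :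
    P x := by
  -- elements `y` with `P (y * x)` for all `x` satisfying `P` form a subalgebra
  let A : Subalgebra ℂ (UHeis U) :=
    { carrier := {y | ∀ x, P x → P (y * x)}
      mul_mem' := fun {a b} ha hb x hx => by rw [mul_assoc]; exact ha _ (hb _ hx)
      add_mem' := fun {a b} ha hb x hx => by rw [add_mul]; exact add _ _ (ha _ hx) (hb _ hx)
      algebraMap_mem' := fun c x hx => by
        rw [← Algebra.smul_def]
        exact smul c x hx }
  let g : Heis U →ₗ⁅ℂ⁆ A :=
    { toFun := fun h => ⟨UniversalEnvelopingAlgebra.ι ℂ h, fun x hx => mul h x hx⟩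
      map_add' := fun h h' => Subtype.ext (by simp)
      map_smul' := fun c h => Subtype.ext (by simp)
      map_lie' := fun {h h'} => Subtype.ext (by
        rw [LieRing.of_associative_ring_bracket]
        change UniversalEnvelopingAlgebra.ι ℂ ⁅h, h'⁆ = _
        rw [LieHom.map_lie, LieRing.of_associative_ring_bracket]
        rfl) }
  have hid : A.val.comp (UniversalEnvelopingAlgebra.lift ℂ g) = AlgHom.id ℂ (UHeis U) := by
    apply UniversalEnvelopingAlgebra.hom_ext
    ext h
    simp [g]
  have hx : ((UniversalEnvelopingAlgebra.lift ℂ g x : A) : UHeis U) = x :=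
    DFunLike.congr_fun hid x
  have := (UniversalEnvelopingAlgebra.lift ℂ g x).2 1 one
  rwa [mul_one, hx] at this

theorem heisC_commutes (x : UHeis U) :
    UniversalEnvelopingAlgebra.ι ℂ (heisC U) * x = x * UniversalEnvelopingAlgebra.ι ℂ (heisC U) := by
  induction x using uheis_induction with
  | one => simp
  | add x y hx hy => rw [mul_add, add_mul, hx, hy]
  | smul c x hx => rw [mul_smul_comm, smul_mul_assoc, hx]
  | mul h x hx => rw [← mul_assoc, heisC_comm, mul_assoc, hx, mul_assoc]

theorem heisC_smul (v : VHeis U) : UniversalEnvelopingAlgebra.ι ℂ (heisC U) • v = v := by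
  obtain ⟨x, rfl⟩ := Submodule.Quotient.mk_surjective _ v
  rw [← Submodule.Quotient.mk_smul, Submodule.Quotient.eq, smul_eq_mul, heisC_commutes]
  have h : x * (UniversalEnvelopingAlgebra.ι ℂ (heisC U) - 1) ∈ heisIdeal U :=
    (heisIdeal U).smul_mem x (Submodule.subset_span (Or.inr rfl))
  rwa [mul_sub, mul_one] at h

theorem heisMode_commutator (m n : ℤ) (a b : HSpace U) (v : VHeis U) :
    heisMode U m a (heisMode U n b v) - heisMode U n b (heisMode U m a v) =
      (if m + n + 1 = 0 then symp U a b else 0) • v := by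
  have h : ⁅heisLoop U (Finsupp.single m a), heisLoop U (Finsupp.single n b)⁆ =
      (if m + n + 1 = 0 then symp U a b else 0) • heisC U := by
    rw [← cocycle_single]
    refine Prod.ext ?_ ?_
    · exact (smul_zero _).symm
    · exact (mul_one _).symm
  have h2 := LieHom.map_lie (UniversalEnvelopingAlgebra.ι ℂ (L := Heis U))
    (heisLoop U (Finsupp.single m a)) (heisLoop U (Finsupp.single n b))
  rw [h, map_smul, LieRing.of_associative_ring_bracket] at h2
  have h3 := congrArg (fun t : UHeis U => t • v) h2
  simp only [sub_smul, mul_smul, smul_assoc, heisC_smul] at h3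
  exact h3.symm

theorem heisMode_vac (n : ℤ) (hn : 0 ≤ n) (a : HSpace U) : heisMode U n a (vac U) = 0 := by
  rw [vac, heisMode_apply_mk, mul_one, Submodule.Quotient.mk_eq_zero]
  exact Submodule.subset_span (Or.inl ⟨a, n, hn, rfl⟩)

/-- The vectors obtained from the vacuum by applying operators `a(n)` span `V_ℋ`. -/
theorem vheis_induction {P : VHeis U → Prop} (vac : P (vac U))
    (add : ∀ x y, P x → P y → P (x + y)) (smul : ∀ (c : ℂ) x, P x → P (c • x))
    (mode : ∀ (n : ℤ) (a : HSpace U) x, P x → P (heisMode U n a x)) (x : VHeis U) : P x := by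
  obtain ⟨x, rfl⟩ := Submodule.Quotient.mk_surjective _ x
  induction x using uheis_induction with
  | one => exact vac
  | add x y hx hy => exact add _ _ hx hy
  | smul c x hx => exact smul c _ hx
  | mul h x hx =>
    have hl : ∀ f : ℤ →₀ HSpace U, P (UniversalEnvelopingAlgebra.ι ℂ (heisLoop U f) •
        (Submodule.Quotient.mk x : VHeis U)) := by
      intro f
      induction f using Finsupp.induction_linear with
      | zero =>
        rw [map_zero, map_zero, zero_smul]
        simpa using smul 0 _ hx
      | add f g hf hg =>
        rw [map_add, map_add, add_smul]
        exact add _ _ hf hg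
      | single n a => exact mode n a _ hx
    have : (Submodule.Quotient.mk (UniversalEnvelopingAlgebra.ι ℂ h * x) : VHeis U) =
        UniversalEnvelopingAlgebra.ι ℂ (heisLoop U h.1) • (Submodule.Quotient.mk x : VHeis U) +
          h.2 • (Submodule.Quotient.mk x : VHeis U) := by
      conv_lhs => rw [heis_decomp h]
      rw [← smul_eq_mul, Submodule.Quotient.mk_smul, map_add, add_smul, map_smul, smul_assoc,
        heisC_smul]
    rw [this]
    exact add _ _ (hl _) (smul _ _ hx)

theorem exists_heisMode_eq_zero (a : HSpace U) (v : VHeis U) :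
    ∃ N : ℤ, ∀ n : ℤ, N ≤ n → heisMode U n a v = 0 := by
  induction v using vheis_induction with
  | vac => exact ⟨0, fun n hn => heisMode_vac n hn a⟩
  | add x y hx hy =>
    obtain ⟨N, hN⟩ := hx
    obtain ⟨M, hM⟩ := hy
    exact ⟨max N M, fun n hn => by
      rw [map_add, hN n (le_trans (le_max_left _ _) hn), hM n (le_trans (le_max_right _ _) hn),
        add_zero]⟩
  | smul c x hx =>
    obtain ⟨N, hN⟩ := hx
    exact ⟨N, fun n hn => by rw [map_smul, hN n hn, smul_zero]⟩
  | mode m b x hx =>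
    obtain ⟨N, hN⟩ := hx
    refine ⟨max N (-m), fun n hn => ?_⟩
    have h := heisMode_commutator n m a b x
    rw [hN n (le_trans (le_max_left _ _) hn), map_zero, sub_zero,
      if_neg (by have := le_trans (le_max_right N (-m)) hn; omega), zero_smul] at h
    exact h

/-- The universal property of `V_ℋ` as a module over the Heisenberg Lie algebra. -/
theorem exists_heisHom {M : Type v} [AddCommGroup M] [Module ℂ M]
    (α : ℤ → HSpace U →ₗ[ℂ] Module.End ℂ M) (e : M)
    (hα : ∀ (m n : ℤ) (a b : HSpace U) (v : M), α m a (α n b v) - α n b (α m a v) =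
      (if m + n + 1 = 0 then symp U a b else 0) • v)
    (he : ∀ (n : ℤ) (a : HSpace U), 0 ≤ n → α n a e = 0) :
    ∃ φ : VHeis U →ₗ[ℂ] M, φ (vac U) = e ∧
      ∀ (n : ℤ) (a : HSpace U) (v : VHeis U), φ (heisMode U n a v) = α n a (φ v) := by
  let L : (ℤ →₀ HSpace U) →ₗ[ℂ] Module.End ℂ M := Finsupp.lsum ℂ α
  have hL : ∀ n a, L (Finsupp.single n a) = α n a := fun n a => by simp [L]
  have hLL : ∀ f g, L f * L g - L g * L f = algebraMap ℂ _ (cocycle U f g) := by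
    intro f g
    induction f using Finsupp.induction_linear with
    | zero => simp
    | add f f' hf hf' =>
      rw [map_add, map_add, LinearMap.add_apply, map_add, ← hf, ← hf']
      noncomm_ring
    | single m a =>
      induction g using Finsupp.induction_linear with
      | zero => simp
      | add g g' hg hg' =>
        rw [map_add, map_add, map_add, ← hg, ← hg']
        noncomm_ring
      | single n b =>
        rw [hL, hL, cocycle_single]
        ext v
        exact hα m n a b v
  let g : Heis U →ₗ⁅ℂ⁆ Module.End ℂ M :=
    { toFun := fun x => L x.1 + algebraMap ℂ _ x.2
      map_add' := fun x y => by
        change L (x.1 + y.1) + algebraMap ℂ _ (x.2 + y.2) = _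
        rw [map_add, map_add]
        abel
      map_smul' := fun c x => by
        change L (c • x.1) + algebraMap ℂ _ (c • x.2) = _
        rw [map_smul, Algebra.algebraMap_eq_smul_one, smul_assoc, RingHom.id_apply, smul_add,
          Algebra.algebraMap_eq_smul_one]
      map_lie' := fun {x y} => by
        change L 0 + algebraMap ℂ _ (cocycle U x.1 y.1) = _
        rw [map_zero, zero_add, ← hLL, LieRing.of_associative_ring_bracket]
        simp only [mul_add, add_mul]
        rw [← Algebra.commutes x.2 (L y.1), ← Algebra.commutes y.2 (L x.1),
          ← Algebra.commutes x.2 (algebraMap ℂ (Module.End ℂ M) y.2)]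
        abel }
  let ψ : UHeis U →ₐ[ℂ] Module.End ℂ M := UniversalEnvelopingAlgebra.lift ℂ g
  have hψ : ∀ x, ψ (UniversalEnvelopingAlgebra.ι ℂ x) = L x.1 + algebraMap ℂ _ x.2 := fun x => by
    simp [ψ, g]
  have hψl : ∀ n a, ψ (UniversalEnvelopingAlgebra.ι ℂ (heisLoop U (Finsupp.single n a))) =
      α n a := fun n a => by
    rw [hψ]
    change L (Finsupp.single n a) + algebraMap ℂ _ 0 = _
    rw [map_zero, add_zero, hL]
  let I : Submodule (UHeis U) (UHeis U) :=
    { carrier := {x | ψ x e = 0}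
      add_mem' := fun {a b} ha hb => by
        change ψ (a + b) e = 0
        rw [map_add, LinearMap.add_apply, ha, hb, add_zero]
      zero_mem' := by simp
      smul_mem' := fun c x hx => by
        change ψ (c * x) e = 0
        rw [map_mul, Module.End.mul_apply, hx, map_zero] }
  have hle : heisIdeal U ≤ I := by
    refine Submodule.span_le.2 ?_
    rintro z (⟨a, n, hn, rfl⟩ | rfl)
    · change ψ _ e = 0
      rw [hψl, he n a hn]
    · change ψ _ e = 0
      rw [map_sub, hψ, map_one]
      change (L 0 + algebraMap ℂ _ 1 - 1) e = 0
      simp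
  let φ : VHeis U →ₗ[ℂ] M := ((heisIdeal U).restrictScalars ℂ).liftQ
    ((LinearMap.applyₗ e) ∘ₗ ψ.toLinearMap) (fun x hx => hle hx)
  refine ⟨φ, ?_, ?_⟩
  · change ψ 1 e = e
    simp
  · intro n a v
    obtain ⟨x, rfl⟩ := Submodule.Quotient.mk_surjective _ v
    rw [heisMode_apply_mk]
    change ψ (_ * x) e = α n a (ψ x e)
    rw [map_mul, hψl]
    rfl

end HeisModule

/-! ### Products with the field `1` -/

section OneField

variable {V : Type v} [AddCommGroup V] [Module ℂ V]

theorem neg_one_pow_mul_self (r : ℕ) : (-1 : ℂ) ^ r * (-1 : ℂ) ^ r = 1 := by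
  rw [← mul_pow]; simp

/-- The coefficient of `z^(m+k+1)` in `Res_x ((x - z)ᵏ - (-z + x)ᵏ) xᵐ`. -/
theorem bin_residue (k m : ℤ) :
    (if 0 ≤ m + k + 1 then (-1 : ℂ) ^ (m + k + 1).toNat * bin k (m + k + 1).toNat else 0) -
      (if 0 ≤ -m - 1 then (-1 : ℂ) ^ k * (-1 : ℂ) ^ (-m - 1).toNat * bin k (-m - 1).toNat else 0) =
    if k < 0 then bin m (-k - 1).toNat else 0 := by
  rcases lt_or_ge k 0 with hk | hk
  · obtain ⟨r, rfl⟩ : ∃ r : ℕ, k = -(r + 1 : ℤ) := ⟨(-k - 1).toNat, by omega⟩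
    rw [if_pos hk, show (-(-(r + 1 : ℤ)) - 1).toNat = r by omega]
    rcases lt_or_ge m 0 with hm | hm
    · obtain ⟨q, rfl⟩ : ∃ q : ℕ, m = -(q + 1 : ℤ) := ⟨(-m - 1).toNat, by omega⟩
      rw [if_neg (by omega), if_pos (by omega), show (-(-(q + 1 : ℤ)) - 1).toNat = q by omega,
        bin_neg, bin_neg, show (r + 1 : ℤ) + q - 1 = ((q + r : ℕ) : ℤ) by push_cast; ring,
        show (q + 1 : ℤ) + r - 1 = ((q + r : ℕ) : ℤ) by push_cast; ring, bin_natCast, bin_natCast,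
        zpow_neg, show (r + 1 : ℤ) = ((r + 1 : ℕ) : ℤ) by push_cast; ring, zpow_natCast,
        inv_eq_of_mul_eq_one_right (neg_one_pow_mul_self (r + 1)), Nat.choose_symm_add]
      have := neg_one_pow_mul_self q
      linear_combination ((-1 : ℂ) ^ r * ((q + r).choose r : ℂ)) * this
    · obtain ⟨q, rfl⟩ : ∃ q : ℕ, m = q := ⟨m.toNat, by omega⟩
      rw [if_neg (by omega : ¬ (0 : ℤ) ≤ -(q : ℤ) - 1), sub_zero]
      split_ifs with h
      · obtain ⟨s, rfl⟩ : ∃ s : ℕ, q = s + r := ⟨q - r, by omega⟩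
        rw [show (((s + r : ℕ) : ℤ) + -(r + 1 : ℤ) + 1).toNat = s by omega, bin_neg,
          show (r + 1 : ℤ) + s - 1 = ((s + r : ℕ) : ℤ) by push_cast; ring, bin_natCast,
          bin_natCast, ← mul_assoc, neg_one_pow_mul_self, one_mul, Nat.choose_symm_add]
      · rw [bin_natCast, Nat.choose_eq_zero_of_lt (by omega), Nat.cast_zero]
  · obtain ⟨k, rfl⟩ : ∃ r : ℕ, k = r := ⟨k.toNat, by omega⟩
    rw [if_neg (by omega : ¬ (k : ℤ) < 0)]
    rcases lt_or_ge m 0 with hm | hm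
    · obtain ⟨q, rfl⟩ : ∃ q : ℕ, m = -(q + 1 : ℤ) := ⟨(-m - 1).toNat, by omega⟩
      rw [if_pos (by omega : (0 : ℤ) ≤ -(-(q + 1 : ℤ)) - 1),
        show (-(-(q + 1 : ℤ)) - 1).toNat = q by omega, zpow_natCast]
      split_ifs with h
      · obtain ⟨s, rfl⟩ : ∃ s : ℕ, k = s + q := ⟨k - q, by omega⟩
        rw [show (-(q + 1 : ℤ) + ((s + q : ℕ) : ℤ) + 1).toNat = s by omega, bin_natCast,
          bin_natCast, Nat.choose_symm_add, pow_add]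
        have := neg_one_pow_mul_self q
        linear_combination -((-1 : ℂ) ^ s * ((s + q).choose q : ℂ)) * this
      · rw [bin_natCast, Nat.choose_eq_zero_of_lt (by omega)]
        simp
    · rw [if_pos (by omega), if_neg (by omega), bin_natCast, Nat.choose_eq_zero_of_lt (by omega)]
      simp

theorem finsum_ite_natCast_eq {M : Type*} [AddCommMonoid M] (z : ℤ) (f : ℕ → M) :
    (∑ᶠ j : ℕ, if (j : ℤ) = z then f j else 0) = if 0 ≤ z then f z.toNat else 0 := by
  split_ifs with h
  · rw [finsum_eq_single _ z.toNat (fun j hj => if_neg (by omega)), if_pos (by omega)]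
  · exact finsum_eq_zero_of_forall_eq_zero fun j => if_neg (by omega)

theorem oneField_ncoeff_apply (n : ℤ) (w : V) :
    ((oneField : VertexOperator ℂ V)[[n]]) w = if n = -1 then w else 0 := by
  rw [oneField_ncoeff]
  split_ifs <;> simp

theorem fieldProd_shift_oneField (m k : ℤ) (X : VertexOperator ℂ V) :
    fieldProd (shift m oneField) k X =
      (if k < 0 then bin m (-k - 1).toNat else 0) • shift (m + k + 1) X := by
  refine vertexOperator_ext fun n w => ?_
  rw [fieldProd_apply, ← bin_residue k m]
  simp only [shift_ncoeff, oneField_ncoeff_apply]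
  have h1 : (∑ᶠ j : ℕ, ((-1 : ℂ) ^ j * bin k j) •
      if k - (j : ℤ) + m = -1 then (X[[n + j]]) w else 0) =
      if 0 ≤ m + k + 1 then ((-1 : ℂ) ^ (m + k + 1).toNat * bin k (m + k + 1).toNat) •
        (X[[n + (m + k + 1)]]) w else 0 := by
    rw [← finsum_congr (fun j : ℕ => show (if (j : ℤ) = m + k + 1 then
      ((-1 : ℂ) ^ j * bin k j) • (X[[n + j]]) w else 0) = _ from ?_), finsum_ite_natCast_eq]
    · split_ifs with h
      · rw [Int.toNat_of_nonneg h]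
      · rfl
    · rw [smul_ite, smul_zero]
      congr 1
      rw [eq_iff_iff]
      omega
  have h2 : (∑ᶠ j : ℕ, ((-1 : ℂ) ^ k * (-1 : ℂ) ^ j * bin k j) •
      (X[[n + k - j]]) (if (j : ℤ) + m = -1 then w else 0)) =
      if 0 ≤ -m - 1 then ((-1 : ℂ) ^ k * (-1 : ℂ) ^ (-m - 1).toNat * bin k (-m - 1).toNat) •
        (X[[n + (m + k + 1)]]) w else 0 := by
    rw [← finsum_congr (fun j : ℕ => show (if (j : ℤ) = -m - 1 then
      ((-1 : ℂ) ^ k * (-1 : ℂ) ^ j * bin k j) • (X[[n + k - j]]) w else 0) = _ from ?_),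
      finsum_ite_natCast_eq]
    · split_ifs with h
      · rw [Int.toNat_of_nonneg h, show n + k - (-m - 1) = n + (m + k + 1) by ring]
      · rfl
    · by_cases hj : (j : ℤ) = -m - 1
      · rw [if_pos hj, if_pos (by omega)]
      · rw [if_neg hj, if_neg (by omega), map_zero, smul_zero]
  rw [h1, h2]
  rw [map_smul, Pi.smul_apply, LinearMap.smul_apply, shift_ncoeff]
  simp only [sub_smul, ite_smul, zero_smul]

/-- The divided power `∂⁽ʳ⁾` of the derivative, on fields. -/
def fieldDeriv (r : ℕ) : VertexOperator ℂ V →ₗ[ℂ] VertexOperator ℂ V where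
  toFun A := ofModes (fun n => ((-1 : ℂ) ^ r * bin n r) • A[[n - r]]) fun w => by
    obtain ⟨N, hN⟩ := exists_ncoeff_eq_zero A w
    exact ⟨N + r, fun n hn => by rw [LinearMap.smul_apply, hN _ (by omega), smul_zero]⟩
  map_add' A B := vertexOperator_ext fun n w => by simp
  map_smul' c A := vertexOperator_ext fun n w => by simp [smul_smul, mul_comm c]

@[simp] theorem fieldDeriv_ncoeff (r : ℕ) (A : VertexOperator ℂ V) (n : ℤ) :
    (fieldDeriv r A)[[n]] = ((-1 : ℂ) ^ r * bin n r) • A[[n - r]] := by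
  rw [fieldDeriv]; simp

theorem fieldProd_shift_oneField_right (m l n : ℤ) (A : VertexOperator ℂ V) (w : V) :
    ((fieldProd (shift m A) l oneField)[[n]]) w =
      (if l < 0 then -(-1 : ℂ) ^ l * bin n (-l - 1).toNat else 0) • (A[[n + m + l + 1]]) w := by
  have hres := bin_residue l n
  rw [fieldProd_apply]
  simp only [shift_ncoeff, oneField_ncoeff_apply]
  have h1 : (∑ᶠ j : ℕ, ((-1 : ℂ) ^ j * bin l j) •
      (A[[l - j + m]]) (if n + (j : ℤ) = -1 then w else 0)) =
      if 0 ≤ -n - 1 then ((-1 : ℂ) ^ (-n - 1).toNat * bin l (-n - 1).toNat) •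
        (A[[n + m + l + 1]]) w else 0 := by
    rw [← finsum_congr (fun j : ℕ => show (if (j : ℤ) = -n - 1 then
      ((-1 : ℂ) ^ j * bin l j) • (A[[l - j + m]]) w else 0) = _ from ?_),
      finsum_ite_natCast_eq]
    · split_ifs with h
      · rw [Int.toNat_of_nonneg h, show l - (-n - 1) + m = n + m + l + 1 by ring]
      · rfl
    · by_cases hj : (j : ℤ) = -n - 1
      · rw [if_pos hj, if_pos (by omega)]
      · rw [if_neg hj, if_neg (by omega), map_zero, smul_zero]
  have h2 : (∑ᶠ j : ℕ, ((-1 : ℂ) ^ l * (-1 : ℂ) ^ j * bin l j) •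
      (if n + l - (j : ℤ) = -1 then (A[[j + m]]) w else 0)) =
      if 0 ≤ n + l + 1 then
        ((-1 : ℂ) ^ l * (-1 : ℂ) ^ (n + l + 1).toNat * bin l (n + l + 1).toNat) •
        (A[[n + m + l + 1]]) w else 0 := by
    rw [← finsum_congr (fun j : ℕ => show (if (j : ℤ) = n + l + 1 then
      ((-1 : ℂ) ^ l * (-1 : ℂ) ^ j * bin l j) • (A[[j + m]]) w else 0) = _ from ?_),
      finsum_ite_natCast_eq]
    · split_ifs with h
      · rw [Int.toNat_of_nonneg h, show n + l + 1 + m = n + m + l + 1 by ring]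
      · rfl
    · rw [smul_ite, smul_zero]
      congr 1
      rw [eq_iff_iff]
      omega
  rw [h1, h2]
  have hsq : (-1 : ℂ) ^ l * (-1 : ℂ) ^ l = 1 := by
    rw [← mul_zpow]; simp
  rw [← ite_zero_smul, ← ite_zero_smul, ← sub_smul]
  congr 1
  have hgoal : (if l < 0 then -(-1 : ℂ) ^ l * bin n (-l - 1).toNat else 0) =
      -(-1 : ℂ) ^ l * if l < 0 then bin n (-l - 1).toNat else 0 := by
    split_ifs <;> simp
  rw [hgoal, ← hres]
  split_ifs
  · linear_combination (-((-1 : ℂ) ^ (-n - 1).toNat * bin l (-n - 1).toNat)) * hsq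
  · linear_combination (-((-1 : ℂ) ^ (-n - 1).toNat * bin l (-n - 1).toNat)) * hsq
  · ring
  · ring

theorem fieldProd_zero (A B : VertexOperator ℂ V) (n : ℤ) (w : V) :
    ((fieldProd A 0 B)[[n]]) w = (A[[0]]) ((B[[n]]) w) - (B[[n]]) ((A[[0]]) w) := by
  rw [fieldProd_apply, finsum_eq_single _ 0, finsum_eq_single _ 0]
  · simp
  · intro j hj
    rw [bin_zero_left, if_neg hj, mul_zero, zero_smul]
  · intro j hj
    rw [bin_zero_left, if_neg hj, mul_zero, zero_smul]

theorem shift_fieldProd (A B : VertexOperator ℂ V) (k m : ℤ) :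
    shift m (fieldProd A k B) = fieldProd A k (shift m B) := by
  refine vertexOperator_ext fun n w => ?_
  rw [shift_ncoeff, fieldProd_apply, fieldProd_apply]
  simp only [shift_ncoeff]
  congr 1
  · refine finsum_congr fun j => ?_
    rw [add_right_comm]
  · refine finsum_congr fun j => ?_
    rw [show n + m + k - (j : ℤ) = n + k - j + m by ring]

theorem bin_succ_mul (k : ℤ) (j : ℕ) : ((j : ℂ) + 1) * bin k (j + 1) = (k - j) * bin k j := by
  have h := bin_mul_bin k 1 j
  rw [add_comm 1 j, Nat.choose_succ_self_right, bin_one] at h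
  push_cast at h
  linear_combination h

theorem bin_mul_sub (k : ℤ) (j : ℕ) : ((k : ℂ) - j) * bin k j = k * bin (k - 1) j := by
  have h := bin_mul_bin_sub k j 1
  simp only [bin_one] at h
  push_cast at h
  linear_combination h

/-- The derivative acts on products of fields by `[∂, A₍ₖ₎] = (∂A)₍ₖ₎ = -k A₍ₖ₋₁₎`. -/
theorem fieldDeriv_fieldProd (A B : VertexOperator ℂ V) (k : ℤ) :
    fieldDeriv 1 (fieldProd A k B) = fieldProd A k (fieldDeriv 1 B) -
      (k : ℂ) • fieldProd A (k - 1) B := by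
  refine vertexOperator_ext fun n w => ?_
  obtain ⟨N, hN⟩ := exists_ncoeff_add_eq_zero B (n - 1) w
  obtain ⟨M, hM⟩ := exists_ncoeff_add_eq_zero A 0 w
  simp only [zero_add] at hM
  have hl : (-(n : ℂ)) • ((leftProd A k B)[[n - 1]]) w = ((leftProd A k (fieldDeriv 1 B))[[n]]) w -
      (k : ℂ) • ((leftProd A (k - 1) B)[[n]]) w := by
    rw [leftProd_eq_sum A B k (n - 1) w (N := N + 1) fun t ht => hN t (by omega),
      leftProd_eq_sum A (fieldDeriv 1 B) k n w (N := N + 1) fun t ht => by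
        rw [fieldDeriv_ncoeff, LinearMap.smul_apply,
          show n + (t : ℤ) - (1 : ℕ) = n - 1 + t by push_cast; ring, hN t (by omega), smul_zero],
      leftProd_eq_sum A B (k - 1) n w (N := N) fun t ht => by
        have := hN (t + 1) (by omega)
        rwa [show n - 1 + ((t + 1 : ℕ) : ℤ) = n + t by push_cast; ring] at this]
    have e1 : ∀ t : ℕ, (-(n : ℂ)) • ((-1 : ℂ) ^ t * bin k t) • (A[[k - t]]) ((B[[n - 1 + t]]) w) -
        ((-1 : ℂ) ^ t * bin k t) • (A[[k - t]]) (((fieldDeriv 1 B)[[n + t]]) w) =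
        ((t : ℂ) * ((-1 : ℂ) ^ t * bin k t)) • (A[[k - t]]) ((B[[n - 1 + t]]) w) := by
      intro t
      rw [fieldDeriv_ncoeff, LinearMap.smul_apply, map_smul, smul_smul, smul_smul,
        show n + (t : ℤ) - (1 : ℕ) = n - 1 + t by push_cast; ring, ← sub_smul]
      congr 1
      rw [bin_one]
      push_cast
      ring
    have e2 : ∑ t ∈ Finset.range (N + 1), ((t : ℂ) * ((-1 : ℂ) ^ t * bin k t)) •
        (A[[k - t]]) ((B[[n - 1 + t]]) w) = -((k : ℂ) • ∑ t ∈ Finset.range N,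
          ((-1 : ℂ) ^ t * bin (k - 1) t) • (A[[k - 1 - t]]) ((B[[n + t]]) w)) := by
      rw [Finset.sum_range_succ', Finset.smul_sum, ← Finset.sum_neg_distrib]
      simp only [Nat.cast_zero, zero_mul, zero_smul, add_zero]
      refine Finset.sum_congr rfl fun t _ => ?_
      rw [smul_smul, ← neg_smul, show k - ((t + 1 : ℕ) : ℤ) = k - 1 - t by push_cast; ring,
        show n - 1 + ((t + 1 : ℕ) : ℤ) = n + t by push_cast; ring]
      congr 1
      have h1 := bin_succ_mul k t
      have h2 := bin_mul_sub k t
      push_cast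
      rw [pow_succ]
      linear_combination (-(-1 : ℂ) ^ t) * (h1 + h2)
    have e3 := Finset.sum_congr (rfl : Finset.range (N + 1) = _) fun t _ => e1 t
    rw [Finset.sum_sub_distrib, ← Finset.smul_sum, e2, sub_eq_iff_eq_add] at e3
    rw [e3]
    abel
  have hr : (-(n : ℂ)) • ((rightProd A k B)[[n - 1]]) w =
      ((rightProd A k (fieldDeriv 1 B))[[n]]) w - (k : ℂ) • ((rightProd A (k - 1) B)[[n]]) w := by
    rw [rightProd_eq_sum A B k (n - 1) w hM, rightProd_eq_sum A (fieldDeriv 1 B) k n w hM,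
      rightProd_eq_sum A B (k - 1) n w hM, Finset.smul_sum, Finset.smul_sum,
      ← Finset.sum_sub_distrib]
    refine Finset.sum_congr rfl fun t _ => ?_
    rw [fieldDeriv_ncoeff, LinearMap.smul_apply, smul_smul, smul_smul, smul_smul,
      show n + k - (t : ℤ) - (1 : ℕ) = n - 1 + k - t by push_cast; ring,
      show n + (k - 1) - (t : ℤ) = n - 1 + k - t by ring, ← sub_smul]
    congr 1
    rw [bin_one, zpow_sub₀ (by norm_num)]
    push_cast
    linear_combination ((-1 : ℂ) ^ k * (-1 : ℂ) ^ t) * bin_mul_sub k t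
  rw [fieldDeriv_ncoeff]
  simp only [fieldProd, LinearMap.sub_apply, map_sub, Pi.sub_apply, map_smul, Pi.smul_apply,
    LinearMap.smul_apply, smul_sub]
  have hc : (-1 : ℂ) ^ 1 * bin n 1 = -(n : ℂ) := by simp
  rw [hc, Nat.cast_one, hl, hr]
  abel

theorem fieldDeriv_one_fieldDeriv (r : ℕ) (A : VertexOperator ℂ V) :
    fieldDeriv 1 (fieldDeriv r A) = ((r : ℂ) + 1) • fieldDeriv (r + 1) A := by
  refine vertexOperator_ext fun n w => ?_
  simp only [fieldDeriv_ncoeff, map_smul, Pi.smul_apply, LinearMap.smul_apply, smul_smul, bin_one]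
  rw [show n - ((1 : ℕ) : ℤ) - r = n - ((r + 1 : ℕ) : ℤ) by push_cast; ring]
  congr 1
  have h1 := bin_succ_mul n r
  have h2 := bin_mul_sub n r
  rw [pow_succ, Nat.cast_one]
  linear_combination (-1 : ℂ) ^ r * (h1 + h2)

end OneField

/-! ### The vertex algebra structure of `V_ℋ` -/

section HeisVA

variable {V : Type v} [AddCommGroup V] [Module ℂ V]

theorem fieldProd_add_left (A A' B : VertexOperator ℂ V) (k : ℤ) :
    fieldProd (A + A') k B = fieldProd A k B + fieldProd A' k B := by
  refine vertexOperator_ext fun n w => ?_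
  obtain ⟨N, hN⟩ := exists_ncoeff_add_eq_zero B n w
  obtain ⟨M, hM⟩ := exists_ncoeff_add_eq_zero A 0 w
  obtain ⟨M', hM'⟩ := exists_ncoeff_add_eq_zero A' 0 w
  simp only [zero_add] at hM hM'
  simp only [fieldProd, LinearMap.sub_apply, map_sub, map_add, Pi.sub_apply, Pi.add_apply,
    LinearMap.add_apply]
  rw [leftProd_eq_sum (A + A') B k n w hN, leftProd_eq_sum A B k n w hN,
    leftProd_eq_sum A' B k n w hN,
    rightProd_eq_sum (A + A') B k n w (N := M + M') fun t ht => by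
      rw [map_add, Pi.add_apply, LinearMap.add_apply, hM t (by omega), hM' t (by omega), add_zero],
    rightProd_eq_sum A B k n w (N := M + M') fun t ht => hM t (by omega),
    rightProd_eq_sum A' B k n w (N := M + M') fun t ht => hM' t (by omega)]
  simp only [map_add, Pi.add_apply, LinearMap.add_apply, smul_add, Finset.sum_add_distrib]
  abel

theorem fieldProd_smul_left (c : ℂ) (A B : VertexOperator ℂ V) (k : ℤ) :
    fieldProd (c • A) k B = c • fieldProd A k B := by
  refine vertexOperator_ext fun n w => ?_
  obtain ⟨N, hN⟩ := exists_ncoeff_add_eq_zero B n w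
  obtain ⟨M, hM⟩ := exists_ncoeff_add_eq_zero A 0 w
  simp only [zero_add] at hM
  simp only [fieldProd, LinearMap.sub_apply, map_sub, map_smul, Pi.sub_apply, Pi.smul_apply,
    LinearMap.smul_apply]
  rw [leftProd_eq_sum (c • A) B k n w hN, leftProd_eq_sum A B k n w hN,
    rightProd_eq_sum (c • A) B k n w (N := M) fun t ht => by
      rw [map_smul, Pi.smul_apply, LinearMap.smul_apply, hM t ht, smul_zero],
    rightProd_eq_sum A B k n w hM]
  simp only [map_smul, Pi.smul_apply, LinearMap.smul_apply, Finset.smul_sum, smul_sub, smul_smul,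
    mul_comm c]

/-- `A ↦ A₍ₖ₎` as a linear map. -/
def fieldProdHom (k : ℤ) : VertexOperator ℂ V →ₗ[ℂ] Module.End ℂ (VertexOperator ℂ V) where
  toFun A := fieldProd A k
  map_add' A B := LinearMap.ext fun X => fieldProd_add_left A B X k
  map_smul' c A := LinearMap.ext fun X => fieldProd_smul_left c A X k

theorem shift_zero (A : VertexOperator ℂ V) : shift 0 A = A :=
  vertexOperator_ext fun n w => by rw [shift_ncoeff, add_zero]

theorem fieldProd_oneField (k : ℤ) (X : VertexOperator ℂ V) :
    fieldProd oneField k X = if k = -1 then X else 0 := by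
  have h := fieldProd_shift_oneField 0 k X
  rw [shift_zero] at h
  rw [h, bin_zero_left]
  split_ifs with h1 h2 h3 h4 h5
  · rw [one_smul, h3, show (0 : ℤ) + -1 + 1 = 0 by norm_num, shift_zero]
  · omega
  · omega
  · rw [zero_smul]
  · omega
  · rw [zero_smul]

theorem fieldProd_oneField_right (A : VertexOperator ℂ V) (l : ℤ) :
    fieldProd A l oneField = if l < 0 then fieldDeriv (-l - 1).toNat A else 0 := by
  refine vertexOperator_ext fun n w => ?_
  have h := fieldProd_shift_oneField_right 0 l n A w
  rw [shift_zero] at h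
  rw [h]
  split_ifs with hl
  · obtain ⟨r, rfl⟩ : ∃ r : ℕ, l = -(r + 1 : ℤ) := ⟨(-l - 1).toNat, by omega⟩
    rw [show (-(-(r + 1 : ℤ)) - 1).toNat = r by omega, fieldDeriv_ncoeff, LinearMap.smul_apply,
      show n + 0 + -(r + 1 : ℤ) + 1 = n - r by ring, zpow_neg,
      show (r + 1 : ℤ) = ((r + 1 : ℕ) : ℤ) by push_cast; ring, zpow_natCast,
      inv_eq_of_mul_eq_one_right (neg_one_pow_mul_self (r + 1)), pow_succ]
    congr 1
    ring
  · simp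

variable {U : Type u} [AddCommGroup U] [Module ℂ U]

/-- The field `a(x) = ∑ₙ a(n) x^(-n-1)` on `V_ℋ`. -/
def heisField : HSpace U →ₗ[ℂ] VertexOperator ℂ (VHeis U) where
  toFun a := ofModes (fun n => heisMode U n a) (exists_heisMode_eq_zero a)
  map_add' a b := vertexOperator_ext fun n w => by simp
  map_smul' c a := vertexOperator_ext fun n w => by simp

@[simp] theorem heisField_ncoeff (a : HSpace U) (n : ℤ) :
    (heisField a)[[n]] = heisMode U n a := by
  rw [heisField]; simp

theorem heisField_hasCommutator (a b : HSpace U) :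
    HasCommutator (heisField a) (heisField b) (fun _ => symp U a b • oneField) 1 := by
  intro p q w
  simp only [heisField_ncoeff, heisMode_commutator, Finset.sum_range_one, bin_zero, one_smul,
    map_smul, Pi.smul_apply, LinearMap.smul_apply, oneField_ncoeff_apply, Nat.cast_zero, sub_zero]
  by_cases h : p + q + 1 = 0
  · rw [if_pos h, if_pos (by omega)]
  · rw [if_neg h, if_neg (by omega), zero_smul, smul_zero]

/-- The operators `a(x)₍ₙ₎` make the space of all fields a module over the Heisenberg algebra, so
there is a unique homomorphism from `V_ℋ` to fields sending the vacuum to the field `1`. -/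
theorem exists_heisY (U : Type u) [AddCommGroup U] [Module ℂ U] :
    ∃ Y : VHeis U →ₗ[ℂ] VertexOperator ℂ (VHeis U), Y (vac U) = oneField ∧
      ∀ (n : ℤ) (a : HSpace U) (v : VHeis U),
        Y (heisMode U n a v) = fieldProd (heisField a) n (Y v) := by
  refine exists_heisHom (fun n => fieldProdHom n ∘ₗ heisField) oneField ?_ ?_
  · intro m n a b X
    change fieldProd _ _ (fieldProd _ _ X) - fieldProd _ _ (fieldProd _ _ X) = _
    rw [fieldProd_commutator (heisField_hasCommutator a b), Finset.sum_range_one, bin_zero,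
      one_smul, fieldProd_smul_left, fieldProd_oneField, Nat.cast_zero, sub_zero]
    by_cases h : m + n + 1 = 0
    · rw [if_pos h, if_pos (by omega)]
    · rw [if_neg h, if_neg (by omega), zero_smul, smul_zero]
  · intro n a hn
    change fieldProd _ _ _ = 0
    rw [fieldProd_oneField_right, if_neg (by omega)]

/-- The state-field correspondence of `V_ℋ`. -/
def heisY (U : Type u) [AddCommGroup U] [Module ℂ U] :
    VHeis U →ₗ[ℂ] VertexOperator ℂ (VHeis U) :=
  (exists_heisY U).choose

theorem heisY_vac : heisY U (vac U) = oneField := (exists_heisY U).choose_spec.1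

theorem heisY_mode (n : ℤ) (a : HSpace U) (v : VHeis U) :
    heisY U (heisMode U n a v) = fieldProd (heisField a) n (heisY U v) :=
  (exists_heisY U).choose_spec.2 n a v

theorem heisY_state (a : HSpace U) : heisY U (state U a) = heisField a := by
  change heisY U (heisMode U (-1) a (vac U)) = _
  rw [heisY_mode, heisY_vac, fieldProd_oneField_right, if_pos (by norm_num)]
  refine vertexOperator_ext fun n w => ?_
  simp

theorem heisY_mode_vac (k n : ℤ) (a : HSpace U) (v : VHeis U) {N : ℕ}
    (hN : ∀ j : ℕ, N ≤ j → ((heisY U v)[[n + j]]) (vac U) = 0) :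
    ((heisY U (heisMode U k a v))[[n]]) (vac U) = ∑ j ∈ Finset.range N,
      ((-1 : ℂ) ^ j * bin k j) • heisMode U (k - j) a (((heisY U v)[[n + j]]) (vac U)) := by
  rw [heisY_mode, fieldProd_apply, finsum_eq_sum_range (n := N) fun j hj => by
    rw [hN j hj, map_zero, smul_zero], finsum_eq_zero_of_forall_eq_zero (fun j : ℕ => by
    rw [heisField_ncoeff, heisMode_vac _ (by omega), map_zero, smul_zero]), sub_zero]
  simp only [heisField_ncoeff]

theorem heisY_creation (v : VHeis U) :
    (∀ n : ℤ, 0 ≤ n → ((heisY U v)[[n]]) (vac U) = 0) ∧ ((heisY U v)[[-1]]) (vac U) = v := by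
  induction v using vheis_induction with
  | vac =>
    rw [heisY_vac]
    refine ⟨fun n hn => ?_, ?_⟩
    · rw [oneField_ncoeff_apply, if_neg (by omega)]
    · rw [oneField_ncoeff_apply, if_pos rfl]
  | add x y hx hy =>
    refine ⟨fun n hn => ?_, ?_⟩
    · rw [map_add, map_add, Pi.add_apply, LinearMap.add_apply, hx.1 n hn, hy.1 n hn, add_zero]
    · rw [map_add, map_add, Pi.add_apply, LinearMap.add_apply, hx.2, hy.2]
  | smul c x hx =>
    refine ⟨fun n hn => ?_, ?_⟩
    · rw [map_smul, map_smul, Pi.smul_apply, LinearMap.smul_apply, hx.1 n hn, smul_zero]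
    · rw [map_smul, map_smul, Pi.smul_apply, LinearMap.smul_apply, hx.2]
  | mode k a x hx =>
    refine ⟨fun n hn => ?_, ?_⟩
    · rw [heisY_mode_vac (N := 0) _ _ _ _ fun j _ => hx.1 _ (by omega), Finset.sum_range_zero]
    · rw [heisY_mode_vac (N := 1) _ _ _ _ fun j hj => hx.1 _ (by omega), Finset.sum_range_one]
      simp [hx.2]

/-- The translation operator `T v = v₋₂ 𝟏`. -/
def heisT : Module.End ℂ (VHeis U) where
  toFun v := ((heisY U v)[[-2]]) (vac U)
  map_add' v w := by simp
  map_smul' c v := by simp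

theorem heisT_apply (v : VHeis U) : heisT v = ((heisY U v)[[-2]]) (vac U) := rfl

/-- `[T, a(k)] = -k a(k-1)`. -/
theorem heisT_mode (k : ℤ) (a : HSpace U) (v : VHeis U) :
    heisT (heisMode U k a v) = heisMode U k a (heisT v) - (k : ℂ) • heisMode U (k - 1) a v := by
  rw [heisT_apply, heisY_mode_vac (N := 2) _ _ _ _ fun j hj => (heisY_creation v).1 _ (by omega),
    Finset.sum_range_succ, Finset.sum_range_one, heisT_apply]
  have h := (heisY_creation v).2
  simp [h, sub_eq_add_neg]

theorem heisY_heisT (v : VHeis U) : heisY U (heisT v) = fieldDeriv 1 (heisY U v) := by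
  induction v using vheis_induction with
  | vac =>
    rw [heisT_apply, heisY_vac, oneField_ncoeff_apply, if_neg (by norm_num), map_zero]
    refine vertexOperator_ext fun n w => ?_
    rw [fieldDeriv_ncoeff, LinearMap.smul_apply, oneField_ncoeff_apply, bin_one]
    split_ifs with h
    · obtain rfl : n = 0 := by push_cast at h; omega
      simp
    · simp
  | add x y hx hy => simp only [map_add, hx, hy]
  | smul c x hx => simp only [map_smul, hx]
  | mode k a x hx =>
    rw [heisT_mode, map_sub, map_smul, heisY_mode, heisY_mode, heisY_mode, hx, fieldDeriv_fieldProd]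

/-- `T v₋ᵣ𝟏 = r v₋ᵣ₋₁𝟏`, so that `v₋ᵣ₋₁𝟏 = T⁽ʳ⁾v`. -/
theorem heisT_ncoeff_vac (v : VHeis U) (r : ℕ) :
    heisT (((heisY U v)[[-(r : ℤ)]]) (vac U)) =
      (r : ℂ) • ((heisY U v)[[-(r : ℤ) - 1]]) (vac U) := by
  induction v using vheis_induction generalizing r with
  | vac =>
    rw [heisY_vac, oneField_ncoeff_apply, oneField_ncoeff_apply]
    have h0 : heisT (vac U) = 0 := by
      rw [heisT_apply, heisY_vac, oneField_ncoeff_apply, if_neg (by norm_num)]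
    split_ifs with h1 h2 h2
    · omega
    · rw [h0, smul_zero]
    · obtain rfl : r = 0 := by omega
      simp
    · rw [map_zero, smul_zero]
  | add x y hx hy =>
    simp only [map_add, Pi.add_apply, LinearMap.add_apply, hx, hy, smul_add]
  | smul c x hx =>
    simp only [map_smul, Pi.smul_apply, LinearMap.smul_apply, hx]
    rw [smul_comm]
  | mode k a x hx =>
    rw [heisY_mode_vac (N := r) _ _ _ _ fun j hj => (heisY_creation x).1 _ (by omega),
      heisY_mode_vac (N := r + 1) _ _ _ _ fun j hj => (heisY_creation x).1 _ (by omega)]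
    set s : ℕ → VHeis U := fun j => ((heisY U x)[[-(r : ℤ) - 1 + j]]) (vac U) with hs
    have hT : ∀ j ∈ Finset.range r, heisT (((heisY U x)[[-(r : ℤ) + j]]) (vac U)) =
        ((r : ℂ) - j) • s j := by
      intro j hj
      have hj' : j < r := by simpa using hj
      have h := hx (r - j)
      rw [show -((r - j : ℕ) : ℤ) = -(r : ℤ) + j by omega] at h
      rw [h, hs, show -(r : ℤ) + j - 1 = -r - 1 + j by ring, Nat.cast_sub hj'.le]
    set f : ℕ → VHeis U := fun j => ((-1 : ℂ) ^ j * bin k j) • heisMode U (k - j) a (s j) with hf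
    have h1 : heisT (∑ j ∈ Finset.range r, ((-1 : ℂ) ^ j * bin k j) •
        heisMode U (k - j) a (((heisY U x)[[-(r : ℤ) + j]]) (vac U))) =
        ∑ j ∈ Finset.range r, (((r : ℂ) - j) • f j + ((j : ℂ) + 1) • f (j + 1)) := by
      rw [map_sum]
      refine Finset.sum_congr rfl fun j hj => ?_
      rw [map_smul, heisT_mode, hT j hj]
      have : ((heisY U x)[[-(r : ℤ) + j]]) (vac U) = s (j + 1) := by
        rw [hs]
        push_cast
        rw [show -(r : ℤ) - 1 + (j + 1) = -r + j by ring]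
      rw [this, hf, map_smul, smul_sub, sub_eq_add_neg, smul_smul, smul_smul, smul_smul, smul_smul,
        ← neg_smul, show k - ((j + 1 : ℕ) : ℤ) = k - j - 1 by push_cast; ring]
      have hb := bin_succ_mul k j
      congr 2
      · ring
      · rw [pow_succ]
        push_cast
        linear_combination (-1 : ℂ) ^ j * hb
    -- `∑ ((r - j) fⱼ + (j + 1) fⱼ₊₁) = r ∑ fⱼ`, since the coefficients of `fⱼ` add up to `r`
    rw [h1, Finset.sum_add_distrib]
    have h2 : ∑ j ∈ Finset.range r, ((j : ℂ) + 1) • f (j + 1) =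
        ∑ j ∈ Finset.range (r + 1), (j : ℂ) • f j := by
      rw [Finset.sum_range_succ']
      simp
    have h3 : ∑ j ∈ Finset.range r, ((r : ℂ) - j) • f j =
        ∑ j ∈ Finset.range (r + 1), ((r : ℂ) - j) • f j := by
      rw [Finset.sum_range_succ]
      simp
    rw [h2, h3, ← Finset.sum_add_distrib, Finset.smul_sum]
    refine Finset.sum_congr rfl fun j _ => ?_
    rw [← add_smul, sub_add_cancel]

/-- `Y(v₋ᵣ₋₁𝟏, x) = ∂⁽ʳ⁾Y(v, x)`. -/
theorem heisY_ncoeff_vac (v : VHeis U) (r : ℕ) :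
    heisY U (((heisY U v)[[-(r : ℤ) - 1]]) (vac U)) = fieldDeriv r (heisY U v) := by
  induction r with
  | zero =>
    rw [Nat.cast_zero, neg_zero, zero_sub, (heisY_creation v).2]
    refine vertexOperator_ext fun n w => ?_
    simp
  | succ r ih =>
    have h := heisT_ncoeff_vac v (r + 1)
    have h2 := congrArg (heisY U) h
    rw [heisY_heisT, show -((r + 1 : ℕ) : ℤ) = -(r : ℤ) - 1 by push_cast; ring, ih,
      fieldDeriv_one_fieldDeriv, map_smul] at h2
    have hr : ((r + 1 : ℕ) : ℂ) ≠ 0 := Nat.cast_ne_zero.2 (Nat.succ_ne_zero r)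
    rw [show (r : ℂ) + 1 = ((r + 1 : ℕ) : ℂ) by push_cast; ring] at h2
    rw [show -((r + 1 : ℕ) : ℤ) = -(r : ℤ) - 1 by push_cast; ring]
    exact (smul_right_injective _ hr h2).symm

/-- The Jacobi identity for the vectors `u` and `v` of `V_ℋ`, as an identity of fields. -/
def JacobiAt (u v : VHeis U) : Prop :=
  ∀ l m : ℤ, ∃ S0 : ℕ, ∀ S : ℕ, S0 ≤ S → fieldProd (shift m (heisY U u)) l (heisY U v) =
    ∑ i ∈ Finset.range S, bin m i • shift (m - i) (heisY U (((heisY U u)[[l + i]]) v))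

theorem JacobiAt.add_right {u v v' : VHeis U} (h : JacobiAt u v) (h' : JacobiAt u v') :
    JacobiAt u (v + v') := by
  intro l m
  obtain ⟨S, hS⟩ := h l m
  obtain ⟨S', hS'⟩ := h' l m
  refine ⟨max S S', fun T hT => ?_⟩
  simp only [map_add, smul_add, Finset.sum_add_distrib]
  rw [hS T (le_trans (le_max_left _ _) hT), hS' T (le_trans (le_max_right _ _) hT)]

theorem JacobiAt.smul_right {u v : VHeis U} (h : JacobiAt u v) (c : ℂ) :
    JacobiAt u (c • v) := by
  intro l m
  obtain ⟨S, hS⟩ := h l m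
  refine ⟨S, fun T hT => ?_⟩
  simp only [map_smul, smul_comm _ c, ← Finset.smul_sum]
  rw [hS T hT]

theorem JacobiAt.smul_left {u v : VHeis U} (h : JacobiAt u v) (c : ℂ) :
    JacobiAt (c • u) v := by
  intro l m
  obtain ⟨S, hS⟩ := h l m
  refine ⟨S, fun T hT => ?_⟩
  simp only [map_smul, Pi.smul_apply, LinearMap.smul_apply, smul_comm _ c, ← Finset.smul_sum,
    fieldProd_smul_left]
  rw [hS T hT]

theorem jacobiAt_vac_left (v : VHeis U) : JacobiAt (vac U) v := by
  intro l m
  refine ⟨(-l).toNat, fun S hS => ?_⟩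
  simp only [heisY_vac, oneField_ncoeff_apply]
  rw [fieldProd_shift_oneField]
  split_ifs with hl
  · rw [Finset.sum_eq_single (-l - 1).toNat]
    · rw [if_pos (by omega), show m - ((-l - 1).toNat : ℤ) = m + l + 1 by omega]
    · intro i _ hi
      rw [if_neg (by omega), map_zero, map_zero, smul_zero]
    · intro hi
      simp only [Finset.mem_range] at hi
      omega
  · rw [zero_smul, Finset.sum_eq_zero]
    intro i _
    rw [if_neg (by omega), map_zero, map_zero, smul_zero]

theorem jacobiAt_vac_right (u : VHeis U) : JacobiAt u (vac U) := by
  intro l m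
  refine ⟨(-l).toNat, fun S hS => ?_⟩
  refine vertexOperator_ext fun n w => ?_
  rw [heisY_vac, fieldProd_shift_oneField_right]
  simp only [map_sum, map_smul, Finset.sum_apply, Pi.smul_apply, LinearMap.sum_apply,
    LinearMap.smul_apply, shift_ncoeff]
  split_ifs with hl
  · obtain ⟨r, rfl⟩ : ∃ r : ℕ, l = -(r + 1 : ℤ) := ⟨(-l - 1).toNat, by omega⟩
    rw [show (-(-(r + 1 : ℤ)) - 1).toNat = r by omega,
      ← Finset.sum_subset (s₁ := Finset.range (r + 1))
        (fun i hi => by simp only [Finset.mem_range] at hi ⊢; omega)]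
    · have h : ∀ i ∈ Finset.range (r + 1), bin m i •
          ((heisY U (((heisY U u)[[-(r + 1 : ℤ) + i]]) (vac U)))[[n + (m - i)]]) w =
          (bin m i * bin (r - n - m - 1) (r - i)) •
            ((heisY U u)[[n + m + -(r + 1 : ℤ) + 1]]) w := by
        intro i hi
        have hi' : i ≤ r := by simp only [Finset.mem_range] at hi; omega
        rw [show -(r + 1 : ℤ) + i = -((r - i : ℕ) : ℤ) - 1 by omega, heisY_ncoeff_vac,
          fieldDeriv_ncoeff, LinearMap.smul_apply, smul_smul, ← mul_assoc,
          show n + (m - (i : ℤ)) - ((r - i : ℕ) : ℤ) = n + m + -(r + 1 : ℤ) + 1 by omega]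
        congr 1
        rw [show n + (m - (i : ℤ)) = -(-(n + m - i)) by ring, bin_neg,
          show -(n + m - (i : ℤ)) + ((r - i : ℕ) : ℤ) - 1 = r - n - m - 1 by omega]
        have := neg_one_pow_mul_self (r - i)
        linear_combination (bin m i * bin (r - n - m - 1) (r - i)) * this
      rw [Finset.sum_congr rfl h, ← Finset.sum_smul]
      congr 1
      rw [← Finset.Nat.sum_antidiagonal_eq_sum_range_succ
        (fun i j => bin m i * bin (r - n - m - 1) j), ← bin_add,
        show m + (r - n - m - 1) = -n + r - 1 by ring, show n = -(-n) by ring, bin_neg, neg_neg,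
        zpow_neg, show (r + 1 : ℤ) = ((r + 1 : ℕ) : ℤ) by push_cast; ring, zpow_natCast,
        inv_eq_of_mul_eq_one_right (neg_one_pow_mul_self (r + 1)), pow_succ]
      have := neg_one_pow_mul_self r
      linear_combination bin (-n + r - 1) r * this
    · intro i _ hi
      simp only [Finset.mem_range] at hi
      rw [(heisY_creation u).1 _ (by omega), map_zero]
      simp
  · rw [zero_smul, Finset.sum_eq_zero]
    intro i _
    rw [(heisY_creation u).1 _ (by omega), map_zero]
    simp

/-- The inductive step of the Jacobi identity in the second argument: `a₍ₖ₎` is moved to the left of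
`u₍ₗ₎`, on fields by `fieldProd_commutator` and on vectors by `hc`. -/
theorem JacobiAt.mode_right {u v : VHeis U} {a : HSpace U} {Sc : ℕ}
    (hc : HasCommutator (heisField a) (heisY U u)
      (fun s => heisY U (heisMode U s a u)) Sc)
    (hu : JacobiAt u v) (hau : ∀ s : ℕ, JacobiAt (heisMode U s a u) v) (k : ℤ) :
    JacobiAt u (heisMode U k a v) := by
  intro l m
  obtain ⟨S0, hS0⟩ := hu l m
  choose S1 hS1 using fun s : ℕ => hau s (k + l - s) m
  refine ⟨S0 + ∑ s ∈ Finset.range Sc, S1 s, fun S hS => ?_⟩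
  have hSs : ∀ s ∈ Finset.range Sc, S1 s ≤ S := fun s hs => by
    have h : S1 s ≤ ∑ s ∈ Finset.range Sc, S1 s :=
      Finset.single_le_sum (f := fun s => S1 s) (fun i _ => Nat.zero_le _) hs
    omega
  have hcomm := fieldProd_commutator (hc.shift_right m) k l (heisY U v)
  rw [sub_eq_iff_eq_add, ← sub_eq_iff_eq_add'] at hcomm
  rw [heisY_mode, ← hcomm, hS0 S (by omega),
    Finset.sum_congr rfl fun s hs => congrArg (bin k s • ·) (hS1 s S (hSs s hs))]
  simp only [map_sum, map_smul, Finset.smul_sum, smul_smul]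
  rw [Finset.sum_comm, ← Finset.sum_sub_distrib]
  refine Finset.sum_congr rfl fun i _ => ?_
  have hi := hc k (l + i) v
  simp only [heisField_ncoeff] at hi
  rw [sub_eq_iff_eq_add, ← sub_eq_iff_eq_add'] at hi
  rw [← hi, map_sub, map_sub, smul_sub, map_sum, map_sum, Finset.smul_sum, heisY_mode,
    shift_fieldProd]
  congr 1
  refine Finset.sum_congr rfl fun s _ => ?_
  rw [map_smul, map_smul, smul_smul, mul_comm, show k + (l + (i : ℤ)) - s = k + l - s + i by ring]

theorem JacobiAt.apply {u v : VHeis U} (h : JacobiAt u v) (l m n : ℤ) (w : VHeis U) :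
    ((fieldProd (shift m (heisY U u)) l (heisY U v))[[n]]) w =
      ∑ᶠ i : ℕ, bin m i • ((heisY U (((heisY U u)[[l + i]]) v))[[m + n - i]]) w := by
  obtain ⟨S0, hS0⟩ := h l m
  obtain ⟨N, hN⟩ := exists_ncoeff_add_eq_zero (heisY U u) l v
  rw [hS0 (max S0 N) (le_max_left _ _), finsum_eq_sum_range (n := max S0 N)]
  · simp only [map_sum, map_smul, Finset.sum_apply, Pi.smul_apply, LinearMap.sum_apply,
      LinearMap.smul_apply, shift_ncoeff]
    refine Finset.sum_congr rfl fun i _ => ?_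
    rw [show n + (m - (i : ℤ)) = m + n - i by ring]
  · intro j hj
    rw [hN j (le_trans (le_max_right _ _) hj), map_zero]
    simp

theorem heisMode_state (s : ℤ) (hs : 0 ≤ s) (a b : HSpace U) :
    heisMode U s a (state U b) = (if s = 0 then symp U a b else 0) • vac U := by
  have h := heisMode_commutator s (-1) a b (vac U)
  rw [heisMode_vac s hs, map_zero, sub_zero, neg_add_cancel_right] at h
  exact h

theorem jacobiAt_state (b : HSpace U) (v : VHeis U) : JacobiAt (state U b) v := by
  induction v using vheis_induction with
  | vac => exact jacobiAt_vac_right _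
  | add x y hx hy => exact hx.add_right hy
  | smul c x hx => exact hx.smul_right c
  | mode k a x hx =>
    refine JacobiAt.mode_right (Sc := 1) ?_ hx (fun s => ?_) k
    · intro p q w
      rw [heisY_state, heisField_hasCommutator a b p q w]
      simp only [Finset.sum_range_one, Nat.cast_zero]
      rw [heisMode_state 0 le_rfl, if_pos rfl, map_smul (heisY U), heisY_vac]
    · rw [heisMode_state _ (by omega)]
      exact (jacobiAt_vac_left x).smul_left _

theorem heisField_heisY_hasCommutator (a : HSpace U) (u : VHeis U) :
    ∃ S, HasCommutator (heisField a) (heisY U u) (fun s => heisY U (heisMode U s a u)) S := by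
  obtain ⟨S, hS⟩ := exists_ncoeff_add_eq_zero (heisField a) 0 u
  simp only [zero_add, heisField_ncoeff] at hS
  refine ⟨S, fun p q w => ?_⟩
  have h := (jacobiAt_state a u).apply 0 p q w
  rw [fieldProd_zero, shift_ncoeff, zero_add, heisY_state, finsum_eq_sum_range (n := S)] at h
  · rw [h]
    simp only [zero_add, heisField_ncoeff]
  · intro j hj
    rw [zero_add, heisField_ncoeff, hS j hj, map_zero]
    simp

/-- The induction on `v` needs the commutator formula for `a ∈ H` and `u`, which is a case of the
Jacobi identity for `a` and `u`, that is, of `jacobiAt_state`. -/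
theorem jacobiAt (u v : VHeis U) : JacobiAt u v := by
  induction v using vheis_induction generalizing u with
  | vac => exact jacobiAt_vac_right _
  | add x y hx hy => exact (hx u).add_right (hy u)
  | smul c x hx => exact (hx u).smul_right c
  | mode k a x hx =>
    obtain ⟨S, hS⟩ := heisField_heisY_hasCommutator a u
    exact JacobiAt.mode_right hS (hx u) (fun s => hx _) k

theorem heisY_isHeisVA : IsHeisVA U (heisY U) := by
  refine ⟨⟨?_, ?_, ?_, ?_⟩, ?_⟩
  · intro n
    rw [heisY_vac, oneField_ncoeff]
  · exact fun v => (heisY_creation v).1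
  · exact fun v => (heisY_creation v).2
  · intro u v w l m n
    have h := (jacobiAt u v).apply l m n w
    simp only [fieldProd_apply, shift_ncoeff] at h
    refine Eq.trans ?_ h
    congr 1
    · refine finsum_congr fun j => ?_
      rw [show l - (j : ℤ) + m = m + l - j by ring]
      rfl
    · refine finsum_congr fun j => ?_
      rw [add_comm (j : ℤ) m]
      rfl
  · intro a n
    rw [heisY_state, heisField_ncoeff]

theorem isHeisVA_unique {Y : VHeis U →ₗ[ℂ] VertexOperator ℂ (VHeis U)} (hY : IsHeisVA U Y) :
    Y = heisY U := by
  obtain ⟨hV, ha⟩ := hY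
  have hfield : ∀ a, Y (state U a) = heisField a := fun a =>
    vertexOperator_ext fun n w => by rw [ha, heisField_ncoeff]
  refine LinearMap.ext fun v => ?_
  induction v using vheis_induction with
  | vac =>
    rw [heisY_vac]
    refine vertexOperator_ext fun n w => ?_
    rw [hV.vacuum, oneField_ncoeff]
  | add x y hx hy => rw [map_add, map_add, hx, hy]
  | smul c x hx => rw [map_smul, map_smul, hx]
  | mode k a x hx =>
    rw [heisY_mode, ← hx]
    refine vertexOperator_ext fun n w => ?_
    -- the Jacobi identity with `m = 0` expresses `Y (a(k) x)` by products of modes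
    have h := hV.jacobi (state U a) x w k 0 n
    rw [finsum_eq_single (fun i : ℕ => ((Ring.choose (0 : ℤ) i : ℤ) : ℂ) • _) 0 (fun i hi => by
      rw [show ((Ring.choose (0 : ℤ) i : ℤ) : ℂ) = bin 0 i from rfl, bin_zero_left, if_neg hi,
        zero_smul])] at h
    rw [Ring.choose_zero_right, Int.cast_one, one_smul, Nat.cast_zero, add_zero, sub_zero, zero_add,
      ha] at h
    rw [zero_add] at h
    rw [← h, fieldProd_apply]
    congr 1
    · refine finsum_congr fun j => ?_
      rw [hfield]
      rfl
    · refine finsum_congr fun j => ?_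
      rw [hfield, zero_add]
      rfl

end HeisVA

/-! ### Taylor coefficients of `f(x - z)` -/

section Taylor

/-- The coefficient of `zʲ` in `f(x - z)`, that is, `(-d/dx)ʲ f / j!`. -/
def taylorCoeff (j : ℕ) : PowerSeries ℂ →ₗ[ℂ] PowerSeries ℂ where
  toFun f := PowerSeries.mk fun r =>
    (-1 : ℂ) ^ j * ((r + j).choose j : ℂ) * PowerSeries.coeff (r + j) f
  map_add' f g := by
    ext r
    simp only [PowerSeries.coeff_mk, map_add]
    ring
  map_smul' c f := by
    ext r
    simp only [PowerSeries.coeff_mk, map_smul, smul_eq_mul, RingHom.id_apply]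
    ring

theorem coeff_taylorCoeff (j r : ℕ) (f : PowerSeries ℂ) :
    PowerSeries.coeff r (taylorCoeff j f) =
      (-1 : ℂ) ^ j * ((r + j).choose j : ℂ) * PowerSeries.coeff (r + j) f := by
  simp [taylorCoeff]

@[simp] theorem taylorCoeff_zero (f : PowerSeries ℂ) : taylorCoeff 0 f = f := by
  ext r
  simp [coeff_taylorCoeff]

theorem taylorCoeff_one (j : ℕ) : taylorCoeff j 1 = if j = 0 then 1 else 0 := by
  split_ifs with h
  · rw [h, taylorCoeff_zero]
  · ext r
    rw [coeff_taylorCoeff, PowerSeries.coeff_one, if_neg (by omega)]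
    simp

theorem succ_smul_taylorCoeff_succ (j : ℕ) (f : PowerSeries ℂ) :
    ((j : ℂ) + 1) • taylorCoeff (j + 1) f =
      -PowerSeries.derivative ℂ (taylorCoeff j f) := by
  ext r
  have h := Nat.add_one_mul_choose_eq (r + j) j
  have h2 := Nat.choose_succ_right_eq (r + j + 1) j
  rw [show r + j + 1 - j = r + 1 by omega] at h2
  have h3 : ((r + j + 1).choose (j + 1) : ℂ) * (j + 1) = ((r + j + 1).choose j : ℂ) * (r + 1) := by
    exact_mod_cast h2
  rw [map_smul, map_neg, PowerSeries.coeff_derivative, coeff_taylorCoeff, coeff_taylorCoeff,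
    smul_eq_mul, show r + 1 + j = r + j + 1 by omega, show r + (j + 1) = r + j + 1 by omega, pow_succ]
  linear_combination (-(-1 : ℂ) ^ j * PowerSeries.coeff (r + j + 1) f) * h3

/-- The Leibniz rule. -/
theorem taylorCoeff_mul (t : ℕ) (f g : PowerSeries ℂ) :
    taylorCoeff t (f * g) = ∑ p ∈ antidiagonal t, taylorCoeff p.1 f * taylorCoeff p.2 g := by
  induction t with
  | zero => simp
  | succ t ih =>
    have ht : ((t : ℂ) + 1) ≠ 0 := Nat.cast_add_one_ne_zero t
    apply smul_right_injective _ ht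
    change ((t : ℂ) + 1) • _ = ((t : ℂ) + 1) • _
    rw [succ_smul_taylorCoeff_succ, ih]
    have h1 : ∑ p ∈ antidiagonal t, ((p.1 : ℂ) + 1) • taylorCoeff (p.1 + 1) f * taylorCoeff p.2 g =
        ∑ p ∈ antidiagonal (t + 1), (p.1 : ℂ) • taylorCoeff p.1 f * taylorCoeff p.2 g := by
      rw [Finset.Nat.sum_antidiagonal_succ]
      simp
    have h2 : ∑ p ∈ antidiagonal t, taylorCoeff p.1 f * ((p.2 : ℂ) + 1) • taylorCoeff (p.2 + 1) g =
        ∑ p ∈ antidiagonal (t + 1), taylorCoeff p.1 f * (p.2 : ℂ) • taylorCoeff p.2 g := by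
      rw [Finset.Nat.sum_antidiagonal_succ']
      simp
    have h3 : -PowerSeries.derivative ℂ
        (∑ p ∈ antidiagonal t, taylorCoeff p.1 f * taylorCoeff p.2 g) =
        ∑ p ∈ antidiagonal t, ((p.1 : ℂ) + 1) • taylorCoeff (p.1 + 1) f * taylorCoeff p.2 g +
        ∑ p ∈ antidiagonal t, taylorCoeff p.1 f * ((p.2 : ℂ) + 1) • taylorCoeff (p.2 + 1) g := by
      rw [map_sum, ← Finset.sum_neg_distrib, ← Finset.sum_add_distrib]
      refine Finset.sum_congr rfl fun p _ => ?_
      rw [succ_smul_taylorCoeff_succ, succ_smul_taylorCoeff_succ, Derivation.leibniz, smul_eq_mul,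
        smul_eq_mul]
      ring
    rw [h3, h1, h2, ← Finset.sum_add_distrib, Finset.smul_sum]
    refine Finset.sum_congr rfl fun p hp => ?_
    have hp' : p.1 + p.2 = t + 1 := Finset.HasAntidiagonal.mem_antidiagonal.1 hp
    rw [smul_mul_assoc, mul_smul_comm, ← add_smul]
    congr 1
    exact_mod_cast hp'

theorem taylorCoeff_taylorCoeff (i j : ℕ) (f : PowerSeries ℂ) :
    taylorCoeff i (taylorCoeff j f) = ((i + j).choose j : ℂ) • taylorCoeff (i + j) f := by
  ext r
  rw [map_smul, coeff_taylorCoeff, coeff_taylorCoeff, coeff_taylorCoeff, smul_eq_mul]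
  have h := Nat.choose_mul (n := r + (i + j)) (k := i + j) (s := j) (by omega)
  rw [show r + (i + j) - j = r + i by omega, show i + j - j = i by omega] at h
  have h' : ((r + (i + j)).choose (i + j) : ℂ) * ((i + j).choose j : ℂ) =
      ((r + (i + j)).choose j : ℂ) * ((r + i).choose i : ℂ) := by exact_mod_cast h
  rw [show r + i + j = r + (i + j) by omega, pow_add]
  linear_combination (-(-1 : ℂ) ^ i * (-1 : ℂ) ^ j * PowerSeries.coeff (r + (i + j)) f) * h'

end Taylor

/-! ### The tensor product of a vertex algebra with `ℂ[[x]]` -/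

section TensorFields

variable {V : Type v} [AddCommGroup V] [Module ℂ V]

/-- Multiplication by `f ∈ ℂ[[x]]` on `V ⊗ ℂ[[x]]`. -/
def seriesMul (V : Type v) [AddCommGroup V] [Module ℂ V] :
    PowerSeries ℂ →ₗ[ℂ] Module.End ℂ (V ⊗[ℂ] PowerSeries ℂ) :=
  LinearMap.lTensorHom V ∘ₗ LinearMap.mul ℂ (PowerSeries ℂ)

@[simp] theorem seriesMul_tmul (f g : PowerSeries ℂ) (v : V) :
    seriesMul V f (v ⊗ₜ[ℂ] g) = v ⊗ₜ[ℂ] (f * g) := by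
  simp [seriesMul]

theorem seriesMul_mul (f g : PowerSeries ℂ) (ξ : V ⊗[ℂ] PowerSeries ℂ) :
    seriesMul V (f * g) ξ = seriesMul V f (seriesMul V g ξ) := by
  induction ξ using TensorProduct.induction_on with
  | zero => simp
  | tmul v h => simp [mul_assoc]
  | add x y hx hy => rw [map_add, map_add, map_add, hx, hy]

/-- The coefficient of `xⁿ` of an element of `V ⊗ ℂ[[x]]`. -/
def tcoeff (V : Type v) [AddCommGroup V] [Module ℂ V] (n : ℕ) :
    V ⊗[ℂ] PowerSeries ℂ →ₗ[ℂ] V :=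
  (TensorProduct.rid ℂ V).toLinearMap ∘ₗ LinearMap.lTensor V (PowerSeries.coeff (R := ℂ) n)

@[simp] theorem tcoeff_tmul (n : ℕ) (v : V) (f : PowerSeries ℂ) :
    tcoeff V n (v ⊗ₜ[ℂ] f) = PowerSeries.coeff n f • v := by
  simp [tcoeff]

theorem dcoeff_apply (Δ : V →ₗ[ℂ] V ⊗[ℂ] PowerSeries ℂ) (n : ℕ) (v : V) :
    dcoeff Δ n v = tcoeff V n (Δ v) := rfl

/-- An element of `V ⊗ ℂ[[x]]` is determined by its coefficients. -/
theorem tcoeff_ext {ξ η : V ⊗[ℂ] PowerSeries ℂ} (h : ∀ n, tcoeff V n ξ = tcoeff V n η) :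
    ξ = η := by
  let b := Module.Free.chooseBasis ℂ V
  let e := TensorProduct.equivFinsuppOfBasisLeft (N := PowerSeries ℂ) b
  have he : ∀ (n : ℕ) (ζ : V ⊗[ℂ] PowerSeries ℂ) (i), PowerSeries.coeff n (e ζ i) =
      b.repr (tcoeff V n ζ) i := by
    intro n ζ i
    induction ζ using TensorProduct.induction_on with
    | zero => simp
    | tmul v f => simp [e, TensorProduct.equivFinsuppOfBasisLeft_apply_tmul, mul_comm]
    | add x y hx hy => simp [hx, hy]
  apply e.injective
  ext i n
  rw [he, he, h]

variable (Y : V →ₗ[ℂ] VertexOperator ℂ V)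

/-- `v ↦ v_m` -/
def yMode (m : ℤ) : V →ₗ[ℂ] Module.End ℂ V :=
  LinearMap.proj m ∘ₗ VertexOperator.ncoeff ∘ₗ Y

theorem yMode_apply (m : ℤ) (v : V) : yMode Y m v = (Y v)[[m]] := rfl

/-- `(v ⊗ f, w ⊗ g) ↦ v_m w ⊗ (-d/dx)ʲ f / j! g` -/
def tensorMode (j : ℕ) (m : ℤ) : V ⊗[ℂ] PowerSeries ℂ →ₗ[ℂ] Module.End ℂ (V ⊗[ℂ] PowerSeries ℂ) :=
  TensorProduct.map₂ (yMode Y m) (LinearMap.mul ℂ (PowerSeries ℂ) ∘ₗ taylorCoeff j)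

@[simp] theorem tensorMode_tmul (j : ℕ) (m : ℤ) (v w : V) (f g : PowerSeries ℂ) :
    tensorMode Y j m (v ⊗ₜ[ℂ] f) (w ⊗ₜ[ℂ] g) =
      ((Y v)[[m]]) w ⊗ₜ[ℂ] (taylorCoeff j f * g) := by
  simp [tensorMode, yMode_apply]

theorem exists_tensorMode_eq_zero (ξ η : V ⊗[ℂ] PowerSeries ℂ) :
    ∃ N : ℤ, ∀ m : ℤ, N ≤ m → ∀ j, tensorMode Y j m ξ η = 0 := by
  induction ξ using TensorProduct.induction_on with
  | zero => exact ⟨0, fun m _ j => by simp⟩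
  | add x y hx hy =>
    obtain ⟨N, hN⟩ := hx
    obtain ⟨M, hM⟩ := hy
    exact ⟨max N M, fun m hm j => by
      rw [map_add, LinearMap.add_apply, hN m (le_trans (le_max_left _ _) hm),
        hM m (le_trans (le_max_right _ _) hm), add_zero]⟩
  | tmul v f =>
    induction η using TensorProduct.induction_on with
    | zero => exact ⟨0, fun m _ j => by simp⟩
    | add x y hx hy =>
      obtain ⟨N, hN⟩ := hx
      obtain ⟨M, hM⟩ := hy
      exact ⟨max N M, fun m hm j => by
        rw [map_add, hN m (le_trans (le_max_left _ _) hm),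
          hM m (le_trans (le_max_right _ _) hm), add_zero]⟩
    | tmul w g =>
      obtain ⟨N, hN⟩ := exists_ncoeff_eq_zero (Y v) w
      exact ⟨N, fun m hm j => by rw [tensorMode_tmul, hN m hm, TensorProduct.zero_tmul]⟩

theorem exists_tensorMode_add_eq_zero (n : ℤ) (ξ η : V ⊗[ℂ] PowerSeries ℂ) :
    ∃ N : ℕ, ∀ j : ℕ, N ≤ j → tensorMode Y j (n + j) ξ η = 0 := by
  obtain ⟨N, hN⟩ := exists_tensorMode_eq_zero Y ξ η
  exact ⟨(N - n).toNat, fun j hj => hN _ (by omega) j⟩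

/-- The state-field correspondence of the tensor product of `V` and the commutative vertex algebra
`ℂ[[x]]` with `Y(f, z) g = f(x - z) g`:
`Y(v ⊗ f, z) (w ⊗ g) = Y(v, z) w ⊗ f(x - z) g`. -/
def tensorY : V ⊗[ℂ] PowerSeries ℂ →ₗ[ℂ] VertexOperator ℂ (V ⊗[ℂ] PowerSeries ℂ) where
  toFun ξ := ofModes (fun n => locSum (fun j : ℕ => tensorMode Y j (n + j) ξ)
    (exists_tensorMode_add_eq_zero Y n ξ)) fun η => by
      obtain ⟨N, hN⟩ := exists_tensorMode_eq_zero Y ξ η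
      exact ⟨N, fun n hn => finsum_eq_zero_of_forall_eq_zero fun j => hN _ (by omega) j⟩
  map_add' ξ ξ' := vertexOperator_ext fun n η => by
    simp only [ofModes_ncoeff, locSum_apply, map_add, LinearMap.add_apply, Pi.add_apply]
    exact finsum_add_of_eventually (exists_tensorMode_add_eq_zero Y n ξ η)
      (exists_tensorMode_add_eq_zero Y n ξ' η)
  map_smul' c ξ := vertexOperator_ext fun n η => by
    simp only [ofModes_ncoeff, locSum_apply, map_smul, LinearMap.smul_apply, Pi.smul_apply,
      RingHom.id_apply]
    exact finsum_smul_of_eventually (exists_tensorMode_add_eq_zero Y n ξ η) c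

theorem tensorY_apply (n : ℤ) (ξ η : V ⊗[ℂ] PowerSeries ℂ) :
    ((tensorY Y ξ)[[n]]) η = ∑ᶠ j : ℕ, tensorMode Y j (n + j) ξ η := by
  rw [tensorY]
  simp [locSum_apply]

theorem tensorY_tmul (n : ℤ) (v w : V) (f g : PowerSeries ℂ) :
    ((tensorY Y (v ⊗ₜ[ℂ] f))[[n]]) (w ⊗ₜ[ℂ] g) =
      ∑ᶠ j : ℕ, ((Y v)[[n + j]]) w ⊗ₜ[ℂ] (taylorCoeff j f * g) := by
  rw [tensorY_apply]
  simp only [tensorMode_tmul]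

theorem tensorY_tmul_one (n : ℤ) (v w : V) (g : PowerSeries ℂ) :
    ((tensorY Y (v ⊗ₜ[ℂ] 1))[[n]]) (w ⊗ₜ[ℂ] g) = ((Y v)[[n]]) w ⊗ₜ[ℂ] g := by
  rw [tensorY_tmul, finsum_eq_single _ 0]
  · simp
  · intro j hj
    rw [taylorCoeff_one, if_neg hj, zero_mul, TensorProduct.tmul_zero]

theorem tensorY_seriesMul_right (n : ℤ) (h : PowerSeries ℂ) (ξ η : V ⊗[ℂ] PowerSeries ℂ) :
    ((tensorY Y ξ)[[n]]) (seriesMul V h η) = seriesMul V h (((tensorY Y ξ)[[n]]) η) := by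
  have key : ∀ j m, tensorMode Y j m ξ ∘ₗ seriesMul V h = seriesMul V h ∘ₗ tensorMode Y j m ξ := by
    intro j m
    refine TensorProduct.ext' fun w g => ?_
    simp only [LinearMap.comp_apply]
    induction ξ using TensorProduct.induction_on with
    | zero => simp
    | add x y hx hy => simp only [map_add, LinearMap.add_apply, hx, hy]
    | tmul v f =>
      rw [seriesMul_tmul, tensorMode_tmul, tensorMode_tmul, seriesMul_tmul, mul_left_comm]
  rw [tensorY_apply, tensorY_apply,
    map_finsum_of_eventually (exists_tensorMode_add_eq_zero Y n ξ η)]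
  exact finsum_congr fun j => LinearMap.congr_fun (key j (n + j)) η

/-- `Y(f ξ, z) = f(x - z) Y(ξ, z)` -/
theorem tensorY_seriesMul_left (n : ℤ) (f : PowerSeries ℂ) (ξ η : V ⊗[ℂ] PowerSeries ℂ) :
    ((tensorY Y (seriesMul V f ξ))[[n]]) η =
      ∑ᶠ i : ℕ, seriesMul V (taylorCoeff i f) (((tensorY Y ξ)[[n + i]]) η) := by
  have hfin : ∀ ξ η : V ⊗[ℂ] PowerSeries ℂ, ∃ N : ℕ, ∀ i, N ≤ i →
      seriesMul V (taylorCoeff i f) (((tensorY Y ξ)[[n + i]]) η) = 0 := fun ξ η => by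
    obtain ⟨N, hN⟩ := exists_ncoeff_add_eq_zero (tensorY Y ξ) n η
    exact ⟨N, fun i hi => by rw [hN i hi, map_zero]⟩
  induction ξ using TensorProduct.induction_on with
  | zero => simp
  | add x y hx hy =>
    simp only [map_add, Pi.add_apply, LinearMap.add_apply, hx, hy]
    exact (finsum_add_of_eventually (hfin x η) (hfin y η)).symm
  | tmul v g =>
    induction η using TensorProduct.induction_on with
    | zero => simp
    | add x y hx hy =>
      simp only [map_add, hx, hy]
      exact (finsum_add_of_eventually (hfin _ x) (hfin _ y)).symm
    | tmul w h =>
      obtain ⟨N, hN⟩ := exists_ncoeff_add_eq_zero (Y v) n w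
      have hN' : ∀ i j : ℕ, N ≤ i + j → ((Y v)[[n + i + j]]) w = 0 := fun i j hij => by
        have := hN (i + j) hij
        rwa [Nat.cast_add, ← add_assoc] at this
      have hr : ∀ i : ℕ, seriesMul V (taylorCoeff i f) (((tensorY Y (v ⊗ₜ[ℂ] g))[[n + i]])
          (w ⊗ₜ[ℂ] h)) = ∑ᶠ j : ℕ, ((Y v)[[n + i + j]]) w ⊗ₜ[ℂ]
            (taylorCoeff i f * (taylorCoeff j g * h)) := by
        intro i
        rw [tensorY_tmul, map_finsum_of_eventually]
        · simp only [seriesMul_tmul]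
        · exact ⟨N, fun j hj => by rw [hN' i j (by omega), TensorProduct.zero_tmul]⟩
      simp only [hr]
      rw [finsum_finsum_eq_sum_antidiagonal (n := N) fun i j hij => by
        rw [hN' i j hij, TensorProduct.zero_tmul], seriesMul_tmul, tensorY_tmul,
        finsum_eq_sum_range (n := N) (fun j hj => by rw [hN j hj, TensorProduct.zero_tmul])]
      refine Finset.sum_congr rfl fun t _ => ?_
      rw [taylorCoeff_mul, Finset.sum_mul, TensorProduct.tmul_sum]
      refine Finset.sum_congr rfl fun p hp => ?_
      rw [← Finset.HasAntidiagonal.mem_antidiagonal.1 hp, Nat.cast_add, ← add_assoc, mul_assoc]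

/-- The coefficients of `Y(ξ, z) η`. -/
theorem tcoeff_tensorY (p : ℕ) (q : ℤ) (ξ η : V ⊗[ℂ] PowerSeries ℂ) :
    tcoeff V p (((tensorY Y ξ)[[q]]) η) = ∑ i ∈ Finset.range (p + 1), ∑ᶠ j : ℕ,
      ((-1 : ℂ) ^ j * ((p - i + j).choose j : ℂ)) •
        ((Y (tcoeff V (p - i + j) ξ))[[q + j]]) (tcoeff V i η) := by
  have hfin : ∀ (ξ : V ⊗[ℂ] PowerSeries ℂ) (w : V) (r : ℕ), ∃ N : ℕ, ∀ j, N ≤ j →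
      ((-1 : ℂ) ^ j * ((r + j).choose j : ℂ)) • ((Y (tcoeff V (r + j) ξ))[[q + j]]) w = 0 := by
    intro ξ w r
    induction ξ using TensorProduct.induction_on with
    | zero => exact ⟨0, fun j _ => by simp⟩
    | add x y hx hy =>
      obtain ⟨N, hN⟩ := hx
      obtain ⟨M, hM⟩ := hy
      exact ⟨max N M, fun j hj => by
        rw [map_add, map_add, map_add, Pi.add_apply, LinearMap.add_apply, smul_add,
          hN j (le_trans (le_max_left _ _) hj), hM j (le_trans (le_max_right _ _) hj), add_zero]⟩
    | tmul v f =>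
      obtain ⟨N, hN⟩ := exists_ncoeff_add_eq_zero (Y v) q w
      exact ⟨N, fun j hj => by
        rw [tcoeff_tmul, map_smul, map_smul, Pi.smul_apply, LinearMap.smul_apply, hN j hj, smul_zero,
          smul_zero]⟩
  induction ξ using TensorProduct.induction_on with
  | zero => simp
  | add x y hx hy =>
    have h0 : tcoeff V p (((tensorY Y (x + y))[[q]]) η) =
      tcoeff V p (((tensorY Y x)[[q]]) η) + tcoeff V p (((tensorY Y y)[[q]]) η) := by simp
    rw [h0, hx, hy, ← Finset.sum_add_distrib]
    refine Finset.sum_congr rfl fun i _ => ?_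
    rw [← finsum_add_of_eventually (hfin x _ _) (hfin y _ _)]
    exact finsum_congr fun j => by simp
  | tmul v f =>
    induction η using TensorProduct.induction_on with
    | zero => simp
    | add x y hx hy =>
      rw [map_add, map_add, hx, hy, ← Finset.sum_add_distrib]
      refine Finset.sum_congr rfl fun i _ => ?_
      rw [← finsum_add_of_eventually (hfin _ _ _) (hfin _ _ _)]
      exact finsum_congr fun j => by simp
    | tmul w g =>
      obtain ⟨N, hN⟩ := exists_ncoeff_add_eq_zero (Y v) q w
      rw [tensorY_tmul, finsum_eq_sum_range (n := N) fun j hj => by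
        rw [hN j hj, TensorProduct.zero_tmul], map_sum]
      have hr : ∀ i ∈ Finset.range (p + 1), (∑ᶠ j : ℕ,
          ((-1 : ℂ) ^ j * ((p - i + j).choose j : ℂ)) •
          ((Y (tcoeff V (p - i + j) (v ⊗ₜ[ℂ] f)))[[q + j]]) (tcoeff V i (w ⊗ₜ[ℂ] g))) =
          ∑ j ∈ Finset.range N, (PowerSeries.coeff (p - i) (taylorCoeff j f) *
            PowerSeries.coeff i g) • ((Y v)[[q + j]]) w := by
        intro i _
        rw [finsum_eq_sum_range (n := N)]
        · refine Finset.sum_congr rfl fun j _ => ?_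
          simp only [tcoeff_tmul, map_smul, Pi.smul_apply, LinearMap.smul_apply, smul_smul,
            coeff_taylorCoeff]
          congr 1
          ring
        · intro j hj
          rw [tcoeff_tmul, map_smul, map_smul, Pi.smul_apply, LinearMap.smul_apply, tcoeff_tmul,
            map_smul, hN j hj, smul_zero, smul_zero, smul_zero]
      rw [Finset.sum_congr rfl hr, Finset.sum_comm]
      refine Finset.sum_congr rfl fun j _ => ?_
      rw [tcoeff_tmul, ← Finset.sum_smul, PowerSeries.coeff_mul,
        ← Finset.Nat.sum_antidiagonal_swap, Finset.Nat.sum_antidiagonal_eq_sum_range_succ_mk]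
      rfl

end TensorFields

section TensorIterate

variable {V : Type v} [AddCommGroup V] [Module ℂ V]

theorem sum_range_sum_range_eq_sum_antidiagonal {M : Type*} [AddCommMonoid M] {f : ℕ → ℕ → M}
    {n : ℕ} (h : ∀ i j, n ≤ i + j → f i j = 0) :
    ∑ i ∈ Finset.range n, ∑ j ∈ Finset.range n, f i j =
      ∑ t ∈ Finset.range n, ∑ p ∈ antidiagonal t, f p.1 p.2 := by
  rw [← finsum_finsum_eq_sum_antidiagonal h, finsum_eq_sum_range (n := n)]
  · exact Finset.sum_congr rfl fun i _ =>
      (finsum_eq_sum_range fun j hj => h i j (by omega)).symm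
  · intro i hi
    exact finsum_eq_zero_of_forall_eq_zero fun j => h i j (by omega)

theorem exists_box_bound {M : Type*} [Zero M] {f : ℕ → ℕ → ℕ → M} {N : ℕ}
    (h1 : ∀ i j, N ≤ i + j → ∀ k, f i j k = 0)
    (h2 : ∀ i j, ∃ K, ∀ k, K ≤ k → f i j k = 0) :
    ∃ B, ∀ i j k, (B ≤ i ∨ B ≤ j ∨ B ≤ k) → f i j k = 0 := by
  choose K hK using h2
  refine ⟨N + ∑ p ∈ Finset.range N ×ˢ Finset.range N, K p.1 p.2, fun i j k hijk => ?_⟩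
  by_cases hij : N ≤ i + j
  · exact h1 i j hij k
  · have h : K i j ≤ ∑ p ∈ Finset.range N ×ˢ Finset.range N, K p.1 p.2 :=
      Finset.single_le_sum (f := fun p : ℕ × ℕ => K p.1 p.2) (a := (i, j))
        (fun _ _ => Nat.zero_le _) (Finset.mem_product.2 ⟨Finset.mem_range.2 (by omega : i < N),
          Finset.mem_range.2 (by omega : j < N)⟩)
    exact hK i j k (by omega)

variable {Y : V →ₗ[ℂ] VertexOperator ℂ V}

set_option maxHeartbeats 1000000 in
/-- If `u` satisfies the Jacobi identity with all vectors of `V`, then the iterate formula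
`Y(ξ₍ₖ₎η, z) = Y(ξ, z)₍ₖ₎Y(η, z)` holds for `ξ = u ⊗ f` in the tensor product of `V` with
`ℂ[[x]]`. -/
theorem tensorY_iterate {u : V}
    (hu : ∀ (v : V) (l m n : ℤ) (w : V), ((fieldProd (shift m (Y u)) l (Y v))[[n]]) w =
      ∑ᶠ i : ℕ, bin m i • ((Y (((Y u)[[l + i]]) v))[[m + n - i]]) w)
    (f : PowerSeries ℂ) (k : ℤ) (ξ : V ⊗[ℂ] PowerSeries ℂ) :
    tensorY Y (((tensorY Y (u ⊗ₜ[ℂ] f))[[k]]) ξ) =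
      fieldProd (tensorY Y (u ⊗ₜ[ℂ] f)) k (tensorY Y ξ) := by
  induction ξ using TensorProduct.induction_on with
  | zero => simp
  | add x y hx hy => rw [map_add, map_add, map_add, map_add, hx, hy]
  | tmul v g =>
  refine vertexOperator_ext fun n η => ?_
  induction η using TensorProduct.induction_on with
  | zero => simp
  | add x y hx hy => rw [map_add, map_add, hx, hy]
  | tmul w h =>
  -- the vectors that occur, with bounds for their support
  set X : ℕ → ℤ → V := fun t m => ((Y (((Y u)[[k + t]]) v))[[m]]) w with hX
  set D : ℕ → ℕ → PowerSeries ℂ := fun p q => taylorCoeff p f * (taylorCoeff q g * h) with hD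
  obtain ⟨M, hM⟩ : ∃ M : ℕ, ∀ t s : ℕ, M ≤ t + s → X t (n + s) = 0 := by
    refine exists_add_bound ?_ fun t => exists_ncoeff_add_eq_zero _ n w
    obtain ⟨T, hT⟩ := exists_ncoeff_add_eq_zero (Y u) k v
    exact ⟨T, fun t ht s => by simp [hX, hT t ht]⟩
  obtain ⟨N1, hN1⟩ := exists_ncoeff_add_eq_zero (Y v) n w
  obtain ⟨B1, hB1⟩ : ∃ B, ∀ j q p : ℕ, (B ≤ j ∨ B ≤ q ∨ B ≤ p) →
      ((Y u)[[k - j + p]]) (((Y v)[[n + j + q]]) w) = 0 := by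
    refine exists_box_bound (N := N1) (fun j q hjq p => ?_) fun j q =>
      exists_ncoeff_add_eq_zero _ _ _
    have := hN1 (j + q) hjq
    rw [Nat.cast_add, ← add_assoc] at this
    rw [this, map_zero]
  obtain ⟨N2, hN2⟩ := exists_ncoeff_add_eq_zero (Y u) 0 w
  obtain ⟨B2, hB2⟩ : ∃ B, ∀ j p q : ℕ, (B ≤ j ∨ B ≤ p ∨ B ≤ q) →
      ((Y v)[[n + k - j + q]]) (((Y u)[[(j : ℤ) + p]]) w) = 0 := by
    refine exists_box_bound (N := N2) (fun j p hjp q => ?_) fun j p =>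
      exists_ncoeff_add_eq_zero _ _ _
    have := hN2 (j + p) hjp
    rw [zero_add, Nat.cast_add] at this
    rw [this, map_zero]
  set B := M + B1 + B2
  set G : ℕ → ℕ → ℕ → V ⊗[ℂ] PowerSeries ℂ := fun t b c =>
    ((b + t).choose t : ℂ) • X t (n + (b + c : ℕ)) ⊗ₜ[ℂ] D (b + t) c with hG
  have hG0 : ∀ t b c, B ≤ t + b + c → G t b c = 0 := fun t b c htbc => by
    rw [hG]
    simp only
    rw [hM t (b + c) (by omega), TensorProduct.zero_tmul, smul_zero]
  -- the left-hand side; the Leibniz rule distributes the derivatives of `f` and `g`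
  have hl : ((tensorY Y (((tensorY Y (u ⊗ₜ[ℂ] f))[[k]]) (v ⊗ₜ[ℂ] g)))[[n]]) (w ⊗ₜ[ℂ] h) =
      ∑ c ∈ Finset.range B, ∑ p ∈ Finset.range B, ∑ s ∈ antidiagonal p, G s.1 s.2 c := by
    obtain ⟨T, hT⟩ := exists_ncoeff_add_eq_zero (Y u) k v
    have h1 : ((tensorY Y (((tensorY Y (u ⊗ₜ[ℂ] f))[[k]]) (v ⊗ₜ[ℂ] g)))[[n]]) (w ⊗ₜ[ℂ] h) =
        ∑ t ∈ Finset.range (T + B), ∑ i ∈ Finset.range B, ∑ s ∈ antidiagonal i, G t s.1 s.2 := by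
      rw [tensorY_tmul, finsum_eq_sum_range (n := T + B) (fun j hj => by
        rw [hT j (by omega), TensorProduct.zero_tmul])]
      simp only [map_sum, Finset.sum_apply, LinearMap.sum_apply]
      refine Finset.sum_congr rfl fun t _ => ?_
      rw [tensorY_tmul, finsum_eq_sum_range (n := B) (fun j hj => by
        rw [show ((Y (((Y u)[[k + t]]) v))[[n + j]]) w = 0 from hM t j (by omega),
          TensorProduct.zero_tmul])]
      refine Finset.sum_congr rfl fun i _ => ?_
      rw [taylorCoeff_mul, Finset.sum_mul, TensorProduct.tmul_sum]
      refine Finset.sum_congr rfl fun s hs => ?_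
      rw [← Finset.HasAntidiagonal.mem_antidiagonal.1 hs, taylorCoeff_taylorCoeff, smul_mul_assoc,
        smul_mul_assoc, TensorProduct.tmul_smul, mul_assoc]
    have h2 : ∑ t ∈ Finset.range (T + B), ∑ i ∈ Finset.range B, ∑ s ∈ antidiagonal i, G t s.1 s.2 =
        ∑ t ∈ Finset.range B, ∑ b ∈ Finset.range B, ∑ c ∈ Finset.range B, G t b c := by
      rw [← Finset.sum_subset (s₁ := Finset.range B)
        (fun i hi => by simp only [Finset.mem_range] at hi ⊢; omega)]
      · refine Finset.sum_congr rfl fun t _ => ?_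
        exact (sum_range_sum_range_eq_sum_antidiagonal fun b c hbc => hG0 t b c (by omega)).symm
      · intro t _ ht
        simp only [Finset.mem_range, not_lt] at ht
        exact Finset.sum_eq_zero fun i _ => Finset.sum_eq_zero fun s _ => hG0 _ _ _ (by omega)
    rw [h1, h2, Finset.sum_congr rfl fun t _ => Finset.sum_comm, Finset.sum_comm]
    refine Finset.sum_congr rfl fun c _ => ?_
    exact sum_range_sum_range_eq_sum_antidiagonal fun t b hbc => hG0 t b c (by omega)
  -- the Jacobi identity for `u` and `v`, with `(x - z)ᵏ` multiplied by `zᵖ`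
  have hinner : ∀ p q : ℕ, (∑ j ∈ Finset.range B, ((-1 : ℂ) ^ j * bin k j) •
      ((Y u)[[k - j + p]]) (((Y v)[[n + j + q]]) w) -
      ∑ j ∈ Finset.range B, ((-1 : ℂ) ^ k * (-1 : ℂ) ^ j * bin k j) •
        ((Y v)[[n + k - j + q]]) (((Y u)[[(j : ℤ) + p]]) w)) ⊗ₜ[ℂ] D p q =
      ∑ s ∈ antidiagonal p, G s.1 s.2 q := by
    intro p q
    have hj := hu v k p (n + q) w
    rw [fieldProd_apply] at hj
    simp only [shift_ncoeff] at hj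
    rw [finsum_eq_sum_range (n := B) (fun j hj => by
        rw [show n + (q : ℤ) + j = n + j + q by ring, hB1 j q p (Or.inl (by omega)), smul_zero]),
      finsum_eq_sum_range (n := B) (fun j hj => by
        rw [show n + (q : ℤ) + k - j = n + k - j + q by ring, hB2 j p q (Or.inl (by omega)),
          smul_zero]),
      finsum_eq_sum_range (n := p + 1) (fun j hj => by
        rw [bin_natCast, Nat.choose_eq_zero_of_lt (by omega), Nat.cast_zero, zero_smul])] at hj
    have e1 : ∀ j : ℕ, n + (q : ℤ) + j = n + j + q := fun j => by ring
    have e2 : ∀ j : ℕ, n + (q : ℤ) + k - j = n + k - j + q := fun j => by ring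
    simp only [e1, e2] at hj
    rw [hj, ← Finset.Nat.sum_antidiagonal_eq_sum_range_succ_mk
      (f := fun s : ℕ × ℕ => bin p s.1 •
        ((Y (((Y u)[[k + s.1]]) v))[[(p : ℤ) + (n + q) - s.1]]) w), TensorProduct.sum_tmul]
    refine Finset.sum_congr rfl fun s hs => ?_
    have hs' : s.1 + s.2 = p := Finset.HasAntidiagonal.mem_antidiagonal.1 hs
    rw [hG]
    simp only
    rw [TensorProduct.smul_tmul', ← hs', bin_natCast, add_comm s.2 s.1, hX]
    simp only
    rw [show ((s.1 + s.2 : ℕ) : ℤ) + (n + q) - s.1 = n + (s.2 + q : ℕ) by push_cast; ring]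
  rw [hl, Finset.sum_congr rfl fun q _ => Finset.sum_congr rfl fun p _ => (hinner p q).symm,
    fieldProd_apply]
  -- the two halves of the right-hand side
  have hr1 : ∀ j : ℕ, ((tensorY Y (u ⊗ₜ[ℂ] f))[[k - j]])
      (((tensorY Y (v ⊗ₜ[ℂ] g))[[n + j]]) (w ⊗ₜ[ℂ] h)) = ∑ q ∈ Finset.range B,
        ∑ p ∈ Finset.range B, ((Y u)[[k - j + p]]) (((Y v)[[n + j + q]]) w) ⊗ₜ[ℂ] D p q := by
    intro j
    rw [tensorY_tmul, finsum_eq_sum_range (n := B + N1) (fun q hq => by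
      have := hN1 (j + q) (by omega)
      rw [Nat.cast_add, ← add_assoc] at this
      rw [this, TensorProduct.zero_tmul]), map_sum,
      ← Finset.sum_subset (s₁ := Finset.range B)
        (fun i hi => by simp only [Finset.mem_range] at hi ⊢; omega)]
    · refine Finset.sum_congr rfl fun q _ => ?_
      rw [tensorY_tmul, finsum_eq_sum_range (n := B) (fun p hp => by
        rw [hB1 j q p (by omega), TensorProduct.zero_tmul])]
    · intro q _ hq
      simp only [Finset.mem_range, not_lt] at hq
      rw [tensorY_tmul]
      exact finsum_eq_zero_of_forall_eq_zero fun p => by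
        rw [hB1 j q p (by omega), TensorProduct.zero_tmul]
  have hr2 : ∀ j : ℕ, ((tensorY Y (v ⊗ₜ[ℂ] g))[[n + k - j]])
      (((tensorY Y (u ⊗ₜ[ℂ] f))[[(j : ℤ)]]) (w ⊗ₜ[ℂ] h)) = ∑ p ∈ Finset.range B,
        ∑ q ∈ Finset.range B,
          ((Y v)[[n + k - j + q]]) (((Y u)[[(j : ℤ) + p]]) w) ⊗ₜ[ℂ] D p q := by
    intro j
    rw [tensorY_tmul, finsum_eq_sum_range (n := B + N2) (fun p hp => by
      have := hN2 (j + p) (by omega)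
      rw [zero_add, Nat.cast_add] at this
      rw [this, TensorProduct.zero_tmul]), map_sum,
      ← Finset.sum_subset (s₁ := Finset.range B)
        (fun i hi => by simp only [Finset.mem_range] at hi ⊢; omega)]
    · refine Finset.sum_congr rfl fun p _ => ?_
      rw [tensorY_tmul, finsum_eq_sum_range (n := B) (fun q hq => by
        rw [hB2 j p q (by omega), TensorProduct.zero_tmul])]
      refine Finset.sum_congr rfl fun q _ => ?_
      rw [hD]
      simp only
      rw [mul_left_comm]
    · intro p _ hp
      simp only [Finset.mem_range, not_lt] at hp
      rw [tensorY_tmul]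
      exact finsum_eq_zero_of_forall_eq_zero fun q => by
        rw [hB2 j p q (by omega), TensorProduct.zero_tmul]
  simp only [hr1, hr2]
  rw [finsum_eq_sum_range (n := B) (fun j hj => by
      rw [Finset.sum_eq_zero fun q _ => Finset.sum_eq_zero fun p _ => ?_, smul_zero]
      rw [hB1 j q p (by omega), TensorProduct.zero_tmul]),
    finsum_eq_sum_range (n := B) (fun j hj => by
      rw [Finset.sum_eq_zero fun q _ => Finset.sum_eq_zero fun p _ => ?_, smul_zero]
      rw [hB2 j q p (by omega), TensorProduct.zero_tmul])]
  have hs1 : ∑ j ∈ Finset.range B, ((-1 : ℂ) ^ j * bin k j) • ∑ q ∈ Finset.range B,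
      ∑ p ∈ Finset.range B, ((Y u)[[k - j + p]]) (((Y v)[[n + j + q]]) w) ⊗ₜ[ℂ] D p q =
      ∑ q ∈ Finset.range B, ∑ p ∈ Finset.range B, (∑ j ∈ Finset.range B,
        ((-1 : ℂ) ^ j * bin k j) • ((Y u)[[k - j + p]]) (((Y v)[[n + j + q]]) w)) ⊗ₜ[ℂ] D p q := by
    simp only [Finset.smul_sum]
    rw [Finset.sum_comm]
    refine Finset.sum_congr rfl fun q _ => ?_
    rw [Finset.sum_comm]
    refine Finset.sum_congr rfl fun p _ => ?_
    rw [TensorProduct.sum_tmul]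
    exact Finset.sum_congr rfl fun j _ => TensorProduct.smul_tmul' _ _ _
  have hs2 : ∑ j ∈ Finset.range B, ((-1 : ℂ) ^ k * (-1 : ℂ) ^ j * bin k j) •
      ∑ p ∈ Finset.range B, ∑ q ∈ Finset.range B,
        ((Y v)[[n + k - j + q]]) (((Y u)[[(j : ℤ) + p]]) w) ⊗ₜ[ℂ] D p q =
      ∑ q ∈ Finset.range B, ∑ p ∈ Finset.range B, (∑ j ∈ Finset.range B,
        ((-1 : ℂ) ^ k * (-1 : ℂ) ^ j * bin k j) •
          ((Y v)[[n + k - j + q]]) (((Y u)[[(j : ℤ) + p]]) w)) ⊗ₜ[ℂ] D p q := by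
    simp only [Finset.smul_sum]
    rw [Finset.sum_congr rfl fun j _ => Finset.sum_comm, Finset.sum_comm]
    refine Finset.sum_congr rfl fun q _ => ?_
    rw [Finset.sum_comm]
    refine Finset.sum_congr rfl fun p _ => ?_
    rw [TensorProduct.sum_tmul]
    exact Finset.sum_congr rfl fun j _ => TensorProduct.smul_tmul' _ _ _
  rw [hs1, hs2, ← Finset.sum_sub_distrib]
  refine Finset.sum_congr rfl fun q _ => ?_
  rw [← Finset.sum_sub_distrib]
  exact Finset.sum_congr rfl fun p _ => TensorProduct.sub_tmul _ _ _

end TensorIterate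

/-! ### Pseudo-endomorphisms attached to isometries -/

theorem seriesMul_one (V : Type u) [AddCommGroup V] [Module ℂ V] :
    seriesMul V (1 : PowerSeries ℂ) = 1 :=
  TensorProduct.ext' fun v f => by rw [seriesMul_tmul, one_mul]; rfl

section Delta

variable {U : Type u} [AddCommGroup U] [Module ℂ U]

theorem tensorY_state_tmul (a : HSpace U) (f g : PowerSeries ℂ) (n : ℤ) (w : VHeis U) :
    ((tensorY (heisY U) (state U a ⊗ₜ[ℂ] f))[[n]]) (w ⊗ₜ[ℂ] g) =
      ∑ᶠ j : ℕ, heisMode U (n + j) a w ⊗ₜ[ℂ] (taylorCoeff j f * g) := by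
  rw [tensorY_tmul, heisY_state]
  simp only [heisField_ncoeff]

theorem exists_heisMode_add_eq_zero (a : HSpace U) (n : ℤ) (w : VHeis U) :
    ∃ N : ℕ, ∀ j : ℕ, N ≤ j → heisMode U (n + j) a w = 0 := by
  obtain ⟨N, hN⟩ := exists_heisMode_eq_zero a w
  exact ⟨(N - n).toNat, fun j hj => hN _ (by omega)⟩

theorem exists_heisMode_heisMode_eq_zero (a b : HSpace U) (m n : ℤ) (w : VHeis U) :
    ∃ N : ℕ, ∀ i j : ℕ, N ≤ i + j → heisMode U (n + j) b (heisMode U (m + i) a w) = 0 := by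
  refine exists_add_bound (f := fun i j : ℕ => heisMode U (n + j) b (heisMode U (m + i) a w)) ?_
    fun i => exists_heisMode_add_eq_zero b n _
  obtain ⟨N, hN⟩ := exists_heisMode_add_eq_zero a m w
  exact ⟨N, fun i hi j => by rw [hN i hi, map_zero]⟩

theorem tensorY_state_commutator_tmul (a b : HSpace U) (f g : PowerSeries ℂ) (m n : ℤ)
    (η : VHeis U ⊗[ℂ] PowerSeries ℂ) :
    ((tensorY (heisY U) (state U a ⊗ₜ[ℂ] f))[[m]])
        (((tensorY (heisY U) (state U b ⊗ₜ[ℂ] g))[[n]]) η) -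
      ((tensorY (heisY U) (state U b ⊗ₜ[ℂ] g))[[n]])
        (((tensorY (heisY U) (state U a ⊗ₜ[ℂ] f))[[m]]) η) =
      if 0 ≤ -m - n - 1 then
        symp U a b • seriesMul (VHeis U) (taylorCoeff (-m - n - 1).toNat (f * g)) η else 0 := by
  induction η using TensorProduct.induction_on with
  | zero => simp
  | add x y hx hy =>
    simp only [map_add]
    rw [add_sub_add_comm, hx, hy]
    split_ifs
    · rw [smul_add]
    · rw [add_zero]
  | tmul w h =>
    obtain ⟨N1, hN1⟩ := exists_heisMode_heisMode_eq_zero b a n m w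
    obtain ⟨N2, hN2⟩ := exists_heisMode_heisMode_eq_zero a b m n w
    have key : ∀ (a b : HSpace U) (f g : PowerSeries ℂ) (m n : ℤ) (N : ℕ)
        (_ : ∀ i j : ℕ, N ≤ i + j → heisMode U (m + j) a (heisMode U (n + i) b w) = 0),
        ((tensorY (heisY U) (state U a ⊗ₜ[ℂ] f))[[m]])
          (((tensorY (heisY U) (state U b ⊗ₜ[ℂ] g))[[n]]) (w ⊗ₜ[ℂ] h)) =
        ∑ t ∈ Finset.range N, ∑ p ∈ antidiagonal t,
          heisMode U (m + p.1) a (heisMode U (n + p.2) b w) ⊗ₜ[ℂ]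
            (taylorCoeff p.1 f * (taylorCoeff p.2 g * h)) := by
      intro a b f g m n N hN
      rw [← finsum_finsum_eq_sum_antidiagonal (f := fun i j : ℕ =>
        heisMode U (m + i) a (heisMode U (n + j) b w) ⊗ₜ[ℂ]
            (taylorCoeff i f * (taylorCoeff j g * h))) (n := N)
          (fun i j hij => by rw [hN j i (by omega), TensorProduct.zero_tmul]),
        finsum_comm_of_bounded (n := N)
          (fun i j hij => by rw [hN j i (by omega), TensorProduct.zero_tmul]),
        tensorY_state_tmul, map_finsum_of_eventually]
      · exact finsum_congr fun j => by rw [tensorY_state_tmul]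
      · obtain ⟨M, hM⟩ := exists_heisMode_add_eq_zero b n w
        exact ⟨M, fun j hj => by rw [hM j hj, TensorProduct.zero_tmul]⟩
    rw [key a b f g m n (N1 + N2) fun i j hij => hN1 i j (by omega),
      key b a g f n m (N1 + N2) fun i j hij => hN2 i j (by omega), ← Finset.sum_sub_distrib]
    have h1 : ∀ t ∈ Finset.range (N1 + N2), ∑ p ∈ antidiagonal t,
          heisMode U (m + p.1) a (heisMode U (n + p.2) b w) ⊗ₜ[ℂ]
            (taylorCoeff p.1 f * (taylorCoeff p.2 g * h)) -
        ∑ p ∈ antidiagonal t,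
          heisMode U (n + p.1) b (heisMode U (m + p.2) a w) ⊗ₜ[ℂ]
            (taylorCoeff p.1 g * (taylorCoeff p.2 f * h)) =
        if (t : ℤ) = -m - n - 1 then symp U a b • w ⊗ₜ[ℂ] (taylorCoeff t (f * g) * h) else 0 := by
      intro t _
      rw [← Finset.Nat.sum_antidiagonal_swap (n := t) (f := fun p : ℕ × ℕ =>
        heisMode U (n + p.1) b (heisMode U (m + p.2) a w) ⊗ₜ[ℂ]
            (taylorCoeff p.1 g * (taylorCoeff p.2 f * h))), ← Finset.sum_sub_distrib]
      simp only [Prod.fst_swap, Prod.snd_swap]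
      have h2 : ∀ p ∈ antidiagonal t, heisMode U (m + p.1) a (heisMode U (n + p.2) b w) ⊗ₜ[ℂ]
            (taylorCoeff p.1 f * (taylorCoeff p.2 g * h)) -
          heisMode U (n + p.2) b (heisMode U (m + p.1) a w) ⊗ₜ[ℂ]
            (taylorCoeff p.2 g * (taylorCoeff p.1 f * h)) =
          (if (t : ℤ) = -m - n - 1 then symp U a b else 0) •
            w ⊗ₜ[ℂ] (taylorCoeff p.1 f * taylorCoeff p.2 g * h) := by
        intro p hp
        have hp' := Finset.HasAntidiagonal.mem_antidiagonal.1 hp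
        rw [mul_left_comm (taylorCoeff p.2 g), ← TensorProduct.sub_tmul, heisMode_commutator,
          ← mul_assoc, TensorProduct.smul_tmul']
        congr 3
        rw [eq_iff_iff]
        omega
      rw [Finset.sum_congr rfl h2, ← Finset.smul_sum, ← TensorProduct.tmul_sum, ← Finset.sum_mul,
        ← taylorCoeff_mul, ite_smul, zero_smul]
    rw [Finset.sum_congr rfl h1]
    by_cases hmn : 0 ≤ -m - n - 1
    · rw [if_pos hmn, seriesMul_tmul]
      by_cases ht : (-m - n - 1).toNat < N1 + N2
      · rw [Finset.sum_eq_single_of_mem _ (Finset.mem_range.2 ht), if_pos (by omega)]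
        intro t _ htne
        rw [if_neg (by omega)]
      · -- both products vanish in the top degree, hence so does the pairing
        rw [Finset.sum_eq_zero fun t ht' => if_neg (by
          have := Finset.mem_range.1 ht'
          omega)]
        have h0 := heisMode_commutator (m + (-m - n - 1).toNat) (n + (0 : ℕ)) a b w
        rw [hN1 0 _ (by omega), hN2 _ 0 (by omega), sub_zero, if_pos (by push_cast; omega)] at h0
        rw [TensorProduct.smul_tmul', ← h0, TensorProduct.zero_tmul]
    · rw [if_neg hmn]
      exact Finset.sum_eq_zero fun t _ => if_neg (by omega)

variable [FiniteDimensional ℂ U]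

/-- The element `P(x)a = ∑ₖ (Pₖ a) xᵏ` of `V_ℋ ⊗ ℂ[[x]]`, where `P(x) ∈ (End H)[[x]]` and
`a ∈ H ⊂ V_ℋ`. -/
def stateTensor (P : ℕ → Module.End ℂ (HSpace U)) :
    HSpace U →ₗ[ℂ] VHeis U ⊗[ℂ] PowerSeries ℂ where
  toFun a := ∑ i, state U (Module.finBasis ℂ (HSpace U) i) ⊗ₜ[ℂ]
    PowerSeries.mk fun k => (Module.finBasis ℂ (HSpace U)).repr (P k a) i
  map_add' a b := by
    rw [← Finset.sum_add_distrib]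
    refine Finset.sum_congr rfl fun i _ => ?_
    rw [← TensorProduct.tmul_add]
    congr 1
    ext k
    simp
  map_smul' c a := by
    rw [Finset.smul_sum]
    refine Finset.sum_congr rfl fun i _ => ?_
    rw [RingHom.id_apply, ← TensorProduct.tmul_smul]
    congr 1
    ext k
    simp

theorem stateTensor_apply (P : ℕ → Module.End ℂ (HSpace U)) (a : HSpace U) :
    stateTensor P a = ∑ i, state U (Module.finBasis ℂ (HSpace U) i) ⊗ₜ[ℂ]
      PowerSeries.mk fun k => (Module.finBasis ℂ (HSpace U)).repr (P k a) i := rfl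

@[simp] theorem tcoeff_stateTensor (P : ℕ → Module.End ℂ (HSpace U)) (a : HSpace U) (k : ℕ) :
    tcoeff (VHeis U) k (stateTensor P a) = state U (P k a) := by
  conv_rhs => rw [← (Module.finBasis ℂ (HSpace U)).sum_repr (P k a), map_sum]
  simp only [stateTensor_apply, map_sum, tcoeff_tmul, PowerSeries.coeff_mk, map_smul]

/-- `P(x) ∈ (End H)[[x]]` preserves the form on `H`. -/
def IsIsometry (P : ℕ → Module.End ℂ (HSpace U)) : Prop :=
  ∀ (s : ℕ) (a b : HSpace U), ∑ p ∈ antidiagonal s, symp U (P p.1 a) (P p.2 b) =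
    if s = 0 then symp U a b else 0

theorem IsIsometry.sum_eq {P : ℕ → Module.End ℂ (HSpace U)} (hP : IsIsometry P)
    (a b : HSpace U) :
    ∑ i, ∑ j, symp U (Module.finBasis ℂ (HSpace U) i) (Module.finBasis ℂ (HSpace U) j) •
      ((PowerSeries.mk fun k => (Module.finBasis ℂ (HSpace U)).repr (P k a) i) *
        (PowerSeries.mk fun k => (Module.finBasis ℂ (HSpace U)).repr (P k b) j)) =
      symp U a b • (1 : PowerSeries ℂ) := by
  set e := Module.finBasis ℂ (HSpace U)
  ext s
  have h := hP s a b
  have h2 : ∀ x y : HSpace U, symp U x y = ∑ i, ∑ j, symp U (e i) (e j) *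
      (e.repr x i * e.repr y j) := by
    intro x y
    conv_lhs => rw [← e.sum_repr x, ← e.sum_repr y]
    simp only [map_sum, LinearMap.sum_apply, map_smul, LinearMap.smul_apply, smul_eq_mul,
      Finset.mul_sum]
    rw [Finset.sum_comm]
    refine Finset.sum_congr rfl fun i _ => ?_
    exact Finset.sum_congr rfl fun j _ => by ring
  simp only [map_sum, map_smul, PowerSeries.coeff_mul, PowerSeries.coeff_mk, smul_eq_mul,
    PowerSeries.coeff_one, mul_ite, mul_one, mul_zero]
  have h3 : ∑ p ∈ antidiagonal s, symp U (P p.1 a) (P p.2 b) = ∑ p ∈ antidiagonal s,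
      ∑ i, ∑ j, symp U (e i) (e j) * (e.repr (P p.1 a) i * e.repr (P p.2 b) j) :=
    Finset.sum_congr rfl fun p _ => h2 _ _
  rw [← h, h3]
  symm
  rw [Finset.sum_comm]
  refine Finset.sum_congr rfl fun i _ => ?_
  rw [Finset.sum_comm]
  refine Finset.sum_congr rfl fun j _ => ?_
  rw [Finset.mul_sum]

theorem tensorY_stateTensor_commutator {P : ℕ → Module.End ℂ (HSpace U)} (hP : IsIsometry P)
    (m n : ℤ) (a b : HSpace U) (η : VHeis U ⊗[ℂ] PowerSeries ℂ) :
    ((tensorY (heisY U) (stateTensor P a))[[m]])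
        (((tensorY (heisY U) (stateTensor P b))[[n]]) η) -
      ((tensorY (heisY U) (stateTensor P b))[[n]])
        (((tensorY (heisY U) (stateTensor P a))[[m]]) η) =
      (if m + n + 1 = 0 then symp U a b else 0) • η := by
  set e := Module.finBasis ℂ (HSpace U) with he
  have h1 : ((tensorY (heisY U) (stateTensor P a))[[m]])
        (((tensorY (heisY U) (stateTensor P b))[[n]]) η) -
      ((tensorY (heisY U) (stateTensor P b))[[n]])
        (((tensorY (heisY U) (stateTensor P a))[[m]]) η) = ∑ i, ∑ j,
      if 0 ≤ -m - n - 1 then symp U (e i) (e j) • seriesMul (VHeis U)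
        (taylorCoeff (-m - n - 1).toNat ((PowerSeries.mk fun k => e.repr (P k a) i) *
          (PowerSeries.mk fun k => e.repr (P k b) j))) η else 0 := by
    simp only [stateTensor_apply, map_sum, Finset.sum_apply, LinearMap.sum_apply]
    rw [Finset.sum_congr rfl fun j _ => rfl, Finset.sum_comm, ← Finset.sum_sub_distrib]
    refine Finset.sum_congr rfl fun i _ => ?_
    rw [← Finset.sum_sub_distrib]
    refine Finset.sum_congr rfl fun j _ => ?_
    exact tensorY_state_commutator_tmul _ _ _ _ m n η
  rw [h1]
  by_cases hmn : 0 ≤ -m - n - 1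
  · have h2 := congrArg (fun f => seriesMul (VHeis U) (taylorCoeff (-m - n - 1).toNat f) η)
      (hP.sum_eq a b)
    simp only [map_sum, map_smul, LinearMap.sum_apply, LinearMap.smul_apply] at h2
    simp only [if_pos hmn]
    rw [h2, taylorCoeff_one]
    by_cases h0 : m + n + 1 = 0
    · rw [if_pos h0, if_pos (by omega)]
      rw [seriesMul_one]
      rfl
    · rw [if_neg h0, if_neg (by omega)]
      simp
  · simp only [if_neg hmn, Finset.sum_const_zero]
    rw [if_neg (by omega), zero_smul]

end Delta

section DeltaMap

variable {U : Type u} [AddCommGroup U] [Module ℂ U]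

theorem tensorY_vac_tmul_one (n : ℤ) (η : VHeis U ⊗[ℂ] PowerSeries ℂ) :
    ((tensorY (heisY U) (vac U ⊗ₜ[ℂ] 1))[[n]]) η = if n = -1 then η else 0 := by
  induction η using TensorProduct.induction_on with
  | zero => simp
  | add x y hx hy =>
    rw [map_add, hx, hy]
    split_ifs
    · rfl
    · rw [add_zero]
  | tmul v f =>
    rw [tensorY_tmul_one, heisY_vac, oneField_ncoeff_apply]
    split_ifs
    · rfl
    · rw [TensorProduct.zero_tmul]

theorem IsPseudoEnd.dcoeff_heisMode {Δ : VHeis U →ₗ[ℂ] VHeis U ⊗[ℂ] PowerSeries ℂ}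
    (h : IsPseudoEnd (vac U) (heisY U) Δ) {P : ℕ → Module.End ℂ (HSpace U)}
    (hs : ∀ n a, dcoeff Δ n (state U a) = state U (P n a)) (p : ℕ) (q : ℤ) (a : HSpace U)
    (w : VHeis U) :
    dcoeff Δ p (heisMode U q a w) = ∑ i ∈ Finset.range (p + 1), ∑ᶠ j : ℕ,
      ((-1 : ℂ) ^ j * ((p - i + j).choose j : ℂ)) •
        heisMode U (q + j) (P (p - i + j) a) (dcoeff Δ i w) := by
  rw [← heisField_ncoeff, ← heisY_state, h.map_Y]
  refine Finset.sum_congr rfl fun i _ => finsum_congr fun j => ?_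
  rw [hs, heisY_state, heisField_ncoeff]

/-- A pseudo-endomorphism of `V_ℋ` is determined by its restriction to `H`. -/
theorem IsPseudoEnd.unique {Δ Δ' : VHeis U →ₗ[ℂ] VHeis U ⊗[ℂ] PowerSeries ℂ}
    (h : IsPseudoEnd (vac U) (heisY U) Δ) (h' : IsPseudoEnd (vac U) (heisY U) Δ')
    {P : ℕ → Module.End ℂ (HSpace U)}
    (hs : ∀ n a, dcoeff Δ n (state U a) = state U (P n a))
    (hs' : ∀ n a, dcoeff Δ' n (state U a) = state U (P n a)) : Δ = Δ' := by
  refine LinearMap.ext fun v => tcoeff_ext fun n => ?_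
  rw [← dcoeff_apply, ← dcoeff_apply]
  induction v using vheis_induction generalizing n with
  | vac => rw [dcoeff_apply, dcoeff_apply, h.map_one, h'.map_one]
  | add x y hx hy => rw [map_add, map_add, hx, hy]
  | smul c x hx => rw [map_smul, map_smul, hx]
  | mode k a x hx =>
    rw [h.dcoeff_heisMode hs, h'.dcoeff_heisMode hs']
    simp only [hx]

theorem exists_forall_heisMode_eq_zero (v : VHeis U) :
    ∃ N : ℤ, ∀ n : ℤ, N ≤ n → ∀ a, heisMode U n a v = 0 := by
  induction v using vheis_induction with
  | vac => exact ⟨0, fun n hn a => heisMode_vac n hn a⟩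
  | add x y hx hy =>
    obtain ⟨N, hN⟩ := hx
    obtain ⟨M, hM⟩ := hy
    exact ⟨max N M, fun n hn a => by
      rw [map_add, hN n (le_trans (le_max_left _ _) hn), hM n (le_trans (le_max_right _ _) hn),
        add_zero]⟩
  | smul c x hx =>
    obtain ⟨N, hN⟩ := hx
    exact ⟨N, fun n hn a => by rw [map_smul, hN n hn, smul_zero]⟩
  | mode k b x hx =>
    obtain ⟨N, hN⟩ := hx
    refine ⟨max N (-k), fun n hn a => ?_⟩
    have h := heisMode_commutator n k a b x
    rw [hN n (le_trans (le_max_left _ _) hn), map_zero, sub_zero, if_neg, zero_smul] at h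
    · exact h
    · have := le_trans (le_max_right N (-k)) hn
      omega

/-- Pseudo-endomorphisms of `V_ℋ` commute if their restrictions to `H` do. -/
theorem IsPseudoEnd.dcoeff_comm {Δ Δ' : VHeis U →ₗ[ℂ] VHeis U ⊗[ℂ] PowerSeries ℂ}
    (h : IsPseudoEnd (vac U) (heisY U) Δ) (h' : IsPseudoEnd (vac U) (heisY U) Δ')
    {P Q : ℕ → Module.End ℂ (HSpace U)}
    (hs : ∀ n a, dcoeff Δ n (state U a) = state U (P n a))
    (hs' : ∀ n a, dcoeff Δ' n (state U a) = state U (Q n a))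
    (hPQ : ∀ m n a, P m (Q n a) = Q n (P m a)) (p q : ℕ) (w : VHeis U) :
    dcoeff Δ p (dcoeff Δ' q w) = dcoeff Δ' q (dcoeff Δ p w) := by
  induction w using vheis_induction generalizing p q with
  | vac =>
    simp only [dcoeff_apply, h.map_one, h'.map_one, tcoeff_tmul, map_smul]
    rw [smul_comm]
  | add x y hx hy => simp only [map_add, hx, hy]
  | smul c x hx => simp only [map_smul, hx]
  | mode n a x hx =>
    have hN : ∃ N : ℕ, ∀ k : ℕ, N ≤ k → ∀ i ≤ p, ∀ l ≤ q, ∀ b,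
        heisMode U (n + k) b (dcoeff Δ i (dcoeff Δ' l x)) = 0 ∧
        heisMode U (n + k) b (dcoeff Δ i x) = 0 ∧
        heisMode U (n + k) b (dcoeff Δ' l x) = 0 := by
      have h1 := fun i l => exists_forall_heisMode_eq_zero (dcoeff Δ i (dcoeff Δ' l x))
      have h2 := fun i => exists_forall_heisMode_eq_zero (dcoeff Δ i x)
      have h3 := fun l => exists_forall_heisMode_eq_zero (dcoeff Δ' l x)
      choose N1 hN1 using h1
      choose N2 hN2 using h2
      choose N3 hN3 using h3
      refine ⟨(∑ i ∈ Finset.range (p + 1), ∑ l ∈ Finset.range (q + 1), (N1 i l - n).toNat) +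
        (∑ i ∈ Finset.range (p + 1), (N2 i - n).toNat) +
        (∑ l ∈ Finset.range (q + 1), (N3 l - n).toNat), fun k hk i hi l hl b => ?_⟩
      have e1 := Finset.single_le_sum (f := fun i => ∑ l ∈ Finset.range (q + 1), (N1 i l - n).toNat)
        (fun _ _ => Nat.zero_le _) (Finset.mem_range.2 (show i < p + 1 by omega))
      have e1' := Finset.single_le_sum (f := fun l => (N1 i l - n).toNat)
        (fun _ _ => Nat.zero_le _) (Finset.mem_range.2 (show l < q + 1 by omega))
      have e2 := Finset.single_le_sum (f := fun i => (N2 i - n).toNat)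
        (fun _ _ => Nat.zero_le _) (Finset.mem_range.2 (show i < p + 1 by omega))
      have e3 := Finset.single_le_sum (f := fun l => (N3 l - n).toNat)
        (fun _ _ => Nat.zero_le _) (Finset.mem_range.2 (show l < q + 1 by omega))
      exact ⟨hN1 i l _ (by omega) b, hN2 i _ (by omega) b, hN3 l _ (by omega) b⟩
    obtain ⟨N, hN⟩ := hN
    -- with `N` as a common bound, both sides are the same sum over boxes, up to the order of
    -- summation
    have key : ∀ (Δ Δ' : VHeis U →ₗ[ℂ] VHeis U ⊗[ℂ] PowerSeries ℂ)
        (P Q : ℕ → Module.End ℂ (HSpace U)) (p q : ℕ)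
        (_ : IsPseudoEnd (vac U) (heisY U) Δ) (_ : IsPseudoEnd (vac U) (heisY U) Δ')
        (_ : ∀ n a, dcoeff Δ n (state U a) = state U (P n a))
        (_ : ∀ n a, dcoeff Δ' n (state U a) = state U (Q n a))
        (_ : ∀ k : ℕ, N ≤ k → ∀ i ≤ p, ∀ l ≤ q, ∀ b,
          heisMode U (n + k) b (dcoeff Δ i (dcoeff Δ' l x)) = 0)
        (_ : ∀ k : ℕ, N ≤ k → ∀ l ≤ q, ∀ b, heisMode U (n + k) b (dcoeff Δ' l x) = 0),
        dcoeff Δ p (dcoeff Δ' q (heisMode U n a x)) =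
          ∑ y ∈ Finset.range (q + 1) ×ˢ Finset.range N,
            ∑ z ∈ Finset.range (p + 1) ×ˢ Finset.range N,
            (((-1 : ℂ) ^ y.2 * ((q - y.1 + y.2).choose y.2 : ℂ)) *
              ((-1 : ℂ) ^ z.2 * ((p - z.1 + z.2).choose z.2 : ℂ))) •
              heisMode U (n + y.2 + z.2) (P (p - z.1 + z.2) (Q (q - y.1 + y.2) a))
                (dcoeff Δ z.1 (dcoeff Δ' y.1 x)) := by
      intro Δ Δ' P Q p q h h' hs hs' hN1 hN2
      rw [h'.dcoeff_heisMode hs', map_sum, Finset.sum_product]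
      refine Finset.sum_congr rfl fun l hl => ?_
      have hl' := Nat.lt_succ_iff.1 (Finset.mem_range.1 hl)
      rw [finsum_eq_sum_range (n := N) fun k hk => by rw [hN2 k hk l hl', smul_zero], map_sum]
      refine Finset.sum_congr rfl fun k _ => ?_
      rw [map_smul, h.dcoeff_heisMode hs, Finset.sum_product, Finset.smul_sum]
      refine Finset.sum_congr rfl fun i hi => ?_
      have hi' := Nat.lt_succ_iff.1 (Finset.mem_range.1 hi)
      rw [finsum_eq_sum_range (n := N) fun j hj => by
        have := hN1 (k + j) (by omega) i hi' l hl'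
        rw [Nat.cast_add, ← add_assoc] at this
        rw [this, smul_zero], Finset.smul_sum]
      refine Finset.sum_congr rfl fun j _ => ?_
      rw [smul_smul]
    rw [key Δ Δ' P Q p q h h' hs hs' (fun k hk i hi l hl b => (hN k hk i hi l hl b).1)
        (fun k hk l hl b => (hN k hk 0 (Nat.zero_le _) l hl b).2.2),
      key Δ' Δ Q P q p h' h hs' hs (fun k hk l hl i hi b => by
        rw [← hx]; exact (hN k hk i hi l hl b).1)
        (fun k hk i hi b => (hN k hk i hi 0 (Nat.zero_le _) b).2.1), Finset.sum_comm]
    refine Finset.sum_congr rfl fun z _ => Finset.sum_congr rfl fun y _ => ?_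
    rw [hPQ, hx, mul_comm, add_right_comm]

variable [FiniteDimensional ℂ U]

theorem tensorY_stateTensor_tmul (P : ℕ → Module.End ℂ (HSpace U)) (a : HSpace U) (n : ℤ)
    (w : VHeis U) (g : PowerSeries ℂ) :
    ((tensorY (heisY U) (stateTensor P a))[[n]]) (w ⊗ₜ[ℂ] g) =
      ∑ i, ∑ᶠ j : ℕ, heisMode U (n + j) (Module.finBasis ℂ (HSpace U) i) w ⊗ₜ[ℂ]
        (taylorCoeff j (PowerSeries.mk fun k =>
          (Module.finBasis ℂ (HSpace U)).repr (P k a) i) * g) := by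
  simp only [stateTensor_apply, map_sum, Finset.sum_apply, LinearMap.sum_apply]
  exact Finset.sum_congr rfl fun i _ => tensorY_state_tmul _ _ _ _ _

theorem tensorY_stateTensor_iterate (P : ℕ → Module.End ℂ (HSpace U)) (a : HSpace U) (k : ℤ)
    (ξ : VHeis U ⊗[ℂ] PowerSeries ℂ) :
    tensorY (heisY U) (((tensorY (heisY U) (stateTensor P a))[[k]]) ξ) =
      fieldProd (tensorY (heisY U) (stateTensor P a)) k (tensorY (heisY U) ξ) := by
  have h : ∀ A B : VertexOperator ℂ (VHeis U ⊗[ℂ] PowerSeries ℂ),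
    fieldProd A k B = fieldProdHom k A B := fun _ _ => rfl
  rw [h]
  simp only [stateTensor_apply, map_sum, Finset.sum_apply, LinearMap.sum_apply]
  refine Finset.sum_congr rfl fun i _ => ?_
  rw [tensorY_iterate fun v l m n w => (jacobiAt_state _ v).apply l m n w]
  rfl

/-- The fields `Y(P(x)a, z)` on `V_ℋ ⊗ ℂ[[x]]` satisfy the Heisenberg relations because `P(x)` is an
isometry. -/
theorem exists_deltaMap {P : ℕ → Module.End ℂ (HSpace U)} (hP : IsIsometry P) :
    ∃ Δ : VHeis U →ₗ[ℂ] VHeis U ⊗[ℂ] PowerSeries ℂ, Δ (vac U) = vac U ⊗ₜ[ℂ] 1 ∧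
      ∀ (n : ℤ) (a : HSpace U) (v : VHeis U),
        Δ (heisMode U n a v) = ((tensorY (heisY U) (stateTensor P a))[[n]]) (Δ v) := by
  refine exists_heisHom (fun n => yMode (tensorY (heisY U)) n ∘ₗ stateTensor P) _ ?_ ?_
  · intro m n a b η
    exact tensorY_stateTensor_commutator hP m n a b η
  · intro n a hn
    change ((tensorY (heisY U) (stateTensor P a))[[n]]) _ = 0
    rw [tensorY_stateTensor_tmul]
    refine Finset.sum_eq_zero fun i _ => finsum_eq_zero_of_forall_eq_zero fun j => ?_
    rw [heisMode_vac _ (by omega), TensorProduct.zero_tmul]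

/-- The pseudo-endomorphism `Δ(x)` of `V_ℋ` with `Δ(x)a = P(x)a` for `a ∈ H`, where `P(x)` is an
isometry of `H`: the homomorphism from `V_ℋ` to the tensor product vertex algebra
`V_ℋ ⊗ ℂ[[x]]` that extends `a ↦ P(x)a`. -/
def deltaMap {P : ℕ → Module.End ℂ (HSpace U)} (hP : IsIsometry P) :
    VHeis U →ₗ[ℂ] VHeis U ⊗[ℂ] PowerSeries ℂ :=
  (exists_deltaMap hP).choose

variable {P : ℕ → Module.End ℂ (HSpace U)} (hP : IsIsometry P)

theorem deltaMap_vac : deltaMap hP (vac U) = vac U ⊗ₜ[ℂ] 1 := (exists_deltaMap hP).choose_spec.1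

theorem deltaMap_mode (n : ℤ) (a : HSpace U) (v : VHeis U) :
    deltaMap hP (heisMode U n a v) =
      ((tensorY (heisY U) (stateTensor P a))[[n]]) (deltaMap hP v) :=
  (exists_deltaMap hP).choose_spec.2 n a v

theorem deltaMap_state (a : HSpace U) : deltaMap hP (state U a) = stateTensor P a := by
  change deltaMap hP (heisMode U (-1) a (vac U)) = _
  rw [deltaMap_mode, deltaMap_vac, tensorY_stateTensor_tmul, stateTensor_apply]
  refine Finset.sum_congr rfl fun i _ => ?_
  rw [finsum_eq_single _ 0]
  · rw [Nat.cast_zero, add_zero, taylorCoeff_zero, mul_one]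
    rfl
  · intro j hj
    rw [heisMode_vac _ (by omega), TensorProduct.zero_tmul]

/-- `Δ(x)` is a homomorphism to the tensor product of `V_ℋ` and `ℂ[[x]]`. -/
theorem deltaMap_heisY (v w : VHeis U) (n : ℤ) :
    deltaMap hP (((heisY U v)[[n]]) w) =
      ((tensorY (heisY U) (deltaMap hP v))[[n]]) (deltaMap hP w) := by
  induction v using vheis_induction generalizing n w with
  | vac =>
    rw [heisY_vac, oneField_ncoeff_apply, deltaMap_vac, tensorY_vac_tmul_one]
    split_ifs
    · rfl
    · rw [map_zero]
  | add x y hx hy =>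
    simp only [map_add, Pi.add_apply, LinearMap.add_apply, hx, hy]
  | smul c x hx =>
    simp only [map_smul, Pi.smul_apply, LinearMap.smul_apply, hx]
  | mode k a x hx =>
    rw [heisY_mode, fieldProd_apply, deltaMap_mode, tensorY_stateTensor_iterate, fieldProd_apply,
      map_sub]
    congr 1
    · rw [map_finsum_of_eventually]
      · refine finsum_congr fun j => ?_
        rw [map_smul, heisField_ncoeff, deltaMap_mode, hx]
      · obtain ⟨N, hN⟩ := exists_ncoeff_add_eq_zero (heisY U x) n w
        exact ⟨N, fun j hj => by rw [hN j hj, map_zero, smul_zero]⟩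
    · rw [map_finsum_of_eventually]
      · refine finsum_congr fun j => ?_
        rw [map_smul, hx, heisField_ncoeff, deltaMap_mode]
      · obtain ⟨N, hN⟩ := exists_ncoeff_add_eq_zero (heisField a) 0 w
        simp only [zero_add] at hN
        exact ⟨N, fun j hj => by rw [hN j hj, map_zero, smul_zero]⟩

theorem deltaMap_isPseudoEnd : IsPseudoEnd (vac U) (heisY U) (deltaMap hP) where
  map_one := deltaMap_vac hP
  map_Y v w p q := by
    rw [dcoeff_apply, deltaMap_heisY, tcoeff_tensorY]
    rfl

theorem dcoeff_deltaMap_state (n : ℕ) (a : HSpace U) :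
    dcoeff (deltaMap hP) n (state U a) = state U (P n a) := by
  rw [dcoeff_apply, deltaMap_state, tcoeff_stateTensor]

/-- The `ℂ[[x]]`-linear extension of `Δ(x)`. -/
def deltaExt {V : Type v} [AddCommGroup V] [Module ℂ V] (Δ : V →ₗ[ℂ] V ⊗[ℂ] PowerSeries ℂ) :
    V ⊗[ℂ] PowerSeries ℂ →ₗ[ℂ] V ⊗[ℂ] PowerSeries ℂ :=
  TensorProduct.lift ((seriesMul V).flip ∘ₗ Δ)

@[simp] theorem deltaExt_tmul {V : Type v} [AddCommGroup V] [Module ℂ V]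
    (Δ : V →ₗ[ℂ] V ⊗[ℂ] PowerSeries ℂ) (w : V) (f : PowerSeries ℂ) :
    deltaExt Δ (w ⊗ₜ[ℂ] f) = seriesMul V f (Δ w) := by
  simp [deltaExt]

theorem tcoeff_seriesMul {V : Type v} [AddCommGroup V] [Module ℂ V] (s : ℕ) (f : PowerSeries ℂ)
    (ξ : V ⊗[ℂ] PowerSeries ℂ) :
    tcoeff V s (seriesMul V f ξ) =
      ∑ p ∈ antidiagonal s, PowerSeries.coeff p.1 f • tcoeff V p.2 ξ := by
  induction ξ using TensorProduct.induction_on with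
  | zero => simp
  | add x y hx hy => simp only [map_add, smul_add, Finset.sum_add_distrib, hx, hy]
  | tmul v g =>
    simp only [seriesMul_tmul, tcoeff_tmul, PowerSeries.coeff_mul, Finset.sum_smul, mul_smul]

theorem tcoeff_deltaExt {V : Type v} [AddCommGroup V] [Module ℂ V]
    (Δ : V →ₗ[ℂ] V ⊗[ℂ] PowerSeries ℂ) (s : ℕ) (ξ : V ⊗[ℂ] PowerSeries ℂ) :
    tcoeff V s (deltaExt Δ ξ) =
      ∑ p ∈ antidiagonal s, dcoeff Δ p.1 (tcoeff V p.2 ξ) := by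
  induction ξ using TensorProduct.induction_on with
  | zero => simp
  | add x y hx hy => simp only [map_add, Finset.sum_add_distrib, hx, hy]
  | tmul v g =>
    rw [deltaExt_tmul, tcoeff_seriesMul, ← Finset.Nat.sum_antidiagonal_swap]
    refine Finset.sum_congr rfl fun p _ => ?_
    rw [tcoeff_tmul, map_smul, dcoeff_apply]
    rfl

theorem deltaExt_tensorY (n : ℤ) (ξ η : VHeis U ⊗[ℂ] PowerSeries ℂ) :
    deltaExt (deltaMap hP) (((tensorY (heisY U) ξ)[[n]]) η) =
      ((tensorY (heisY U) (deltaExt (deltaMap hP) ξ))[[n]]) (deltaExt (deltaMap hP) η) := by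
  induction ξ using TensorProduct.induction_on with
  | zero => simp
  | add x y hx hy => simp only [map_add, Pi.add_apply, LinearMap.add_apply, hx, hy]
  | tmul v f =>
    induction η using TensorProduct.induction_on with
    | zero => simp
    | add x y hx hy => simp only [map_add, hx, hy]
    | tmul w g =>
      rw [deltaExt_tmul, deltaExt_tmul, tensorY_seriesMul_left, tensorY_tmul,
        map_finsum_of_eventually]
      · refine finsum_congr fun j => ?_
        rw [deltaExt_tmul, deltaMap_heisY, tensorY_seriesMul_right, seriesMul_mul]
      · obtain ⟨N, hN⟩ := exists_ncoeff_add_eq_zero (heisY U v) n w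
        exact ⟨N, fun j hj => by rw [hN j hj, TensorProduct.zero_tmul]⟩

/-- If `P(x)Q(x) = 1`, then the extension of `a ↦ P(x)a` is a left inverse of that of
`a ↦ Q(x)a`. -/
theorem deltaExt_deltaMap {Q : ℕ → Module.End ℂ (HSpace U)} (hQ : IsIsometry Q)
    (hPQ : ∀ s, ∑ p ∈ antidiagonal s, P p.1 * Q p.2 = if s = 0 then 1 else 0) (w : VHeis U) :
    deltaExt (deltaMap hP) (deltaMap hQ w) = w ⊗ₜ[ℂ] 1 := by
  have hstate : ∀ a, deltaExt (deltaMap hP) (stateTensor Q a) = state U a ⊗ₜ[ℂ] 1 := by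
    intro a
    refine tcoeff_ext fun s => ?_
    rw [tcoeff_deltaExt]
    simp only [tcoeff_stateTensor, dcoeff_deltaMap_state]
    rw [← map_sum, tcoeff_tmul, PowerSeries.coeff_one]
    have h := LinearMap.congr_fun (hPQ s) a
    simp only [LinearMap.sum_apply, Module.End.mul_apply] at h
    rw [h]
    split_ifs
    · rw [Module.End.one_apply, one_smul]
    · rw [LinearMap.zero_apply, map_zero, zero_smul]
  induction w using vheis_induction with
  | vac => rw [deltaMap_vac, deltaExt_tmul, deltaMap_vac, seriesMul_one]; rfl
  | add x y hx hy => rw [map_add, map_add, hx, hy, TensorProduct.add_tmul]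
  | smul c x hx => rw [map_smul, map_smul, hx, TensorProduct.smul_tmul']
  | mode n a x hx =>
    rw [deltaMap_mode, deltaExt_tensorY, hx, hstate, tensorY_tmul_one, heisY_state,
      heisField_ncoeff]

theorem mk_dcoeff_mul_mk_dcoeff {Q : ℕ → Module.End ℂ (HSpace U)} (hQ : IsIsometry Q)
    (hPQ : ∀ s, ∑ p ∈ antidiagonal s, P p.1 * Q p.2 = if s = 0 then 1 else 0) :
    PowerSeries.mk (dcoeff (deltaMap hP)) * PowerSeries.mk (dcoeff (deltaMap hQ)) = 1 := by
  ext s : 1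
  refine LinearMap.ext fun w => ?_
  have h := congrArg (tcoeff (VHeis U) s) (deltaExt_deltaMap hP hQ hPQ w)
  rw [tcoeff_deltaExt, tcoeff_tmul] at h
  rw [PowerSeries.coeff_mul, LinearMap.sum_apply]
  simp only [PowerSeries.coeff_mk, Module.End.mul_apply, dcoeff_apply] at h ⊢
  rw [h, PowerSeries.coeff_one, PowerSeries.coeff_one]
  split_ifs
  · rw [one_smul]; rfl
  · rw [zero_smul]; rfl

end DeltaMap

/-! ### The pair `Δ_R^±` -/

section DeltaPair

theorem seriesInv_mul {E : Type v} [Ring E] {A : PowerSeries E}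
    (hA : PowerSeries.constantCoeff A = 1) : seriesInv A * A = 1 :=
  PowerSeries.invOfUnit_mul A 1 hA

theorem mul_seriesInv {E : Type v} [Ring E] {A : PowerSeries E}
    (hA : PowerSeries.constantCoeff A = 1) : A * seriesInv A = 1 :=
  PowerSeries.mul_invOfUnit A 1 hA

theorem sum_coeff_mul_eq_ite {E : Type v} [Ring E] {A B : PowerSeries E} (h : A * B = 1) (s : ℕ) :
    ∑ p ∈ antidiagonal s, PowerSeries.coeff p.1 A * PowerSeries.coeff p.2 B =
      if s = 0 then 1 else 0 := by
  rw [← PowerSeries.coeff_mul, h, PowerSeries.coeff_one]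

theorem commute_C_iff {E : Type v} [Ring E] (T : E) (A : PowerSeries E) :
    Commute (PowerSeries.C T) A ↔ ∀ k, Commute T (PowerSeries.coeff k A) := by
  constructor
  · intro h k
    have := congrArg (PowerSeries.coeff k) h.eq
    rwa [PowerSeries.coeff_C_mul, PowerSeries.coeff_mul_C] at this
  · intro h
    ext k
    rw [PowerSeries.coeff_C_mul, PowerSeries.coeff_mul_C]
    exact (h k).eq

theorem commute_coeff_seriesInv {E : Type v} [Ring E] {A : PowerSeries E}
    (hA : PowerSeries.constantCoeff A = 1) {T : E} (h : ∀ k, Commute T (PowerSeries.coeff k A))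
    (k : ℕ) : Commute T (PowerSeries.coeff k (seriesInv A)) := by
  revert k
  rw [← commute_C_iff] at h ⊢
  let u : (PowerSeries E)ˣ := ⟨A, seriesInv A, mul_seriesInv hA, seriesInv_mul hA⟩
  exact Commute.units_inv_right (u := u) h

variable {U : Type u} [AddCommGroup U] [Module ℂ U]

theorem constantCoeff_seriesInv {E : Type v} [Ring E] (A : PowerSeries E) :
    PowerSeries.constantCoeff (seriesInv A) = 1 := by
  rw [seriesInv, PowerSeries.constantCoeff_invOfUnit]
  simp

theorem constantCoeff_dualSeries (R : PowerSeries (Module.End ℂ U)) :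
    PowerSeries.constantCoeff (dualSeries R) = 1 := by
  rw [← PowerSeries.coeff_zero_eq_constantCoeff_apply, dualSeries, PowerSeries.coeff_mk,
    PowerSeries.coeff_zero_eq_constantCoeff_apply, constantCoeff_seriesInv]
  rfl

variable {R : PowerSeries (Module.End ℂ U)}

/-- `(R*)⁻¹(x)` is the transpose of `R(x)`. -/
theorem coeff_seriesInv_dualSeries (hR : PowerSeries.constantCoeff R = 1) (n : ℕ) :
    PowerSeries.coeff n (seriesInv (dualSeries R)) = (PowerSeries.coeff n R).dualMap := by
  have h : (PowerSeries.mk fun n => (PowerSeries.coeff n R).dualMap) * dualSeries R = 1 := by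
    ext s : 1
    rw [PowerSeries.coeff_mul, PowerSeries.coeff_one, ← Finset.Nat.sum_antidiagonal_swap]
    simp only [Prod.fst_swap, Prod.snd_swap, PowerSeries.coeff_mk, dualSeries]
    have h := congrArg (Module.Dual.transpose (R := ℂ)) (sum_coeff_mul_eq_ite (seriesInv_mul hR) s)
    rw [map_sum] at h
    refine Eq.trans (Finset.sum_congr rfl fun p _ => ?_) (h.trans ?_)
    · rfl
    · split_ifs
      · rfl
      · rw [map_zero]
  have h2 := left_inv_eq_right_inv h (mul_seriesInv (constantCoeff_dualSeries R))
  rw [← h2, PowerSeries.coeff_mk]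

/-- The family of endomorphisms of `H` with components `Aₙ` on `U` and `Bₙ` on `U*`. -/
def blockCoeff (A : PowerSeries (Module.End ℂ U))
    (B : PowerSeries (Module.End ℂ (Module.Dual ℂ U))) (n : ℕ) : Module.End ℂ (HSpace U) :=
  (PowerSeries.coeff n A).prodMap (PowerSeries.coeff n B)

theorem blockCoeff_apply (A : PowerSeries (Module.End ℂ U))
    (B : PowerSeries (Module.End ℂ (Module.Dual ℂ U))) (n : ℕ) (a : HSpace U) :
    blockCoeff A B n a = (PowerSeries.coeff n A a.1, PowerSeries.coeff n B a.2) := rfl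

/-- The coefficients of the action of `Δ_R⁺(x)` on `H`. -/
abbrev plusCoeff (R : PowerSeries (Module.End ℂ U)) : ℕ → Module.End ℂ (HSpace U) :=
  blockCoeff R (dualSeries R)

/-- The coefficients of the action of `Δ_R⁻(x)` on `H`. -/
abbrev minusCoeff (R : PowerSeries (Module.End ℂ U)) : ℕ → Module.End ℂ (HSpace U) :=
  blockCoeff (seriesInv R) (seriesInv (dualSeries R))

theorem symp_apply (a b : HSpace U) : symp U a b = a.2 b.1 - b.2 a.1 := rfl

theorem isIsometry_blockCoeff {A : PowerSeries (Module.End ℂ U)}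
    {B : PowerSeries (Module.End ℂ (Module.Dual ℂ U))} {C : PowerSeries (Module.End ℂ U)}
    (hB : ∀ n, PowerSeries.coeff n B = (PowerSeries.coeff n C).dualMap) (hCA : C * A = 1) :
    IsIsometry (blockCoeff A B) := by
  intro s a b
  have key : ∀ (f : Module.Dual ℂ U) (x : U), ∑ p ∈ antidiagonal s,
      (PowerSeries.coeff p.1 B f) (PowerSeries.coeff p.2 A x) = if s = 0 then f x else 0 := by
    intro f x
    have h := congrArg f (LinearMap.congr_fun (sum_coeff_mul_eq_ite hCA s) x)
    rw [LinearMap.sum_apply, map_sum] at h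
    refine Eq.trans (Finset.sum_congr rfl fun p _ => ?_) (h.trans ?_)
    · rw [hB]
      rfl
    · split_ifs
      · rfl
      · rw [LinearMap.zero_apply, map_zero]
  simp only [symp_apply, blockCoeff_apply, Finset.sum_sub_distrib]
  rw [key, ← Finset.Nat.sum_antidiagonal_swap]
  simp only [Prod.fst_swap, Prod.snd_swap]
  rw [key]
  split_ifs
  · rfl
  · rw [sub_zero]

theorem isIsometry_plusCoeff (hR : PowerSeries.constantCoeff R = 1) :
    IsIsometry (plusCoeff R) :=
  isIsometry_blockCoeff (C := seriesInv R) (fun n => by rw [dualSeries, PowerSeries.coeff_mk])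
    (seriesInv_mul hR)

theorem isIsometry_minusCoeff (hR : PowerSeries.constantCoeff R = 1) :
    IsIsometry (minusCoeff R) :=
  isIsometry_blockCoeff (C := R) (coeff_seriesInv_dualSeries hR) (mul_seriesInv hR)

theorem sum_blockCoeff_mul {A A' : PowerSeries (Module.End ℂ U)}
    {B B' : PowerSeries (Module.End ℂ (Module.Dual ℂ U))} (hA : A * A' = 1) (hB : B * B' = 1)
    (s : ℕ) : ∑ p ∈ antidiagonal s, blockCoeff A B p.1 * blockCoeff A' B' p.2 =
      if s = 0 then 1 else 0 := by
  refine LinearMap.ext fun a => ?_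
  have h1 := LinearMap.congr_fun (sum_coeff_mul_eq_ite hA s) a.1
  have h2 := LinearMap.congr_fun (sum_coeff_mul_eq_ite hB s) a.2
  rw [LinearMap.sum_apply] at h1 h2 ⊢
  refine Prod.ext ?_ ?_
  · rw [Prod.fst_sum]
    refine Eq.trans h1 ?_
    split_ifs <;> rfl
  · rw [Prod.snd_sum]
    refine Eq.trans h2 ?_
    split_ifs <;> rfl

theorem sum_plusCoeff_mul_minusCoeff (hR : PowerSeries.constantCoeff R = 1) (s : ℕ) :
    ∑ p ∈ antidiagonal s, plusCoeff R p.1 * minusCoeff R p.2 = if s = 0 then 1 else 0 :=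
  sum_blockCoeff_mul (mul_seriesInv hR) (mul_seriesInv (constantCoeff_dualSeries R)) s

theorem sum_minusCoeff_mul_plusCoeff (hR : PowerSeries.constantCoeff R = 1) (s : ℕ) :
    ∑ p ∈ antidiagonal s, minusCoeff R p.1 * plusCoeff R p.2 = if s = 0 then 1 else 0 :=
  sum_blockCoeff_mul (seriesInv_mul hR) (seriesInv_mul (constantCoeff_dualSeries R)) s

/-- The coefficients of `Δ_R^±` on `H`, according to the sign: `true` stands for `+` and `false` for
`-`. -/
def signCoeff (R : PowerSeries (Module.End ℂ U)) (ε : Bool) : ℕ → Module.End ℂ (HSpace U) :=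
  if ε then plusCoeff R else minusCoeff R

theorem signCoeff_comm (hcomm : ∀ i j : ℕ, PowerSeries.coeff i R * PowerSeries.coeff j R =
      PowerSeries.coeff j R * PowerSeries.coeff i R)
    (hR : PowerSeries.constantCoeff R = 1) (ε η : Bool) (m n : ℕ) (a : HSpace U) :
    signCoeff R ε m (signCoeff R η n a) = signCoeff R η n (signCoeff R ε m a) := by
  have c1 : ∀ m n, Commute (PowerSeries.coeff m R) (PowerSeries.coeff n R) := hcomm
  have c2 : ∀ m n, Commute (PowerSeries.coeff m R) (PowerSeries.coeff n (seriesInv R)) :=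
    fun m => commute_coeff_seriesInv hR (c1 m)
  have c3 : ∀ m n, Commute (PowerSeries.coeff m (seriesInv R))
      (PowerSeries.coeff n (seriesInv R)) :=
    fun m => commute_coeff_seriesInv hR fun k => (c2 k m).symm
  have d : ∀ S T : Module.End ℂ U, Commute S T → ∀ f : Module.Dual ℂ U,
      S.dualMap (T.dualMap f) = T.dualMap (S.dualMap f) := by
    intro S T h f
    ext x
    exact congrArg f (LinearMap.congr_fun h.eq.symm x)
  have e : ∀ n, PowerSeries.coeff n (dualSeries R) =
    (PowerSeries.coeff n (seriesInv R)).dualMap := fun n => by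
      rw [dualSeries, PowerSeries.coeff_mk]
  cases ε <;> cases η <;>
    simp only [signCoeff, blockCoeff_apply, if_true, Bool.false_eq_true, if_false, e,
      coeff_seriesInv_dualSeries hR] <;>
    refine Prod.ext ?_ (d _ _ ?_ _)
  · exact LinearMap.congr_fun (c3 m n).eq a.1
  · exact c1 m n
  · exact LinearMap.congr_fun (c2 n m).symm.eq a.1
  · exact c2 m n
  · exact LinearMap.congr_fun (c2 m n).eq a.1
  · exact (c2 n m).symm
  · exact LinearMap.congr_fun (c1 m n).eq a.1
  · exact c3 m n

theorem isIsometry_signCoeff (hR : PowerSeries.constantCoeff R = 1) (ε : Bool) :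
    IsIsometry (signCoeff R ε) := by
  cases ε
  · exact isIsometry_minusCoeff hR
  · exact isIsometry_plusCoeff hR

theorem sum_signCoeff_mul (hR : PowerSeries.constantCoeff R = 1) (ε : Bool) (s : ℕ) :
    ∑ p ∈ antidiagonal s, signCoeff R ε p.1 * signCoeff R (!ε) p.2 = if s = 0 then 1 else 0 := by
  cases ε
  · exact sum_minusCoeff_mul_plusCoeff hR s
  · exact sum_plusCoeff_mul_minusCoeff hR s

theorem signCoeff_zero (hR : PowerSeries.constantCoeff R = 1) (ε : Bool) (a : HSpace U) :
    signCoeff R ε 0 a = a := by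
  cases ε <;>
    simp [signCoeff, blockCoeff_apply, hR, constantCoeff_seriesInv, constantCoeff_dualSeries]

theorem dcoeff_state_of_components {Δ : VHeis U →ₗ[ℂ] VHeis U ⊗[ℂ] PowerSeries ℂ}
    {A : PowerSeries (Module.End ℂ U)} {B : PowerSeries (Module.End ℂ (Module.Dual ℂ U))}
    (hA : ∀ (u : U) n, dcoeff Δ n (state U (u, 0)) = state U (PowerSeries.coeff n A u, 0))
    (hB : ∀ (f : Module.Dual ℂ U) n,
      dcoeff Δ n (state U (0, f)) = state U (0, PowerSeries.coeff n B f)) (n : ℕ) (a : HSpace U) :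
    dcoeff Δ n (state U a) = state U (blockCoeff A B n a) := by
  have h : a = (a.1, 0) + (0, a.2) := by simp
  conv_lhs => rw [h, map_add, map_add, hA, hB, ← map_add]
  simp [blockCoeff_apply]

/-- The pair `Δ_R^±` is determined by its restriction to `H`. -/
theorem IsDeltaPair.unique {Δp Δm Δp' Δm' : VHeis U →ₗ[ℂ] VHeis U ⊗[ℂ] PowerSeries ℂ}
    (h : IsDeltaPair R (heisY U) Δp Δm) (h' : IsDeltaPair R (heisY U) Δp' Δm') :
    Δp' = Δp ∧ Δm' = Δm :=
  ⟨h'.plus_pseudo.unique h.plus_pseudo (dcoeff_state_of_components h'.plus_U h'.plus_dual)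
      (dcoeff_state_of_components h.plus_U h.plus_dual),
    h'.minus_pseudo.unique h.minus_pseudo (dcoeff_state_of_components h'.minus_U h'.minus_dual)
      (dcoeff_state_of_components h.minus_U h.minus_dual)⟩

variable [FiniteDimensional ℂ U]

/-- `Δ_R^±(x)`, according to the sign. -/
def signDelta (hR : PowerSeries.constantCoeff R = 1) (ε : Bool) :
    VHeis U →ₗ[ℂ] VHeis U ⊗[ℂ] PowerSeries ℂ :=
  deltaMap (isIsometry_signCoeff hR ε)

theorem signDelta_comm (hcomm : ∀ i j : ℕ, PowerSeries.coeff i R * PowerSeries.coeff j R =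
      PowerSeries.coeff j R * PowerSeries.coeff i R)
    (hR : PowerSeries.constantCoeff R = 1) (ε η : Bool) (m n : ℕ) (w : VHeis U) :
    dcoeff (signDelta hR ε) m (dcoeff (signDelta hR η) n w) =
      dcoeff (signDelta hR η) n (dcoeff (signDelta hR ε) m w) :=
  (deltaMap_isPseudoEnd _).dcoeff_comm (deltaMap_isPseudoEnd _) (dcoeff_deltaMap_state _)
    (dcoeff_deltaMap_state _) (signCoeff_comm hcomm hR ε η) m n w

theorem mk_dcoeff_signDelta_mul (hR : PowerSeries.constantCoeff R = 1) (ε : Bool) :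
    PowerSeries.mk (dcoeff (signDelta hR ε)) * PowerSeries.mk (dcoeff (signDelta hR !ε)) = 1 := by
  refine mk_dcoeff_mul_mk_dcoeff _ _ ?_
  cases ε
  · exact sum_minusCoeff_mul_plusCoeff hR
  · exact sum_plusCoeff_mul_minusCoeff hR

theorem isDeltaPair_signDelta (hcomm : ∀ i j : ℕ, PowerSeries.coeff i R * PowerSeries.coeff j R =
      PowerSeries.coeff j R * PowerSeries.coeff i R)
    (hR : PowerSeries.constantCoeff R = 1) :
    IsDeltaPair R (heisY U) (signDelta hR true) (signDelta hR false) where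
  plus_U u n := by
    rw [signDelta, dcoeff_deltaMap_state]
    simp [signCoeff, blockCoeff_apply]
  minus_U u n := by
    rw [signDelta, dcoeff_deltaMap_state]
    simp [signCoeff, blockCoeff_apply]
  plus_dual u n := by
    rw [signDelta, dcoeff_deltaMap_state]
    simp [signCoeff, blockCoeff_apply]
  minus_dual u n := by
    rw [signDelta, dcoeff_deltaMap_state]
    simp [signCoeff, blockCoeff_apply]
  plus_pseudo := deltaMap_isPseudoEnd _
  minus_pseudo := deltaMap_isPseudoEnd _
  comm_plus m n := LinearMap.ext (signDelta_comm hcomm hR _ _ m n)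
  comm_minus m n := LinearMap.ext (signDelta_comm hcomm hR _ _ m n)
  comm_mixed m n := LinearMap.ext (signDelta_comm hcomm hR _ _ m n)
  plus_minus := mk_dcoeff_signDelta_mul hR true
  minus_plus := mk_dcoeff_signDelta_mul hR false

end DeltaPair

/-! ### The filtration of a vacuum `(H,𝒮)`-module -/

section Filtration

variable {H : Type u} [AddCommGroup H] [Module ℂ H]
variable {W : Type v} [AddCommGroup W] [Module ℂ W]
variable {ρ : LoopRep H W} {e : W}

theorem mode_eq (n : ℤ) (a : H) : mode ρ n a = ρ (gen n a) := rfl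

@[simp] theorem modePair_tmul (m n : ℤ) (b a : H) :
    modePair ρ m n (b ⊗ₜ[ℂ] a) = mode ρ m b * mode ρ n a := by
  simp [modePair]

theorem modePair_mem {X : Submodule ℂ W} {m n : ℤ} {w : W}
    (h : ∀ b a, mode ρ m b (mode ρ n a w) ∈ X) (t : H ⊗[ℂ] H) : modePair ρ m n t w ∈ X := by
  induction t using TensorProduct.induction_on with
  | zero => simp
  | add x y hx hy => rw [map_add, LinearMap.add_apply]; exact X.add_mem hx hy
  | tmul b a => rw [modePair_tmul]; exact h b a

theorem finsum_mem_submodule {X : Submodule ℂ W} {f : ℕ → W} (h : ∀ i, f i ∈ X) :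
    ∑ᶠ i, f i ∈ X :=
  finsum_induction (· ∈ X) X.zero_mem (fun _ _ => X.add_mem) h

theorem filt_mono {k l : ℤ} (h : k ≤ l) : filt ρ e k ≤ filt ρ e l :=
  Submodule.span_mono fun _ ⟨s, hs, hw⟩ => ⟨s, hs.trans h, hw⟩

theorem filt_eq_bot {k : ℤ} (hk : k < 0) : filt ρ e k = ⊥ := by
  rw [filt, Submodule.span_eq_bot]
  rintro w ⟨l, hl, rfl⟩
  have : 0 ≤ (l.map fun p : H × ℕ+ => ((p.2 : ℕ) : ℤ)).sum :=
    List.sum_nonneg fun x hx => by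
      obtain ⟨p, _, rfl⟩ := List.mem_map.1 hx
      exact Int.natCast_nonneg _
  omega

theorem eq_zero_of_mem_filt {k : ℤ} (hk : k < 0) {w : W} (hw : w ∈ filt ρ e k) : w = 0 := by
  rwa [filt_eq_bot hk, Submodule.mem_bot] at hw

theorem mem_filt_zero : e ∈ filt ρ e 0 :=
  Submodule.subset_span ⟨[], le_rfl, rfl⟩

/-- `W[k]` is spanned by `e`, if `k ≥ 0`, and the subspaces `a(-m)W[k-m]`. -/
theorem filt_induction {k : ℤ} {Q : W → Prop} (vac : 0 ≤ k → Q e)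
    (mode : ∀ (m : ℕ+) (a : H) (w : W), w ∈ filt ρ e (k - (m : ℕ)) →
      Q (mode ρ (-((m : ℕ) : ℤ)) a w))
    (zero : Q 0) (add : ∀ x y, Q x → Q y → Q (x + y)) (smul : ∀ (c : ℂ) x, Q x → Q (c • x))
    {w : W} (hw : w ∈ filt ρ e k) : Q w := by
  induction hw using Submodule.span_induction with
  | zero => exact zero
  | add x y _ _ hx hy => exact add x y hx hy
  | smul c x _ hx => exact smul c x hx
  | mem x hx =>
    obtain ⟨l, hl, rfl⟩ := hx
    cases l with
    | nil => exact vac hl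
    | cons p l =>
      rw [List.map_cons, List.prod_cons, Module.End.mul_apply]
      rw [List.map_cons, List.sum_cons] at hl
      exact mode _ _ _ (Submodule.subset_span ⟨l, by omega, rfl⟩)

theorem mode_neg_mem_filt (m : ℕ+) (a : H) {k : ℤ} {w : W} (hw : w ∈ filt ρ e k) :
    mode ρ (-((m : ℕ) : ℤ)) a w ∈ filt ρ e (k + (m : ℕ)) := by
  rcases lt_or_ge k 0 with hk | hk
  · rw [eq_zero_of_mem_filt hk hw, map_zero]
    exact Submodule.zero_mem _
  · lift k to ℕ using hk
    have := mode_mem_filt ρ e a m k w hw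
    rwa [Nat.cast_add] at this

variable {form : LinearMap.BilinForm ℂ H} {S : PowerSeries (Module.End ℂ (H ⊗[ℂ] H))}

theorem mode_mode_eq (hρ : IsHSModule form S ρ) (a b : H) (m n : ℤ) (w : W) :
    mode ρ m a (mode ρ n b w) =
      (∑ᶠ k : ℕ, ∑ j ∈ Finset.range (k + 1), ((-1 : ℂ) ^ j * (k.choose j : ℂ)) •
        modePair ρ (n + k - j) (m + j) (PowerSeries.coeff k S (b ⊗ₜ[ℂ] a)) w)
      + (if m + n + 1 = 0 then form a b else 0) • w := by
  have h := hρ.relation a b m n w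
  rw [relVec, sub_sub, sub_eq_zero] at h
  exact h

/-- `a(n)W[k] ⊆ W[k-n-1]` for `n ≥ 0`, by induction on `k`: the relations replace `a(n)b(-m)w` by
terms `b'(n')a'(m')w` with `m' ≥ n` and by `⟨a,b⟩w`, where `n = m - 1`. -/
theorem mode_nonneg_mem_filt (hρ : IsHSModule form S ρ) (he : IsVacuumLike ρ e) {k : ℤ} {w : W}
    (hw : w ∈ filt ρ e k) (a : H) (n : ℤ) (hn : 0 ≤ n) :
    mode ρ n a w ∈ filt ρ e (k - n - 1) := by
  have key : ∀ K : ℕ, ∀ k : ℤ, k < K → ∀ w ∈ filt ρ e k, ∀ (a : H) (n : ℤ), 0 ≤ n →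
      mode ρ n a w ∈ filt ρ e (k - n - 1) := by
    intro K
    induction K with
    | zero =>
      intro k hk w hw a n _
      rw [eq_zero_of_mem_filt (by exact_mod_cast hk) hw, map_zero]
      exact Submodule.zero_mem _
    | succ K ih =>
      intro k hk w hw a n hn
      refine filt_induction (Q := fun w => mode ρ n a w ∈ filt ρ e (k - n - 1)) ?_ ?_ ?_ ?_ ?_ hw
      · intro _
        rw [he a n hn]
        exact Submodule.zero_mem _
      · intro m b w hw
        have hm := m.pos
        rw [mode_mode_eq hρ]
        refine Submodule.add_mem _ (finsum_mem_submodule fun i => Submodule.sum_mem _ fun j hj =>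
          Submodule.smul_mem _ _ (modePair_mem (fun b' a' => ?_) _)) ?_
        · have hj' := Finset.mem_range.1 hj
          have h1 := ih (k - (m : ℕ)) (by omega) w hw a' (n + j) (by omega)
          rcases lt_or_ge (-((m : ℕ) : ℤ) + i - j) 0 with h | h
          · obtain ⟨q, hq⟩ : ∃ q : ℕ+, -((m : ℕ) : ℤ) + i - j = -((q : ℕ) : ℤ) :=
              ⟨⟨((m : ℕ) - i + j : ℤ).toNat, by omega⟩, by simp only [PNat.mk_coe]; omega⟩
            rw [hq]
            exact filt_mono (by omega) (mode_neg_mem_filt q b' h1)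
          · exact filt_mono (by omega) (ih _ (by omega) _ h1 b' _ h)
        · split_ifs with h
          · exact Submodule.smul_mem _ _ (filt_mono (by omega) hw)
          · rw [zero_smul]; exact Submodule.zero_mem _
      · rw [map_zero]; exact Submodule.zero_mem _
      · intro x y hx hy
        rw [map_add]
        exact Submodule.add_mem _ hx hy
      · intro c x hx
        rw [map_smul]
        exact Submodule.smul_mem _ _ hx
  exact key (k + 1).toNat k (by omega) w hw a n hn

/-- `a(n)W[k] ⊆ W[k-n]`. -/
theorem mode_mem_filt_sub (hρ : IsHSModule form S ρ) (he : IsVacuumLike ρ e) {k : ℤ} {w : W}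
    (hw : w ∈ filt ρ e k) (a : H) (n : ℤ) : mode ρ n a w ∈ filt ρ e (k - n) := by
  rcases lt_or_ge n 0 with h | h
  · obtain ⟨q, rfl⟩ : ∃ q : ℕ+, n = -((q : ℕ) : ℤ) :=
      ⟨⟨(-n).toNat, by omega⟩, by simp only [PNat.mk_coe]; omega⟩
    rw [sub_neg_eq_add]
    exact mode_neg_mem_filt q a hw
  · exact filt_mono (by omega) (mode_nonneg_mem_filt hρ he hw a n h)

theorem prod_gen_apply_mem_filt (hρ : IsHSModule form S ρ) (he : IsVacuumLike ρ e)
    (l : List (H × ℤ)) {k : ℤ} {w : W} (hw : w ∈ filt ρ e k) :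
    ρ (l.map fun p => gen p.2 p.1).prod w ∈ filt ρ e (k - (l.map Prod.snd).sum) := by
  induction l with
  | nil => simpa using hw
  | cons p l ih =>
    simp only [List.map_cons, List.prod_cons, List.sum_cons, map_mul, Module.End.mul_apply]
    rw [← mode_eq]
    exact filt_mono (by omega) (mode_mem_filt_sub hρ he ih p.1 p.2)

/-- `J` annihilates the vacuum-like vector: a monomial of degree `d ≥ 0` contains a factor `a(n)` with
`n ≥ 0`, which lowers the filtration by one more than `n`, so it maps `e` to `W[-d-1] = 0`. -/
theorem prod_gen_apply_vac_eq_zero (hρ : IsHSModule form S ρ) (he : IsVacuumLike ρ e)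
    (l : List (H × ℤ)) (hl : l ≠ []) (hs : 0 ≤ (l.map Prod.snd).sum) :
    ρ (l.map fun p => gen p.2 p.1).prod e = 0 := by
  have key : ∀ l : List (H × ℤ), (∃ p ∈ l, 0 ≤ p.2) →
      ρ (l.map fun p => gen p.2 p.1).prod e ∈ filt ρ e (-(l.map Prod.snd).sum - 1) := by
    intro l
    induction l with
    | nil => rintro ⟨p, hp, _⟩; simp at hp
    | cons p l ih =>
      intro h
      simp only [List.map_cons, List.prod_cons, List.sum_cons, map_mul, Module.End.mul_apply]
      rw [← mode_eq]
      by_cases hl : ∃ p ∈ l, 0 ≤ p.2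
      · exact filt_mono (by omega) (mode_mem_filt_sub hρ he (ih hl) p.1 p.2)
      · have hp : 0 ≤ p.2 := by
          obtain ⟨q, hq, hq0⟩ := h
          rcases List.mem_cons.1 hq with rfl | hq
          · exact hq0
          · exact absurd ⟨q, hq, hq0⟩ hl
        exact filt_mono (by omega) (mode_nonneg_mem_filt hρ he
          (prod_gen_apply_mem_filt hρ he l mem_filt_zero) p.1 p.2 hp)
  have neg : ∀ l : List (H × ℤ), l ≠ [] → (¬ ∃ p ∈ l, 0 ≤ p.2) → (l.map Prod.snd).sum < 0 := by
    intro l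
    induction l with
    | nil => intro h; exact absurd rfl h
    | cons p l ih =>
      intro _ h
      have hp : p.2 < 0 := not_le.1 fun hp => h ⟨p, List.mem_cons_self, hp⟩
      rw [List.map_cons, List.sum_cons]
      by_cases hl : l = []
      · simpa [hl] using hp
      · have := ih hl fun ⟨q, hq, hq0⟩ => h ⟨q, List.mem_cons_of_mem _ hq, hq0⟩
        omega
  refine eq_zero_of_mem_filt (by omega) (key l ?_)
  by_contra h
  exact absurd (neg l hl h) (by omega)

theorem exists_mem_filt (hW : IsVacuumModule form S ρ e) (w : W) : ∃ k : ℕ, w ∈ filt ρ e k := by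
  have key : ∀ (t : LoopAlg H) (w : W), (∃ k : ℕ, w ∈ filt ρ e k) →
      ∃ k : ℕ, ρ t w ∈ filt ρ e k := by
    intro t
    have hadd : ∀ x y : W, (∃ k : ℕ, x ∈ filt ρ e k) → (∃ k : ℕ, y ∈ filt ρ e k) →
        ∃ k : ℕ, x + y ∈ filt ρ e k := by
      rintro x y ⟨k, hk⟩ ⟨l, hl⟩
      exact ⟨k + l, Submodule.add_mem _ (filt_mono (by push_cast; omega) hk)
        (filt_mono (by push_cast; omega) hl)⟩
    induction t using TensorAlgebra.induction with
    | algebraMap c =>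
      rintro w ⟨k, hk⟩
      rw [AlgHom.commutes, Module.algebraMap_end_apply]
      exact ⟨k, Submodule.smul_mem _ _ hk⟩
    | add s t hs ht =>
      intro w hw
      rw [map_add, LinearMap.add_apply]
      exact hadd _ _ (hs w hw) (ht w hw)
    | mul s t hs ht =>
      intro w hw
      rw [map_mul, Module.End.mul_apply]
      exact hs _ (ht w hw)
    | ι x =>
      rintro w hw
      induction x using Finsupp.induction_linear with
      | zero => exact ⟨0, by simp⟩
      | add x y hx hy =>
        rw [map_add, map_add, LinearMap.add_apply]
        exact hadd _ _ hx hy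
      | single n a =>
        obtain ⟨k, hk⟩ := hw
        exact ⟨(k - n).toNat, filt_mono (by omega)
          (mode_mem_filt_sub hW.isHSModule hW.vacuumLike hk a n)⟩
  obtain ⟨t, rfl⟩ := hW.cyclic w
  exact key t e ⟨0, mem_filt_zero⟩

end Filtration

/-! ### The universal vacuum `(H,𝒮)`-module -/

section UniversalModule

variable {H : Type u} [AddCommGroup H] [Module ℂ H]

theorem map_modePair {W : Type v} [AddCommGroup W] [Module ℂ W] {W' : Type w} [AddCommGroup W']
    [Module ℂ W'] {ρ : LoopRep H W} {ρ' : LoopRep H W'} {f : W →ₗ[ℂ] W'}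
    (hf : ∀ (n : ℤ) (a : H) (w : W), f (mode ρ n a w) = mode ρ' n a (f w)) (m n : ℤ)
    (t : H ⊗[ℂ] H) (w : W) : f (modePair ρ m n t w) = modePair ρ' m n t (f w) := by
  induction t using TensorProduct.induction_on with
  | zero => simp
  | add x y hx hy => simp only [map_add, LinearMap.add_apply, hx, hy]
  | tmul b a => simp only [modePair_tmul, Module.End.mul_apply, hf]

theorem map_relVec {form : LinearMap.BilinForm ℂ H} {S : PowerSeries (Module.End ℂ (H ⊗[ℂ] H))}
    {W : Type v} [AddCommGroup W] [Module ℂ W] {W' : Type w} [AddCommGroup W']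
    [Module ℂ W'] {ρ : LoopRep H W} {ρ' : LoopRep H W'} {f : W →ₗ[ℂ] W'}
    (hf : ∀ (n : ℤ) (a : H) (w : W), f (mode ρ n a w) = mode ρ' n a (f w)) (a b : H) (m n : ℤ)
    (w : W) (hw : ∃ N : ℕ, ∀ p q : ℤ, N ≤ p + q → ∀ t : H ⊗[ℂ] H, modePair ρ p q t w = 0) :
    f (relVec form S ρ a b m n w) = relVec form S ρ' a b m n (f w) := by
  simp only [relVec, map_sub, map_smul, hf]
  rw [map_finsum_of_eventually]
  · simp only [map_sum, map_smul, map_modePair hf]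
  · obtain ⟨N, hN⟩ := hw
    refine ⟨(N - m - n).toNat, fun k hk => Finset.sum_eq_zero fun j _ => ?_⟩
    rw [hN _ _ (by omega), smul_zero]

/-- `T(H ⊗ ℂ[t,t⁻¹])` is spanned by the monomials. -/
theorem loopAlg_span : Submodule.span ℂ {t : LoopAlg H | ∃ l : List (H × ℤ),
    t = (l.map fun p => gen p.2 p.1).prod} = ⊤ := by
  rw [eq_top_iff]
  rintro t -
  set X := Submodule.span ℂ {t : LoopAlg H | ∃ l : List (H × ℤ),
    t = (l.map fun p => gen p.2 p.1).prod} with hX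
  have hmul : ∀ s ∈ X, ∀ t ∈ X, s * t ∈ X := by
    intro s hs t ht
    induction hs using Submodule.span_induction with
    | zero => rw [zero_mul]; exact X.zero_mem
    | add x y _ _ hx hy => rw [add_mul]; exact X.add_mem hx hy
    | smul c x _ hx => rw [smul_mul_assoc]; exact X.smul_mem c hx
    | mem x hx =>
      induction ht using Submodule.span_induction with
      | zero => rw [mul_zero]; exact X.zero_mem
      | add y z _ _ hy hz => rw [mul_add]; exact X.add_mem hy hz
      | smul c y _ hy => rw [mul_smul_comm]; exact X.smul_mem c hy
      | mem y hy =>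
        obtain ⟨l, rfl⟩ := hx
        obtain ⟨l', rfl⟩ := hy
        exact Submodule.subset_span ⟨l ++ l', by rw [List.map_append, List.prod_append]⟩
  induction t using TensorAlgebra.induction with
  | algebraMap c =>
    rw [Algebra.algebraMap_eq_smul_one]
    exact X.smul_mem c (Submodule.subset_span ⟨[], rfl⟩)
  | add s t hs ht => exact X.add_mem hs ht
  | mul s t hs ht => exact hmul s hs t ht
  | ι x =>
    induction x using Finsupp.induction_linear with
    | zero => rw [map_zero]; exact X.zero_mem
    | add x y hx hy => rw [map_add]; exact X.add_mem hx hy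
    | single n a =>
      refine Submodule.subset_span ⟨[(a, n)], ?_⟩
      rw [List.map_singleton, List.prod_singleton]
      rfl

theorem mk_prod_gen_eq_zero (l : List (H × ℤ)) (hl : l ≠ []) (hs : 0 ≤ (l.map Prod.snd).sum) :
    (Submodule.Quotient.mk (l.map fun p => gen p.2 p.1).prod : PreV H) = 0 :=
  (Submodule.Quotient.mk_eq_zero _).2 (Submodule.subset_span ⟨l, hl, hs, rfl⟩)

theorem preV_induction {Q : PreV H → Prop}
    (prod : ∀ l : List (H × ℤ), Q (Submodule.Quotient.mk (l.map fun p => gen p.2 p.1).prod))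
    (zero : Q 0) (add : ∀ x y, Q x → Q y → Q (x + y)) (smul : ∀ (c : ℂ) x, Q x → Q (c • x))
    (x : PreV H) : Q x := by
  obtain ⟨t, rfl⟩ := Submodule.Quotient.mk_surjective _ x
  have ht : t ∈ Submodule.span ℂ {t : LoopAlg H | ∃ l : List (H × ℤ),
      t = (l.map fun p => gen p.2 p.1).prod} := by rw [loopAlg_span]; trivial
  induction ht using Submodule.span_induction with
  | zero => exact zero
  | add x y _ _ hx hy => exact add _ _ hx hy
  | smul c x _ hx => exact smul c _ hx
  | mem x hx =>
    obtain ⟨l, rfl⟩ := hx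
    exact prod l

theorem exists_mode_preVRep_eq_zero (x : PreV H) :
    ∃ N : ℕ, ∀ n : ℤ, N ≤ n → ∀ a, mode (preVRep H) n a x = 0 := by
  induction x using preV_induction with
  | zero => exact ⟨0, fun n _ a => map_zero _⟩
  | add x y hx hy =>
    obtain ⟨N, hN⟩ := hx
    obtain ⟨M, hM⟩ := hy
    exact ⟨N + M, fun n hn a => by
      rw [map_add, hN n (by push_cast at hn; omega), hM n (by push_cast at hn; omega), add_zero]⟩
  | smul c x hx =>
    obtain ⟨N, hN⟩ := hx
    exact ⟨N, fun n hn a => by rw [map_smul, hN n hn]; exact smul_zero (A := PreV H) c⟩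
  | prod l =>
    refine ⟨(-(l.map Prod.snd).sum).toNat, fun n hn a => ?_⟩
    have := mk_prod_gen_eq_zero ((a, n) :: l) (List.cons_ne_nil _ _)
      (by rw [List.map_cons, List.sum_cons]; omega)
    rwa [List.map_cons, List.prod_cons] at this

theorem exists_modePair_preVRep_eq_zero (x : PreV H) :
    ∃ N : ℕ, ∀ p q : ℤ, N ≤ p + q → ∀ t, modePair (preVRep H) p q t x = 0 := by
  induction x using preV_induction with
  | zero => exact ⟨0, fun p q _ t => map_zero _⟩
  | add x y hx hy =>
    obtain ⟨N, hN⟩ := hx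
    obtain ⟨M, hM⟩ := hy
    exact ⟨N + M, fun p q hn t => by
      rw [map_add, hN p q (by push_cast at hn; omega), hM p q (by push_cast at hn; omega),
        add_zero]⟩
  | smul c x hx =>
    obtain ⟨N, hN⟩ := hx
    exact ⟨N, fun p q hn t => by rw [map_smul, hN p q hn]; exact smul_zero (A := PreV H) c⟩
  | prod l =>
    refine ⟨(-(l.map Prod.snd).sum).toNat, fun p q hn t => ?_⟩
    rw [← Submodule.mem_bot (R := ℂ)]
    refine modePair_mem (fun b a => ?_) t
    rw [Submodule.mem_bot]
    have := mk_prod_gen_eq_zero ((b, p) :: (a, q) :: l) (List.cons_ne_nil _ _)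
      (by rw [List.map_cons, List.sum_cons, List.map_cons, List.sum_cons]; omega)
    rwa [List.map_cons, List.prod_cons, List.map_cons, List.prod_cons] at this

variable (form : LinearMap.BilinForm ℂ H) (S : PowerSeries (Module.End ℂ (H ⊗[ℂ] H)))

/-- The projection of `Ṽ(H,𝒮)` onto `V(H,𝒮)`. -/
def preVToVHS : PreV H →ₗ[ℂ] VHS form S := ((relSubmodule form S).mkQ).restrictScalars ℂ

theorem preVToVHS_mode (n : ℤ) (a : H) (x : PreV H) :
    preVToVHS form S (mode (preVRep H) n a x) =
      mode (vhsRep form S) n a (preVToVHS form S x) := rfl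

theorem preVToVHS_surjective : Function.Surjective (preVToVHS form S) :=
  Submodule.Quotient.mk_surjective _

theorem vhsRep_vhsOne (t : LoopAlg H) :
    vhsRep form S t (vhsOne form S) = preVToVHS form S (Submodule.Quotient.mk t) := by
  change preVToVHS form S (Submodule.Quotient.mk (t * 1)) = _
  rw [mul_one]

theorem vhs_isVacuumModule : IsVacuumModule form S (vhsRep form S) (vhsOne form S) where
  isHSModule :=
    { truncation := fun a w => by
        obtain ⟨x, rfl⟩ := preVToVHS_surjective form S w
        obtain ⟨N, hN⟩ := exists_mode_preVRep_eq_zero x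
        exact ⟨N, fun n hn => by rw [← preVToVHS_mode, hN n hn, map_zero]⟩
      relation := fun a b m n w => by
        obtain ⟨x, rfl⟩ := preVToVHS_surjective form S w
        rw [← map_relVec (preVToVHS_mode form S) a b m n x (exists_modePair_preVRep_eq_zero x)]
        exact (Submodule.Quotient.mk_eq_zero _).2 (Submodule.subset_span ⟨a, b, m, n, x, rfl⟩) }
  vacuumLike := fun a m hm => by
    rw [mode_eq, vhsRep_vhsOne]
    have := mk_prod_gen_eq_zero [(a, m)] (List.cons_ne_nil _ _) (by simpa using hm)
    rw [List.map_singleton, List.prod_singleton] at this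
    rw [this, map_zero]
  cyclic := fun w => by
    obtain ⟨x, rfl⟩ := preVToVHS_surjective form S w
    obtain ⟨t, rfl⟩ := Submodule.Quotient.mk_surjective _ x
    exact ⟨t, vhsRep_vhsOne form S t⟩

variable {form S}

/-- The universal property of `V(H,𝒮)`. -/
theorem vhs_universal {W : Type v} [AddCommGroup W] [Module ℂ W] {ρ : LoopRep H W} {e : W}
    (hW : IsVacuumModule form S ρ e) :
    ∃! f : VHS form S →ₗ[ℂ] W, IsLoopHom (vhsRep form S) ρ f ∧ f (vhsOne form S) = e := by
  -- `t ↦ t e` factors through `T/J`, and then through the relations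
  let I : Submodule (LoopAlg H) (LoopAlg H) :=
    { carrier := {t | ρ t e = 0}
      add_mem' := fun {a b} ha hb => by
        change ρ (a + b) e = 0
        rw [map_add, LinearMap.add_apply, ha, hb, add_zero]
      zero_mem' := by simp
      smul_mem' := fun c x hx => by
        change ρ (c * x) e = 0
        rw [map_mul, Module.End.mul_apply, hx, map_zero] }
  have hI : leftIdealJ H ≤ I := by
    refine Submodule.span_le.2 ?_
    rintro _ ⟨l, hl, hs, rfl⟩
    exact prod_gen_apply_vac_eq_zero hW.isHSModule hW.vacuumLike l hl hs
  let g : PreV H →ₗ[ℂ] W := ((leftIdealJ H).restrictScalars ℂ).liftQ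
    ((LinearMap.applyₗ e) ∘ₗ ρ.toLinearMap) (fun x hx => hI hx)
  have hg : ∀ (t : LoopAlg H) (x : PreV H), g (t • x) = ρ t (g x) := by
    intro t x
    obtain ⟨s, rfl⟩ := Submodule.Quotient.mk_surjective _ x
    change ρ (t * s) e = ρ t (ρ s e)
    rw [map_mul, Module.End.mul_apply]
  let K : Submodule (LoopAlg H) (PreV H) :=
    { carrier := {x | g x = 0}
      add_mem' := fun {a b} ha hb => by
        change g (a + b) = 0
        rw [map_add, ha, hb, add_zero]
      zero_mem' := map_zero g
      smul_mem' := fun c x hx => by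
        change g (c • x) = 0
        rw [hg, hx, map_zero] }
  have hK : relSubmodule form S ≤ K := by
    refine Submodule.span_le.2 ?_
    rintro _ ⟨a, b, m, n, x, rfl⟩
    change g _ = 0
    rw [map_relVec (fun n a w => hg (gen n a) w) a b m n x (exists_modePair_preVRep_eq_zero x)]
    exact hW.isHSModule.relation a b m n _
  let f : VHS form S →ₗ[ℂ] W := ((relSubmodule form S).restrictScalars ℂ).liftQ g
    (fun x hx => hK hx)
  refine ⟨f, ⟨?_, ?_⟩, ?_⟩
  · intro t w
    obtain ⟨x, rfl⟩ := Submodule.Quotient.mk_surjective _ w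
    exact hg t x
  · change ρ 1 e = e
    simp
  · rintro f' ⟨h1, h2⟩
    refine LinearMap.ext fun w => ?_
    obtain ⟨t, rfl⟩ := (vhs_isVacuumModule form S).cyclic w
    rw [h1, h2, vhsRep_vhsOne]
    rfl

end UniversalModule

/-! ### The associated graded module -/

section Graded

/-- A linear map with commuting values extends to the symmetric algebra. -/
theorem exists_symmetricAlgebra_lift {M : Type u} [AddCommGroup M] [Module ℂ M] {A : Type v}
    [Semiring A] [Algebra ℂ A] (f : M →ₗ[ℂ] A) (hf : ∀ x y, f x * f y = f y * f x) :
    ∃ σ : SymmetricAlgebra ℂ M →ₐ[ℂ] A, ∀ x, σ (SymmetricAlgebra.ι ℂ M x) = f x := by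
  have hcomm : ∀ a ∈ Set.range f, ∀ b ∈ Set.range f, a * b = b * a := by
    rintro _ ⟨x, rfl⟩ _ ⟨y, rfl⟩
    exact hf x y
  -- the universal property needs a commutative target: the subalgebra generated by the image
  have h := Algebra.isMulCommutative_adjoin ℂ hcomm
  let _ : CommSemiring (Algebra.adjoin ℂ (Set.range f)) :=
    { (inferInstance : Semiring (Algebra.adjoin ℂ (Set.range f))) with
      mul_comm := h.is_comm.comm }
  let g : M →ₗ[ℂ] Algebra.adjoin ℂ (Set.range f) :=
    { toFun := fun x => ⟨f x, Algebra.subset_adjoin ⟨x, rfl⟩⟩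
      map_add' := fun x y => Subtype.ext (map_add f x y)
      map_smul' := fun c x => Subtype.ext (map_smul f c x) }
  exact ⟨(Algebra.adjoin ℂ (Set.range f)).val.comp (SymmetricAlgebra.lift g), fun x => by
    rw [AlgHom.comp_apply, SymmetricAlgebra.lift_ι_apply]
    rfl⟩

variable {H : Type u} [AddCommGroup H] [Module ℂ H]
variable {W : Type v} [AddCommGroup W] [Module ℂ W]
variable (ρ : LoopRep H W) (e : W)

theorem grClass_add (k : ℕ) (x y : filt ρ e (k : ℤ)) :
    grClass ρ e k (x + y) = grClass ρ e k x + grClass ρ e k y := by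
  rw [grClass, Submodule.Quotient.mk_add, map_add]
  rfl

theorem grClass_smul (k : ℕ) (c : ℂ) (x : filt ρ e (k : ℤ)) :
    grClass ρ e k (c • x) = c • grClass ρ e k x := by
  rw [grClass, Submodule.Quotient.mk_smul]
  exact DirectSum.of_smul ℂ k c _

variable {ρ e}

theorem grClass_eq_zero_iff {k : ℕ} {x : filt ρ e (k : ℤ)} :
    grClass ρ e k x = 0 ↔ (x : W) ∈ filt ρ e ((k : ℤ) - 1) := by
  rw [grClass, ← map_zero (DirectSum.of (GrPiece ρ e) k), (DirectSum.of_injective k).eq_iff,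
    Submodule.Quotient.mk_eq_zero]
  rfl

theorem grClass_eq {k l : ℕ} (hkl : k = l) {x : filt ρ e (k : ℤ)} {y : filt ρ e (l : ℤ)}
    (h : (x : W) - y ∈ filt ρ e ((k : ℤ) - 1)) : grClass ρ e k x = grClass ρ e l y := by
  subst hkl
  rw [← sub_eq_zero, sub_eq_add_neg, ← neg_one_smul ℂ (grClass ρ e k y), ← grClass_smul,
    ← grClass_add, grClass_eq_zero_iff]
  rw [neg_one_smul, ← sub_eq_add_neg]
  exact h

theorem gr_induction {Q : Gr ρ e → Prop} (grClass : ∀ k x, Q (grClass ρ e k x)) (zero : Q 0)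
    (add : ∀ x y, Q x → Q y → Q (x + y)) (x : Gr ρ e) : Q x := by
  induction x using DirectSum.induction_on with
  | zero => exact zero
  | add x y hx hy => exact add x y hx hy
  | of k x =>
    obtain ⟨x, rfl⟩ := Submodule.Quotient.mk_surjective _ x
    exact grClass k x

theorem gr_hom_ext {M : Type w} [AddCommMonoid M] [Module ℂ M] {f g : Gr ρ e →ₗ[ℂ] M}
    (h : ∀ k x, f (grClass ρ e k x) = g (grClass ρ e k x)) : f = g := by
  refine LinearMap.ext fun x => ?_
  induction x using gr_induction with
  | grClass k x => exact h k x
  | zero => rw [map_zero, map_zero]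
  | add x y hx hy => rw [map_add, map_add, hx, hy]

/-- A linear map on `gr W` given by linear maps `θₖ` on `W` that vanish on `W[k-1]`. -/
theorem exists_grHom {M : Type w} [AddCommGroup M] [Module ℂ M]
    (θ : (k : ℕ) → filt ρ e (k : ℤ) →ₗ[ℂ] M)
    (hθ : ∀ (k : ℕ) (x : filt ρ e (k : ℤ)), (x : W) ∈ filt ρ e ((k : ℤ) - 1) → θ k x = 0) :
    ∃ Θ : Gr ρ e →ₗ[ℂ] M, ∀ (k : ℕ) x, Θ (grClass ρ e k x) = θ k x :=
  ⟨DirectSum.toModule ℂ ℕ M fun k => Submodule.liftQ _ (θ k) fun x hx => hθ k x hx,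
    fun k _ => DirectSum.toModule_lof ℂ k _⟩

theorem exists_grMul (m : ℕ+) (a : H) :
    ∃ Θ : Gr ρ e →ₗ[ℂ] Gr ρ e, ∀ k x, Θ (grClass ρ e k x) = grClass ρ e (k + (m : ℕ))
      ⟨mode ρ (-((m : ℕ) : ℤ)) a x, mode_mem_filt ρ e a m k x x.2⟩ := by
  refine exists_grHom (ρ := ρ) (e := e) (fun k =>
    { toFun := fun x => grClass ρ e (k + (m : ℕ))
        ⟨mode ρ (-((m : ℕ) : ℤ)) a x, mode_mem_filt ρ e a m k x x.2⟩
      map_add' := fun x y => by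
        rw [← grClass_add]
        congr 1
        exact Subtype.ext (map_add _ _ _)
      map_smul' := fun c x => by
        rw [RingHom.id_apply, ← grClass_smul]
        congr 1
        exact Subtype.ext (map_smul _ _ _) }) fun k x hx => ?_
  refine grClass_eq_zero_iff.2 ?_
  have := mode_neg_mem_filt m a hx
  rwa [show (k : ℤ) - 1 + (m : ℕ) = ((k + (m : ℕ) : ℕ) : ℤ) - 1 by push_cast; ring] at this

variable (ρ e) in
/-- The action of `a ⊗ t⁻ᵐ` on `gr W`. -/
def grMulSingle (m : ℕ+) (a : H) : Module.End ℂ (Gr ρ e) := (exists_grMul m a).choose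

theorem grMulSingle_grClass (m : ℕ+) (a : H) (k : ℕ) (x : filt ρ e (k : ℤ)) :
    grMulSingle ρ e m a (grClass ρ e k x) = grClass ρ e (k + (m : ℕ))
      ⟨mode ρ (-((m : ℕ) : ℤ)) a x, mode_mem_filt ρ e a m k x x.2⟩ :=
  (exists_grMul m a).choose_spec k x

variable (ρ e) in
/-- The action of `H ⊗ t⁻¹ℂ[t⁻¹]` on `gr W`. -/
def grMul : (ℕ+ →₀ H) →ₗ[ℂ] Module.End ℂ (Gr ρ e) :=
  Finsupp.lsum ℂ fun m =>
    { toFun := grMulSingle ρ e m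
      map_add' := fun a b => by
        refine gr_hom_ext fun k x => ?_
        rw [LinearMap.add_apply, grMulSingle_grClass, grMulSingle_grClass, grMulSingle_grClass,
          ← grClass_add]
        congr 1
        exact Subtype.ext (by simp)
      map_smul' := fun c a => by
        refine gr_hom_ext fun k x => ?_
        rw [RingHom.id_apply, LinearMap.smul_apply, grMulSingle_grClass, grMulSingle_grClass,
          ← grClass_smul]
        congr 1
        exact Subtype.ext (by simp) }

theorem grMul_single_grClass (m : ℕ+) (a : H) (k : ℕ) (x : filt ρ e (k : ℤ)) :
    grMul ρ e (Finsupp.single m a) (grClass ρ e k x) = grClass ρ e (k + (m : ℕ))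
      ⟨mode ρ (-((m : ℕ) : ℤ)) a x, mode_mem_filt ρ e a m k x x.2⟩ := by
  rw [grMul, Finsupp.lsum_single]
  exact grMulSingle_grClass m a k x

variable {form : LinearMap.BilinForm ℂ H} {S : PowerSeries (Module.End ℂ (H ⊗[ℂ] H))}

theorem modePair_eq_zero (hρ : IsHSModule form S ρ) (he : IsVacuumLike ρ e) {k : ℤ} {w : W}
    (hw : w ∈ filt ρ e k) {p q : ℤ} (hpq : k < p + q) (t : H ⊗[ℂ] H) :
    modePair ρ p q t w = 0 :=
  eq_zero_of_mem_filt (k := k - q - p) (by omega) (modePair_mem (fun b a =>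
    mode_mem_filt_sub hρ he (mode_mem_filt_sub hρ he hw a q) b p) t)

/-- The operators `a(-m)` and `b(-n)` commute up to lower terms, because `𝒮(0) = 1`. -/
theorem mode_neg_comm_mem_filt (hρ : IsHSModule form S ρ) (he : IsVacuumLike ρ e)
    (hS : PowerSeries.coeff 0 S = 1) {k : ℤ} {w : W} (hw : w ∈ filt ρ e k) (a b : H) (m n : ℕ+) :
    mode ρ (-((m : ℕ) : ℤ)) a (mode ρ (-((n : ℕ) : ℤ)) b w) -
      mode ρ (-((n : ℕ) : ℤ)) b (mode ρ (-((m : ℕ) : ℤ)) a w) ∈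
        filt ρ e (k + (m : ℕ) + (n : ℕ) - 1) := by
  have hm := m.pos
  have hn := n.pos
  have h0 : ∑ j ∈ Finset.range (0 + 1), ((-1 : ℂ) ^ j * ((0 : ℕ).choose j : ℂ)) •
      modePair ρ (-((n : ℕ) : ℤ) + (0 : ℕ) - j) (-((m : ℕ) : ℤ) + j)
        (PowerSeries.coeff 0 S (b ⊗ₜ[ℂ] a)) w =
      mode ρ (-((n : ℕ) : ℤ)) b (mode ρ (-((m : ℕ) : ℤ)) a w) := by
    simp [hS]
  rw [mode_mode_eq hρ, if_neg (by omega), zero_smul, add_zero,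
    finsum_eq_sum_range (n := (k + (m : ℕ) + (n : ℕ)).toNat + 1) (fun i hi =>
      Finset.sum_eq_zero fun j _ => by
        rw [modePair_eq_zero hρ he hw (by omega), smul_zero]), Finset.sum_range_succ', h0,
    add_sub_cancel_right]
  refine Submodule.sum_mem _ fun i _ => Submodule.sum_mem _ fun j _ =>
    Submodule.smul_mem _ _ (modePair_mem (fun b' a' => ?_) _)
  exact filt_mono (by push_cast; omega)
    (mode_mem_filt_sub hρ he (mode_mem_filt_sub hρ he hw a' _) b' _)

theorem grMul_comm (hρ : IsHSModule form S ρ) (he : IsVacuumLike ρ e)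
    (hS : PowerSeries.coeff 0 S = 1) (x y : ℕ+ →₀ H) :
    grMul ρ e x * grMul ρ e y = grMul ρ e y * grMul ρ e x := by
  induction x using Finsupp.induction_linear with
  | zero => simp
  | add x x' hx hx' => rw [map_add, add_mul, mul_add, hx, hx']
  | single m a =>
    induction y using Finsupp.induction_linear with
    | zero => simp
    | add y y' hy hy' => rw [map_add, add_mul, mul_add, hy, hy']
    | single n b =>
      refine gr_hom_ext (ρ := ρ) (e := e) fun k z => ?_
      simp only [Module.End.mul_apply, grMul_single_grClass]
      refine grClass_eq (by omega) (filt_mono ?_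
        (mode_neg_comm_mem_filt hρ he hS z.2 a b m n))
      push_cast
      omega

/-- The action of the symmetric algebra `S(H ⊗ t⁻¹ℂ[t⁻¹])` on `gr W`. -/
theorem exists_grAction (hρ : IsHSModule form S ρ) (he : IsVacuumLike ρ e)
    (hS : PowerSeries.coeff 0 S = 1) :
    ∃ σ : SymmetricAlgebra ℂ (ℕ+ →₀ H) →ₐ[ℂ] Module.End ℂ (Gr ρ e),
      ∀ x, σ (SymmetricAlgebra.ι ℂ _ x) = grMul ρ e x :=
  exists_symmetricAlgebra_lift (grMul ρ e) (grMul_comm hρ he hS)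

/-- The class of the vacuum-like vector generates `gr W`. -/
theorem exists_grAction_eq {σ : SymmetricAlgebra ℂ (ℕ+ →₀ H) →ₐ[ℂ] Module.End ℂ (Gr ρ e)}
    (hσ : ∀ x, σ (SymmetricAlgebra.ι ℂ _ x) = grMul ρ e x) (x : Gr ρ e) :
    ∃ s, σ s (grClass ρ e 0 ⟨e, mem_filt_zero⟩) = x := by
  have key : ∀ K k : ℕ, k < K → ∀ w ∈ filt ρ e (k : ℤ), ∃ h : w ∈ filt ρ e (k : ℤ),
      ∃ s, σ s (grClass ρ e 0 ⟨e, mem_filt_zero⟩) = grClass ρ e k ⟨w, h⟩ := by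
    intro K
    induction K with
    | zero => intro k hk; omega
    | succ K ih =>
      intro k hk w hw
      refine filt_induction (Q := fun w => ∃ h : w ∈ filt ρ e (k : ℤ),
        ∃ s, σ s (grClass ρ e 0 ⟨e, mem_filt_zero⟩) = grClass ρ e k ⟨w, h⟩) ?_ ?_ ?_ ?_ ?_ hw
      · intro _
        refine ⟨filt_mono (by omega) mem_filt_zero, ?_⟩
        by_cases hk0 : k = 0
        · subst hk0
          exact ⟨1, by rw [map_one]; rfl⟩
        · refine ⟨0, ?_⟩
          rw [map_zero, LinearMap.zero_apply]
          exact (grClass_eq_zero_iff.2 (filt_mono (by omega) mem_filt_zero)).symm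
      · intro m a w hw
        have hm := m.pos
        rcases lt_or_ge k (m : ℕ) with hkm | hkm
        · rw [eq_zero_of_mem_filt (by omega) hw, map_zero]
          refine ⟨Submodule.zero_mem _, 0, ?_⟩
          rw [map_zero, LinearMap.zero_apply]
          exact (grClass_eq_zero_iff.2 (Submodule.zero_mem _)).symm
        · obtain ⟨l, rfl⟩ := Nat.exists_eq_add_of_le' hkm
          rw [show ((l + (m : ℕ) : ℕ) : ℤ) - (m : ℕ) = l by push_cast; ring] at hw
          obtain ⟨h, s, hs⟩ := ih l (by omega) w hw
          refine ⟨mode_mem_filt ρ e a m l w h,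
            SymmetricAlgebra.ι ℂ _ (Finsupp.single m a) * s, ?_⟩
          rw [map_mul, Module.End.mul_apply, hs, hσ, grMul_single_grClass]
      · refine ⟨Submodule.zero_mem _, 0, ?_⟩
        rw [map_zero, LinearMap.zero_apply]
        exact (grClass_eq_zero_iff.2 (Submodule.zero_mem _)).symm
      · rintro x y ⟨hx, s, hs⟩ ⟨hy, t, ht⟩
        refine ⟨Submodule.add_mem _ hx hy, s + t, ?_⟩
        rw [map_add, LinearMap.add_apply, hs, ht, ← grClass_add]
        rfl
      · rintro c x ⟨hx, s, hs⟩
        refine ⟨Submodule.smul_mem _ c hx, c • s, ?_⟩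
        rw [map_smul, LinearMap.smul_apply, hs, ← grClass_smul]
        rfl
  induction x using gr_induction with
  | grClass k x =>
    obtain ⟨_, h⟩ := key (k + 1) k (Nat.lt_succ_self k) x x.2
    exact h
  | zero => exact ⟨0, by simp⟩
  | add x y hx hy =>
    obtain ⟨s, rfl⟩ := hx
    obtain ⟨t, rfl⟩ := hy
    exact ⟨s + t, by simp⟩

variable (ρ e) in
/-- A symbol map: linear maps `θₖ` from `W` to the symmetric algebra `S(H ⊗ t⁻¹ℂ[t⁻¹])` that induce
a homomorphism from `gr W` to the free module of rank one, with `e ↦ 1`. -/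
structure IsSymbol (θ : ℕ → W →ₗ[ℂ] SymmetricAlgebra ℂ (ℕ+ →₀ H)) : Prop where
  lower : ∀ k : ℕ, ∀ w ∈ filt ρ e ((k : ℤ) - 1), θ k w = 0
  map_mode : ∀ (k : ℕ) (m : ℕ+) (a : H), ∀ w ∈ filt ρ e (k : ℤ),
    θ (k + (m : ℕ)) (mode ρ (-((m : ℕ) : ℤ)) a w) =
      SymmetricAlgebra.ι ℂ _ (Finsupp.single m a) * θ k w
  map_vac : θ 0 e = 1

variable {θ : ℕ → W →ₗ[ℂ] SymmetricAlgebra ℂ (ℕ+ →₀ H)}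

theorem IsSymbol.exists_grHom (hθ : IsSymbol ρ e θ)
    {σ : SymmetricAlgebra ℂ (ℕ+ →₀ H) →ₐ[ℂ] Module.End ℂ (Gr ρ e)}
    (hσ : ∀ x, σ (SymmetricAlgebra.ι ℂ _ x) = grMul ρ e x) :
    ∃ Θ : Gr ρ e →ₗ[ℂ] SymmetricAlgebra ℂ (ℕ+ →₀ H),
      (∀ k x, Θ (grClass ρ e k x) = θ k x) ∧
      ∀ s, Θ (σ s (grClass ρ e 0 ⟨e, mem_filt_zero⟩)) = s := by
  obtain ⟨Θ, hΘ⟩ := ZF.exists_grHom (ρ := ρ) (e := e)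
    (fun k => θ k ∘ₗ (filt ρ e (k : ℤ)).subtype) (fun k x hx => hθ.lower k x hx)
  have hΘσ : ∀ s x, Θ (σ s x) = s * Θ x := by
    intro s
    induction s using SymmetricAlgebra.induction with
    | algebraMap c =>
      intro x
      rw [AlgHom.commutes, Module.algebraMap_end_apply, map_smul, Algebra.smul_def]
    | ι y =>
      intro x
      rw [hσ]
      induction y using Finsupp.induction_linear with
      | zero => simp
      | add y z hy hz => simp only [map_add, LinearMap.add_apply, add_mul, hy, hz]
      | single m a =>
        induction x using gr_induction with
        | grClass k x =>
          rw [grMul_single_grClass, hΘ, hΘ]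
          exact hθ.map_mode k m a x x.2
        | zero => simp
        | add x y hx hy => simp only [map_add, mul_add, hx, hy]
    | mul s t hs ht =>
      intro x
      rw [map_mul, Module.End.mul_apply, hs, ht, mul_assoc]
    | add s t hs ht =>
      intro x
      rw [map_add, LinearMap.add_apply, map_add, hs, ht, add_mul]
  refine ⟨Θ, hΘ, fun s => ?_⟩
  rw [hΘσ, hΘ]
  change s * θ 0 e = s
  rw [hθ.map_vac, mul_one]

/-- An `(H,𝒮)`-module with a symbol map is of PBW type: the symbol map inverts the surjection from
the free module of rank one onto `gr W`. -/
theorem IsSymbol.isPBW (hθ : IsSymbol ρ e θ) (hρ : IsHSModule form S ρ) (he : IsVacuumLike ρ e)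
    (hS : PowerSeries.coeff 0 S = 1) : IsPBW ρ e := by
  obtain ⟨σ, hσ⟩ := exists_grAction hρ he hS
  obtain ⟨Θ, -, hΘ⟩ := hθ.exists_grHom hσ
  refine ⟨σ, fun a m k x => by rw [hσ, grMul_single_grClass], ?_⟩
  let _ : Module (SymmetricAlgebra ℂ (ℕ+ →₀ H)) (Gr ρ e) := Module.compHom (Gr ρ e) σ.toRingHom
  refine Module.Free.of_equiv (LinearEquiv.ofBijective (LinearMap.toSpanSingleton
    (SymmetricAlgebra ℂ (ℕ+ →₀ H)) (Gr ρ e) (grClass ρ e 0 ⟨e, mem_filt_zero⟩)) ⟨?_, ?_⟩)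
  · intro s t hst
    rw [← hΘ s, ← hΘ t]
    exact congrArg Θ hst
  · intro x
    exact exists_grAction_eq hσ x

/-- The symbol map is injective on `gr W`. -/
theorem IsSymbol.mem_filt_of_eq_zero (hθ : IsSymbol ρ e θ) (hρ : IsHSModule form S ρ)
    (he : IsVacuumLike ρ e) (hS : PowerSeries.coeff 0 S = 1) {k : ℕ} {w : W}
    (hw : w ∈ filt ρ e (k : ℤ)) (h0 : θ k w = 0) : w ∈ filt ρ e ((k : ℤ) - 1) := by
  obtain ⟨σ, hσ⟩ := exists_grAction hρ he hS
  obtain ⟨Θ, hΘ, hΘσ⟩ := hθ.exists_grHom hσ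
  obtain ⟨s, hs⟩ := exists_grAction_eq hσ (grClass ρ e k ⟨w, hw⟩)
  have h := hΘσ s
  rw [hs, hΘ] at h
  change θ k w = s at h
  rw [← h, h0, map_zero, LinearMap.zero_apply] at hs
  exact grClass_eq_zero_iff.1 hs.symm

/-- The intersection of the kernels of the maps of a symbol map is trivial. -/
theorem IsSymbol.eq_zero (hθ : IsSymbol ρ e θ) (hW : IsVacuumModule form S ρ e)
    (hS : PowerSeries.coeff 0 S = 1) {w : W} (h0 : ∀ k, θ k w = 0) : w = 0 := by
  obtain ⟨k, hk⟩ := exists_mem_filt hW w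
  induction k with
  | zero =>
    exact eq_zero_of_mem_filt (by norm_num)
      (hθ.mem_filt_of_eq_zero hW.isHSModule hW.vacuumLike hS hk (h0 0))
  | succ k ih =>
    refine ih ?_
    have := hθ.mem_filt_of_eq_zero hW.isHSModule hW.vacuumLike hS hk (h0 _)
    rwa [Nat.cast_succ, add_sub_cancel_right] at this

/-- The pullback of a symbol map under a homomorphism. -/
theorem IsSymbol.comp {W' : Type w} [AddCommGroup W'] [Module ℂ W'] {ρ' : LoopRep H W'} {e' : W'}
    (hθ : IsSymbol ρ e θ) {f : W' →ₗ[ℂ] W} (hf : IsLoopHom ρ' ρ f) (he : f e' = e) :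
    IsSymbol ρ' e' fun k => θ k ∘ₗ f := by
  have hle : ∀ k : ℤ, ∀ w ∈ filt ρ' e' k, f w ∈ filt ρ e k := by
    intro k w hw
    have hprod : ∀ l : List (H × ℕ+),
        f ((l.map fun p => mode ρ' (-((p.2 : ℕ) : ℤ)) p.1).prod e') =
          (l.map fun p => mode ρ (-((p.2 : ℕ) : ℤ)) p.1).prod e := by
      intro l
      induction l with
      | nil => exact he
      | cons p l ih =>
        simp only [List.map_cons, List.prod_cons, Module.End.mul_apply]
        rw [mode_eq, hf, ih]
        rfl
    have h : filt ρ' e' k ≤ (filt ρ e k).comap f := by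
      refine Submodule.span_le.2 ?_
      rintro _ ⟨l, hl, rfl⟩
      exact Submodule.subset_span ⟨l, hl, hprod l⟩
    exact h hw
  exact
    { lower := fun k w hw => hθ.lower k _ (hle _ _ hw)
      map_mode := fun k m a w hw => by
        rw [LinearMap.comp_apply, mode_eq, hf]
        exact hθ.map_mode k m a _ (hle _ _ hw)
      map_vac := by rw [LinearMap.comp_apply, he, hθ.map_vac] }

end Graded

/-! ### The Fock space realization of `V_ℋ` -/

section Contraction

variable {M : Type u} [AddCommGroup M] [Module ℂ M]

/-- A linear functional on `M` extends to a derivation of the symmetric algebra. -/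
theorem exists_contract (d : M →ₗ[ℂ] ℂ) :
    ∃ D : Module.End ℂ (SymmetricAlgebra ℂ M),
      (∀ x, D (SymmetricAlgebra.ι ℂ M x) = algebraMap ℂ _ (d x)) ∧
      ∀ s t, D (s * t) = s * D t + D s * t := by
  -- the `ε`-component of the homomorphism to the dual numbers with `x ↦ x + d(x)ε`
  let F : SymmetricAlgebra ℂ M →ₐ[ℂ] DualNumber (SymmetricAlgebra ℂ M) :=
    SymmetricAlgebra.lift
      { toFun := fun x => TrivSqZeroExt.inl (SymmetricAlgebra.ι ℂ M x) +
          TrivSqZeroExt.inr (algebraMap ℂ _ (d x))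
        map_add' := fun x y => by
          ext <;> simp [Algebra.algebraMap_eq_smul_one, add_smul]
        map_smul' := fun c x => by
          ext <;> simp [Algebra.algebraMap_eq_smul_one, mul_smul] }
  have hF : ∀ x, F (SymmetricAlgebra.ι ℂ M x) = TrivSqZeroExt.inl (SymmetricAlgebra.ι ℂ M x) +
      TrivSqZeroExt.inr (algebraMap ℂ _ (d x)) := fun x => by
    simp only [F, SymmetricAlgebra.lift_ι_apply]
    rfl
  have hfst : ∀ s, (F s).fst = s := by
    intro s
    have h : (TrivSqZeroExt.fstHom ℂ (SymmetricAlgebra ℂ M) (SymmetricAlgebra ℂ M)).comp F =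
        AlgHom.id ℂ _ := by
      refine SymmetricAlgebra.algHom_ext (LinearMap.ext fun x => ?_)
      change (F (SymmetricAlgebra.ι ℂ M x)).fst = SymmetricAlgebra.ι ℂ M x
      rw [hF]
      simp
    exact DFunLike.congr_fun h s
  refine ⟨(TrivSqZeroExt.sndHom (SymmetricAlgebra ℂ M) (SymmetricAlgebra ℂ M)).restrictScalars ℂ
    ∘ₗ F.toLinearMap, fun x => ?_, fun s t => ?_⟩
  · change (F _).snd = _
    rw [hF]
    simp [Algebra.algebraMap_eq_smul_one]
  · change (F (s * t)).snd = s * (F t).snd + (F s).snd * t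
    rw [map_mul, TrivSqZeroExt.snd_mul, hfst, hfst]
    simp [mul_comm]

/-- The derivation of the symmetric algebra that extends the linear functional `d` on `M`. -/
def contract (d : M →ₗ[ℂ] ℂ) : Module.End ℂ (SymmetricAlgebra ℂ M) := (exists_contract d).choose

theorem contract_ι (d : M →ₗ[ℂ] ℂ) (x : M) :
    contract d (SymmetricAlgebra.ι ℂ M x) = algebraMap ℂ _ (d x) :=
  (exists_contract d).choose_spec.1 x

theorem contract_mul (d : M →ₗ[ℂ] ℂ) (s t : SymmetricAlgebra ℂ M) :
    contract d (s * t) = s * contract d t + contract d s * t :=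
  (exists_contract d).choose_spec.2 s t

theorem contract_one (d : M →ₗ[ℂ] ℂ) : contract d 1 = 0 := by
  have h := contract_mul d 1 1
  rw [mul_one, one_mul, mul_one] at h
  exact left_eq_add.1 h

theorem contract_algebraMap (d : M →ₗ[ℂ] ℂ) (c : ℂ) : contract d (algebraMap ℂ _ c) = 0 := by
  rw [Algebra.algebraMap_eq_smul_one, map_smul, contract_one, smul_zero]

theorem contract_comm (d d' : M →ₗ[ℂ] ℂ) (s : SymmetricAlgebra ℂ M) :
    contract d (contract d' s) = contract d' (contract d s) := by
  induction s using SymmetricAlgebra.induction with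
  | algebraMap c => simp only [contract_algebraMap, map_zero]
  | ι x => simp only [contract_ι, contract_algebraMap]
  | mul s t hs ht =>
    simp only [contract_mul, map_add, hs, ht]
    ring
  | add s t hs ht => simp only [map_add, hs, ht]

/-- Contraction with linear functionals, as a linear map. -/
def contractHom : (M →ₗ[ℂ] ℂ) →ₗ[ℂ] Module.End ℂ (SymmetricAlgebra ℂ M) where
  toFun := contract
  map_add' d d' := LinearMap.ext fun s => by
    rw [LinearMap.add_apply]
    induction s using SymmetricAlgebra.induction with
    | algebraMap c => simp only [contract_algebraMap, add_zero]
    | ι x => simp only [contract_ι, LinearMap.add_apply, map_add]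
    | mul s t hs ht =>
      simp only [contract_mul, hs, ht]
      ring
    | add s t hs ht =>
      rw [map_add, map_add, map_add, hs, ht]
      abel
  map_smul' c d := LinearMap.ext fun s => by
    rw [RingHom.id_apply, LinearMap.smul_apply]
    induction s using SymmetricAlgebra.induction with
    | algebraMap c => simp only [contract_algebraMap, smul_zero]
    | ι x => rw [contract_ι, contract_ι, LinearMap.smul_apply, smul_eq_mul, map_mul, Algebra.smul_def]
    | mul s t hs ht =>
      simp only [contract_mul, hs, ht, Algebra.smul_def]
      ring
    | add s t hs ht => rw [map_add, map_add, smul_add, hs, ht]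

end Contraction

section Fock

variable {U : Type u} [AddCommGroup U] [Module ℂ U]

variable (U) in
/-- The action of `a ⊗ tⁿ` on the symmetric algebra `S(H ⊗ t⁻¹ℂ[t⁻¹])`: multiplication by `a ⊗ tⁿ` if
`n < 0`, and the derivation with `b ⊗ t⁻ᵐ ↦ ⟨a, b⟩ δ_{m,n+1}` if `n ≥ 0`. -/
def fockMode (n : ℤ) :
    HSpace U →ₗ[ℂ] Module.End ℂ (SymmetricAlgebra ℂ (ℕ+ →₀ HSpace U)) :=
  if 0 ≤ n then
    contractHom ∘ₗ LinearMap.lcomp ℂ ℂ (Finsupp.lapply n.toNat.succPNat) ∘ₗ symp U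
  else LinearMap.mul ℂ _ ∘ₗ SymmetricAlgebra.ι ℂ _ ∘ₗ Finsupp.lsingle (-n - 1).toNat.succPNat

theorem fockMode_nonneg {n : ℤ} (hn : 0 ≤ n) (a : HSpace U) :
    fockMode U n a = contract (symp U a ∘ₗ Finsupp.lapply n.toNat.succPNat) := by
  rw [fockMode, if_pos hn]
  rfl

theorem fockMode_neg (m : ℕ+) (a : HSpace U) (s : SymmetricAlgebra ℂ (ℕ+ →₀ HSpace U)) :
    fockMode U (-((m : ℕ) : ℤ)) a s = SymmetricAlgebra.ι ℂ _ (Finsupp.single m a) * s := by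
  have hm := m.pos
  have h : (-(-((m : ℕ) : ℤ)) - 1).toNat.succPNat = m := by
    apply PNat.coe_injective
    rw [Nat.succPNat_coe]
    omega
  rw [fockMode, if_neg (by omega), h]
  rfl

theorem fockMode_commutator (m n : ℤ) (a b : HSpace U)
    (s : SymmetricAlgebra ℂ (ℕ+ →₀ HSpace U)) :
    fockMode U m a (fockMode U n b s) - fockMode U n b (fockMode U m a s) =
      (if m + n + 1 = 0 then symp U a b else 0) • s := by
  have key : ∀ (m : ℤ) (_ : 0 ≤ m) (n : ℕ+) (a b : HSpace U),
      fockMode U m a (fockMode U (-((n : ℕ) : ℤ)) b s) -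
        fockMode U (-((n : ℕ) : ℤ)) b (fockMode U m a s) =
      (if m + -((n : ℕ) : ℤ) + 1 = 0 then symp U a b else 0) • s := by
    intro m hm n a b
    rw [fockMode_neg, fockMode_neg, fockMode_nonneg hm, contract_mul, add_sub_cancel_left,
      contract_ι, LinearMap.comp_apply, Finsupp.lapply_apply, Finsupp.single_apply,
      Algebra.smul_def]
    have h : (n = m.toNat.succPNat) ↔ (m + -((n : ℕ) : ℤ) + 1 = 0) := by
      rw [← PNat.coe_inj, Nat.succPNat_coe]
      omega
    simp only [h]
    split_ifs
    · rfl
    · rw [map_zero]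
  have hneg : ∀ n : ℤ, n < 0 → ∃ q : ℕ+, n = -((q : ℕ) : ℤ) := fun n hn =>
    ⟨⟨(-n).toNat, by omega⟩, by simp only [PNat.mk_coe]; omega⟩
  rcases lt_or_ge m 0 with hm | hm <;> rcases lt_or_ge n 0 with hn | hn
  · obtain ⟨p, rfl⟩ := hneg m hm
    obtain ⟨q, rfl⟩ := hneg n hn
    rw [if_neg (by omega), zero_smul]
    simp only [fockMode_neg]
    ring
  · obtain ⟨p, rfl⟩ := hneg m hm
    rw [← neg_sub, key n hn p b a, ← neg_smul]
    congr 1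
    simp only [show ∀ x y : ℤ, x + y + 1 = y + x + 1 from fun x y => by ring]
    rw [show n + -((p : ℕ) : ℤ) = -((p : ℕ) : ℤ) + n by ring]
    split_ifs
    · rw [symp_apply, symp_apply]
      ring
    · exact neg_zero
  · obtain ⟨q, rfl⟩ := hneg n hn
    exact key m hm q a b
  · rw [if_neg (by omega), zero_smul, fockMode_nonneg hm, fockMode_nonneg hn, contract_comm,
      sub_self]

theorem exists_fockMap (U : Type u) [AddCommGroup U] [Module ℂ U] :
    ∃ φ : VHeis U →ₗ[ℂ] SymmetricAlgebra ℂ (ℕ+ →₀ HSpace U), φ (vac U) = 1 ∧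
      ∀ (n : ℤ) (a : HSpace U) (v : VHeis U), φ (heisMode U n a v) = fockMode U n a (φ v) :=
  exists_heisHom (fockMode U) 1 fockMode_commutator fun n a hn => by
    rw [fockMode_nonneg hn, contract_one]

/-- The homomorphism from `V_ℋ` to the Fock space. -/
def fockMap (U : Type u) [AddCommGroup U] [Module ℂ U] :
    VHeis U →ₗ[ℂ] SymmetricAlgebra ℂ (ℕ+ →₀ HSpace U) := (exists_fockMap U).choose

/-- The algebra homomorphism with `a ⊗ t⁻ᵐ ↦ (a ⊗ t⁻ᵐ) Xᵐ`; the coefficient of `Xᵏ` of the image of `s`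
is the component of `s` of weight `k`. -/
def weightHom (U : Type u) [AddCommGroup U] [Module ℂ U] :
    SymmetricAlgebra ℂ (ℕ+ →₀ HSpace U) →ₐ[ℂ]
      Polynomial (SymmetricAlgebra ℂ (ℕ+ →₀ HSpace U)) :=
  SymmetricAlgebra.lift (Finsupp.lsum ℂ fun m : ℕ+ =>
    (Polynomial.monomial (R := SymmetricAlgebra ℂ (ℕ+ →₀ HSpace U)) (m : ℕ)).restrictScalars ℂ ∘ₗ
      SymmetricAlgebra.ι ℂ _ ∘ₗ Finsupp.lsingle m)

theorem weightHom_ι_single (m : ℕ+) (a : HSpace U) :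
    weightHom U (SymmetricAlgebra.ι ℂ _ (Finsupp.single m a)) =
      Polynomial.C (SymmetricAlgebra.ι ℂ _ (Finsupp.single m a)) * Polynomial.X ^ (m : ℕ) := by
  rw [weightHom, SymmetricAlgebra.lift_ι_apply, Finsupp.lsum_single,
    Polynomial.C_mul_X_pow_eq_monomial]
  rfl

/-- The component of weight `k` of the image of a vector of `V_ℋ` in the Fock space. -/
def heisSymbol (U : Type u) [AddCommGroup U] [Module ℂ U] (k : ℕ) :
    VHeis U →ₗ[ℂ] SymmetricAlgebra ℂ (ℕ+ →₀ HSpace U) :=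
  (Polynomial.lcoeff (SymmetricAlgebra ℂ (ℕ+ →₀ HSpace U)) k).restrictScalars ℂ ∘ₗ
    (weightHom U).toLinearMap ∘ₗ fockMap U

theorem heisSymbol_apply (k : ℕ) (w : VHeis U) :
    heisSymbol U k w = (weightHom U (fockMap U w)).coeff k := rfl

theorem heisSymbol_vac (k : ℕ) : heisSymbol U k (vac U) = if k = 0 then 1 else 0 := by
  rw [heisSymbol_apply, fockMap, (exists_fockMap U).choose_spec.1, map_one, Polynomial.coeff_one]

theorem heisSymbol_mode (j : ℕ) (m : ℕ+) (a : HSpace U) (w : VHeis U) :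
    heisSymbol U j (heisMode U (-((m : ℕ) : ℤ)) a w) =
      if (m : ℕ) ≤ j then
        SymmetricAlgebra.ι ℂ _ (Finsupp.single m a) * heisSymbol U (j - (m : ℕ)) w else 0 := by
  rw [heisSymbol_apply, fockMap, (exists_fockMap U).choose_spec.2, fockMode_neg, map_mul,
    weightHom_ι_single, mul_assoc, Polynomial.coeff_C_mul, Polynomial.coeff_X_pow_mul', mul_ite,
    mul_zero]
  rfl

/-- The action of `T(H ⊗ ℂ[t,t⁻¹])` on `V_ℋ` in which `a ⊗ tⁿ` acts as `a(n)`. -/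
def heisRep (U : Type u) [AddCommGroup U] [Module ℂ U] : LoopRep (HSpace U) (VHeis U) :=
  TensorAlgebra.lift ℂ (Finsupp.lsum ℂ (heisMode U))

@[simp] theorem mode_heisRep (n : ℤ) (a : HSpace U) :
    mode (heisRep U) n a = heisMode U n a := by
  rw [mode_eq, gen, heisRep, TensorAlgebra.lift_ι_apply, Finsupp.lsum_single]

theorem heisRep_isHSModule : IsHSModule (symp U) 1 (heisRep U) where
  truncation a w := by
    simp only [mode_heisRep]
    exact exists_heisMode_eq_zero a w
  relation a b m n w := by
    rw [relVec, finsum_eq_single _ 0]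
    · have h := heisMode_commutator m n a b w
      simp only [zero_add, Finset.sum_range_one, pow_zero, Nat.choose_self, Nat.cast_one, one_mul,
        one_smul, PowerSeries.coeff_zero_one, Module.End.one_apply, modePair_tmul,
        Module.End.mul_apply, mode_heisRep, Nat.cast_zero, add_zero, sub_zero]
      rw [h, sub_self]
    · intro k hk
      refine Finset.sum_eq_zero fun j _ => ?_
      rw [PowerSeries.coeff_one, if_neg hk, LinearMap.zero_apply, map_zero, LinearMap.zero_apply,
        smul_zero]

theorem heisRep_isVacuumLike : IsVacuumLike (heisRep U) (vac U) := fun a m hm => by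
  rw [mode_heisRep, heisMode_vac m hm]

theorem heisMode_mem_filt {k : ℤ} {w : VHeis U} (hw : w ∈ filt (heisRep U) (vac U) k)
    (a : HSpace U) (n : ℤ) : heisMode U n a w ∈ filt (heisRep U) (vac U) (k - n) := by
  rw [← mode_heisRep]
  exact mode_mem_filt_sub heisRep_isHSModule heisRep_isVacuumLike hw a n

theorem exists_mem_filt_heisRep (w : VHeis U) : ∃ k : ℕ, w ∈ filt (heisRep U) (vac U) k := by
  induction w using vheis_induction with
  | vac => exact ⟨0, mem_filt_zero⟩
  | add x y hx hy =>
    obtain ⟨k, hk⟩ := hx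
    obtain ⟨l, hl⟩ := hy
    exact ⟨k + l, Submodule.add_mem _ (filt_mono (by push_cast; omega) hk)
      (filt_mono (by push_cast; omega) hl)⟩
  | smul c x hx =>
    obtain ⟨k, hk⟩ := hx
    exact ⟨k, Submodule.smul_mem _ c hk⟩
  | mode n a x hx =>
    obtain ⟨k, hk⟩ := hx
    exact ⟨(k - n).toNat, filt_mono (by omega) (heisMode_mem_filt hk a n)⟩

theorem heisSymbol_eq_zero {k : ℤ} {w : VHeis U} (hw : w ∈ filt (heisRep U) (vac U) k) {j : ℕ}
    (hj : k < j) : heisSymbol U j w = 0 := by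
  induction j using Nat.strong_induction_on generalizing k w with
  | _ j ih =>
    refine filt_induction (Q := fun w => heisSymbol U j w = 0) ?_ ?_ ?_ ?_ ?_ hw
    · intro hk
      rw [heisSymbol_vac, if_neg (by omega)]
    · intro m a w hw
      have hm := m.pos
      rw [mode_heisRep, heisSymbol_mode]
      split_ifs with h
      · rw [ih (j - (m : ℕ)) (by omega) hw (by omega), mul_zero]
      · rfl
    · exact map_zero _
    · intro x y hx hy
      rw [map_add, hx, hy, add_zero]
    · intro c x hx
      rw [map_smul, hx, smul_zero]

end Fock

/-! ### The twisted fields -/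

section TwistField

variable {V : Type v} [AddCommGroup V] [Module ℂ V]

theorem ofPowerSeries_coeff_of_neg (f : PowerSeries ℂ) {i : ℤ} (hi : i < 0) :
    (HahnSeries.ofPowerSeries ℤ ℂ f).coeff i = 0 := by
  rw [HahnSeries.ofPowerSeries_apply, HahnSeries.embDomain_of_notMem_range]
  rintro ⟨k, hk⟩
  have : (k : ℤ) = i := hk
  omega

theorem coeff_ofPowerSeries_smul (A : VertexOperator ℂ V) (f : PowerSeries ℂ) (v : V) (n : ℤ) :
    ((HahnModule.of ℂ).symm ((HahnSeries.ofPowerSeries ℤ ℂ f) • A v)).coeff (-n - 1) =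
      ∑ᶠ k : ℕ, PowerSeries.coeff k f • (A[[n + k]]) v := by
  obtain ⟨N, hN⟩ := exists_ncoeff_add_eq_zero A n v
  rw [finsum_eq_sum_range (n := N) fun k hk => by rw [hN k hk, smul_zero], HahnModule.coeff_smul]
  have hA : ∀ j, ((HahnModule.of ℂ).symm (A v)).coeff j = (A[[-j - 1]]) v := fun j => by
    rw [← VertexOperator.coeff_eq_ncoeff]
    rfl
  refine Finset.sum_bij_ne_zero (fun ij _ _ => ij.1.toNat) ?_ ?_ ?_ ?_
  · intro ij hij hne
    have h := (Finset.mem_vaddAntidiagonal _ _).1 hij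
    rw [vadd_eq_add] at h
    have h0 : 0 ≤ ij.1 := by
      by_contra hneg
      exact hne (by rw [ofPowerSeries_coeff_of_neg f (not_le.1 hneg), zero_smul])
    by_contra hn
    refine hne ?_
    have := hN ij.1.toNat (by simpa using hn)
    rw [hA, show -ij.2 - 1 = n + (ij.1.toNat : ℤ) by omega, this, smul_zero]
  · intro ij hij hne ij' hij' hne' h
    have h1 := ((Finset.mem_vaddAntidiagonal _ _).1 hij).2.2
    have h2 := ((Finset.mem_vaddAntidiagonal _ _).1 hij').2.2
    rw [vadd_eq_add] at h1 h2
    have h0 : 0 ≤ ij.1 := by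
      by_contra hneg
      exact hne (by rw [ofPowerSeries_coeff_of_neg f (not_le.1 hneg), zero_smul])
    have h0' : 0 ≤ ij'.1 := by
      by_contra hneg
      exact hne' (by rw [ofPowerSeries_coeff_of_neg f (not_le.1 hneg), zero_smul])
    refine Prod.ext ?_ ?_ <;> omega
  · intro k _ hne
    have h1 : (HahnSeries.ofPowerSeries ℤ ℂ f).coeff (k : ℤ) = PowerSeries.coeff k f :=
      HahnSeries.ofPowerSeries_apply_coeff f k
    have h2 := hA (-n - 1 - k)
    rw [show -(-n - 1 - (k : ℤ)) - 1 = n + k by ring] at h2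
    have hne1 : PowerSeries.coeff k f ≠ 0 := fun h => hne (by rw [h, zero_smul])
    have hne2 : (A[[n + k]]) v ≠ 0 := fun h => hne (by rw [h, smul_zero])
    refine ⟨((k : ℤ), -n - 1 - k), (Finset.mem_vaddAntidiagonal _ _).2 ⟨?_, ?_, ?_⟩, ?_, ?_⟩
    · rw [HahnSeries.mem_support, h1]
      exact hne1
    · rw [HahnSeries.mem_support, h2]
      exact hne2
    · change (k : ℤ) + (-n - 1 - k) = _
      ring
    · rw [h1, h2]
      exact hne
    · simp
  · intro ij hij hne
    have h := ((Finset.mem_vaddAntidiagonal _ _).1 hij).2.2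
    rw [vadd_eq_add] at h
    have h0 : 0 ≤ ij.1 := by
      by_contra hneg
      exact hne (by rw [ofPowerSeries_coeff_of_neg f (not_le.1 hneg), zero_smul])
    rw [hA, show -ij.2 - 1 = n + (ij.1.toNat : ℤ) by omega,
      ← HahnSeries.ofPowerSeries_apply_coeff (Γ := ℤ) f ij.1.toNat]
    congr 2
    omega

/-- The modes of `A(x)Δ(x)`. -/
theorem twistField_ncoeff (Δ : V →ₗ[ℂ] V ⊗[ℂ] PowerSeries ℂ) (A : VertexOperator ℂ V) (n : ℤ)
    (w : V) : ((twistField Δ A)[[n]]) w = ∑ᶠ k : ℕ, (A[[n + k]]) (dcoeff Δ k w) := by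
  have key : ∀ ξ : V ⊗[ℂ] PowerSeries ℂ,
      (∃ N : ℕ, ∀ k : ℕ, N ≤ k → (A[[n + k]]) (tcoeff V k ξ) = 0) ∧
      ((HahnModule.of ℂ).symm (extendSeries A ξ)).coeff (-n - 1) =
        ∑ᶠ k : ℕ, (A[[n + k]]) (tcoeff V k ξ) := by
    intro ξ
    induction ξ using TensorProduct.induction_on with
    | zero => simp
    | tmul v f =>
      obtain ⟨N, hN⟩ := exists_ncoeff_add_eq_zero A n v
      refine ⟨⟨N, fun k hk => by rw [tcoeff_tmul, map_smul, hN k hk, smul_zero]⟩, ?_⟩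
      simp only [tcoeff_tmul, map_smul]
      exact coeff_ofPowerSeries_smul A f v n
    | add x y hx hy =>
      obtain ⟨⟨N, hN⟩, hx⟩ := hx
      obtain ⟨⟨M, hM⟩, hy⟩ := hy
      refine ⟨⟨max N M, fun k hk => ?_⟩, ?_⟩
      · rw [map_add, map_add, hN k (le_trans (le_max_left _ _) hk),
          hM k (le_trans (le_max_right _ _) hk), add_zero]
      · simp only [map_add]
        rw [finsum_add_of_eventually ⟨N, hN⟩ ⟨M, hM⟩, ← hx, ← hy]
        rfl
  exact (key (Δ w)).2

end TwistField

section TwistedModule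

variable {U : Type u} [AddCommGroup U] [Module ℂ U]

/-- The weight filtration of `V_ℋ`. -/
abbrev heisFilt (U : Type u) [AddCommGroup U] [Module ℂ U] (k : ℤ) : Submodule ℂ (VHeis U) :=
  filt (heisRep U) (vac U) k

/-- Pseudo-endomorphisms preserve the weight filtration. -/
theorem IsPseudoEnd.dcoeff_mem_heisFilt {Δ : VHeis U →ₗ[ℂ] VHeis U ⊗[ℂ] PowerSeries ℂ}
    (h : IsPseudoEnd (vac U) (heisY U) Δ) {P : ℕ → Module.End ℂ (HSpace U)}
    (hs : ∀ n a, dcoeff Δ n (state U a) = state U (P n a)) {k : ℤ} {w : VHeis U}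
    (hw : w ∈ heisFilt U k) (p : ℕ) : dcoeff Δ p w ∈ heisFilt U k := by
  have key : ∀ K : ℕ, ∀ k : ℤ, k < K → ∀ w ∈ heisFilt U k, ∀ p, dcoeff Δ p w ∈ heisFilt U k := by
    intro K
    induction K with
    | zero =>
      intro k hk w hw p
      rw [eq_zero_of_mem_filt (by exact_mod_cast hk) hw, map_zero]
      exact Submodule.zero_mem _
    | succ K ih =>
      intro k hk w hw p
      refine filt_induction (Q := fun w => dcoeff Δ p w ∈ heisFilt U k) ?_ ?_ ?_ ?_ ?_ hw
      · intro hk0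
        rw [dcoeff_apply, h.map_one, tcoeff_tmul]
        exact Submodule.smul_mem _ _ (filt_mono hk0 mem_filt_zero)
      · intro m a w hw
        have hm := m.pos
        rw [mode_heisRep, h.dcoeff_heisMode hs]
        refine Submodule.sum_mem _ fun i _ => finsum_mem_submodule fun j =>
          Submodule.smul_mem _ _ ?_
        exact filt_mono (by omega) (heisMode_mem_filt (ih _ (by omega) w hw i) _ _)
      · rw [map_zero]
        exact Submodule.zero_mem _
      · intro x y hx hy
        rw [map_add]
        exact Submodule.add_mem _ hx hy
      · intro c x hx
        rw [map_smul]
        exact Submodule.smul_mem _ _ hx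
  exact key (k + 1).toNat k (by omega) w hw p

/-- `Δ₀` is the identity modulo lower terms if it is the identity on `H`. -/
theorem IsPseudoEnd.dcoeff_zero_sub_mem {Δ : VHeis U →ₗ[ℂ] VHeis U ⊗[ℂ] PowerSeries ℂ}
    (h : IsPseudoEnd (vac U) (heisY U) Δ) {P : ℕ → Module.End ℂ (HSpace U)}
    (hs : ∀ n a, dcoeff Δ n (state U a) = state U (P n a)) (hP : ∀ a, P 0 a = a) {k : ℤ}
    {w : VHeis U} (hw : w ∈ heisFilt U k) : dcoeff Δ 0 w - w ∈ heisFilt U (k - 1) := by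
  have key : ∀ K : ℕ, ∀ k : ℤ, k < K → ∀ w ∈ heisFilt U k,
      dcoeff Δ 0 w - w ∈ heisFilt U (k - 1) := by
    intro K
    induction K with
    | zero =>
      intro k hk w hw
      rw [eq_zero_of_mem_filt (by exact_mod_cast hk) hw, map_zero, sub_zero]
      exact Submodule.zero_mem _
    | succ K ih =>
      intro k hk w hw
      refine filt_induction (Q := fun w => dcoeff Δ 0 w - w ∈ heisFilt U (k - 1))
        ?_ ?_ ?_ ?_ ?_ hw
      · intro hk0
        rw [dcoeff_apply, h.map_one, tcoeff_tmul, PowerSeries.coeff_zero_one, one_smul, sub_self]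
        exact Submodule.zero_mem _
      · intro m a w hw
        have hm := m.pos
        have hD := h.dcoeff_mem_heisFilt hs hw 0
        rw [mode_heisRep, h.dcoeff_heisMode hs, Finset.sum_range_one,
          finsum_eq_sum_range (n := k.toNat + 1 + (m : ℕ)) (fun j hj => by
            rw [eq_zero_of_mem_filt (k := k - (m : ℕ) - (-((m : ℕ) : ℤ) + j)) (by omega)
              (heisMode_mem_filt hD _ _), smul_zero]),
          show k.toNat + 1 + (m : ℕ) = (k.toNat + (m : ℕ)) + 1 by omega, Finset.sum_range_succ',
          add_sub_assoc]
        refine Submodule.add_mem _ (Submodule.sum_mem _ fun j _ => Submodule.smul_mem _ _ ?_) ?_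
        · exact filt_mono (by push_cast; omega) (heisMode_mem_filt hD _ _)
        · have h1 := heisMode_mem_filt (ih _ (by omega) w hw) a (-((m : ℕ) : ℤ))
          rw [map_sub] at h1
          simp only [pow_zero, Nat.choose_self, Nat.cast_one, one_mul, one_smul, Nat.cast_zero,
            add_zero, hP, Nat.sub_self]
          exact filt_mono (by omega) h1
      · rw [map_zero, sub_zero]
        exact Submodule.zero_mem _
      · intro x y hx hy
        rw [map_add, add_sub_add_comm]
        exact Submodule.add_mem _ hx hy
      · intro c x hx
        rw [map_smul, ← smul_sub]
        exact Submodule.smul_mem _ _ hx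
  exact key (k + 1).toNat k (by omega) w hw

/-- The projections of `H` to `U` (sign `true`) and `U*` (sign `false`). -/
def signPart (U : Type u) [AddCommGroup U] [Module ℂ U] (ε : Bool) : Module.End ℂ (HSpace U) :=
  if ε then onU 1 else onDual 1

@[simp] theorem signPart_true (a : HSpace U) : signPart U true a = (a.1, 0) := rfl

@[simp] theorem signPart_false (a : HSpace U) : signPart U false a = (0, a.2) := rfl

theorem signPart_add (a : HSpace U) : signPart U true a + signPart U false a = a := by
  simp

variable [FiniteDimensional ℂ U] {R : PowerSeries (Module.End ℂ U)}
variable (hR : PowerSeries.constantCoeff R = 1)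

/-- The modes of `Y(a,x)Δ^±(x)`, according to the sign. -/
def signMode (ε : Bool) (n : ℤ) : HSpace U →ₗ[ℂ] Module.End ℂ (VHeis U) :=
  LinearMap.proj n ∘ₗ VertexOperator.ncoeff ∘ₗ twistField (signDelta hR ε) ∘ₗ heisField

theorem signMode_apply (ε : Bool) (n : ℤ) (a : HSpace U) (w : VHeis U) :
    signMode hR ε n a w = ∑ᶠ k : ℕ, heisMode U (n + k) a (dcoeff (signDelta hR ε) k w) := by
  change ((twistField (signDelta hR ε) (heisField a))[[n]]) w = _
  rw [twistField_ncoeff]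
  simp only [heisField_ncoeff]

theorem dcoeff_signDelta_mem (ε : Bool) {k : ℤ} {w : VHeis U} (hw : w ∈ heisFilt U k) (p : ℕ) :
    dcoeff (signDelta hR ε) p w ∈ heisFilt U k :=
  (deltaMap_isPseudoEnd _).dcoeff_mem_heisFilt (dcoeff_deltaMap_state _) hw p

theorem signMode_eq_sum (ε : Bool) (n : ℤ) (a : HSpace U) {k : ℤ} {w : VHeis U}
    (hw : w ∈ heisFilt U k) {N : ℕ} (hN : k < n + N) :
    signMode hR ε n a w =
      ∑ i ∈ Finset.range N, heisMode U (n + i) a (dcoeff (signDelta hR ε) i w) := by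
  rw [signMode_apply, finsum_eq_sum_range]
  intro j hj
  exact eq_zero_of_mem_filt (k := k - (n + j)) (by omega)
    (heisMode_mem_filt (dcoeff_signDelta_mem hR ε hw j) a _)

theorem signMode_mem (ε : Bool) (n : ℤ) (a : HSpace U) {k : ℤ} {w : VHeis U}
    (hw : w ∈ heisFilt U k) : signMode hR ε n a w ∈ heisFilt U (k - n) := by
  rw [signMode_apply]
  refine finsum_mem_submodule fun j => ?_
  exact filt_mono (by omega) (heisMode_mem_filt (dcoeff_signDelta_mem hR ε hw j) a _)

/-- `a_R(-m)` and `a(-m)` agree up to lower terms. -/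
theorem signMode_sub_mem (ε : Bool) (n : ℤ) (a : HSpace U) {k : ℤ} {w : VHeis U}
    (hw : w ∈ heisFilt U k) :
    signMode hR ε n a w - heisMode U n a w ∈ heisFilt U (k - n - 1) := by
  rw [signMode_eq_sum hR ε n a hw (N := (k - n).toNat + 1) (by push_cast; omega),
    Finset.sum_range_succ', add_sub_assoc]
  refine Submodule.add_mem _ (Submodule.sum_mem _ fun j _ => ?_) ?_
  · exact filt_mono (by push_cast; omega)
      (heisMode_mem_filt (dcoeff_signDelta_mem hR ε hw _) a _)
  · rw [Nat.cast_zero, add_zero, ← map_sub]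
    have h := (deltaMap_isPseudoEnd (isIsometry_signCoeff hR ε)).dcoeff_zero_sub_mem
      (dcoeff_deltaMap_state _) (signCoeff_zero hR ε) hw
    exact filt_mono (by omega) (heisMode_mem_filt h a n)

theorem signMode_vac (ε : Bool) {n : ℤ} (hn : 0 ≤ n) (a : HSpace U) :
    signMode hR ε n a (vac U) = 0 := by
  rw [signMode_apply]
  refine finsum_eq_zero_of_forall_eq_zero fun k => ?_
  rw [dcoeff_apply, signDelta, deltaMap_vac, tcoeff_tmul, map_smul, heisMode_vac _ (by omega),
    smul_zero]

theorem twistMode_eq (n : ℤ) (a : HSpace U) :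
    twistMode (heisY U) (signDelta hR true) (signDelta hR false) n a =
      signMode hR true n (signPart U true a) + signMode hR false n (signPart U false a) := by
  rw [signPart_true, signPart_false, signMode, signMode]
  simp only [← heisY_state, LinearMap.comp_apply]
  simp only [twistMode, LinearMap.comp_apply, LinearMap.add_apply, map_add]
  rfl

/-- The action `a ⊗ tⁿ ↦ a_R(n)` of `T(H ⊗ ℂ[t,t⁻¹])` on `V_ℋ`. -/
abbrev twistedRep : LoopRep (HSpace U) (VHeis U) :=
  twistRep (heisY U) (signDelta hR true) (signDelta hR false)

theorem mode_twistedRep (n : ℤ) (a : HSpace U) :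
    mode (twistedRep hR) n a =
      signMode hR true n (signPart U true a) + signMode hR false n (signPart U false a) := by
  rw [mode_eq, gen, twistedRep, twistRep, TensorAlgebra.lift_ι_apply, Finsupp.lsum_single,
    twistMode_eq]

theorem mode_twistedRep_mem (n : ℤ) (a : HSpace U) {k : ℤ} {w : VHeis U}
    (hw : w ∈ heisFilt U k) : mode (twistedRep hR) n a w ∈ heisFilt U (k - n) := by
  rw [mode_twistedRep, LinearMap.add_apply]
  exact Submodule.add_mem _ (signMode_mem hR _ n _ hw) (signMode_mem hR _ n _ hw)

theorem mode_twistedRep_sub_mem (n : ℤ) (a : HSpace U) {k : ℤ} {w : VHeis U}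
    (hw : w ∈ heisFilt U k) :
    mode (twistedRep hR) n a w - heisMode U n a w ∈ heisFilt U (k - n - 1) := by
  have h := Submodule.add_mem _ (signMode_sub_mem hR true n (signPart U true a) hw)
    (signMode_sub_mem hR false n (signPart U false a) hw)
  rw [sub_add_sub_comm, ← LinearMap.add_apply, ← LinearMap.add_apply, ← map_add, signPart_add,
    ← mode_twistedRep] at h
  exact h

theorem twistedRep_isVacuumLike : IsVacuumLike (twistedRep hR) (vac U) := fun a m hm => by
  rw [mode_twistedRep, LinearMap.add_apply, signMode_vac hR _ hm, signMode_vac hR _ hm, add_zero]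

theorem filt_twistedRep_le (k : ℤ) : filt (twistedRep hR) (vac U) k ≤ heisFilt U k := by
  refine Submodule.span_le.2 ?_
  rintro _ ⟨l, hl, rfl⟩
  refine filt_mono hl ?_
  clear hl
  induction l with
  | nil => exact mem_filt_zero
  | cons p l ih =>
    simp only [List.map_cons, List.prod_cons, List.sum_cons, Module.End.mul_apply]
    exact filt_mono (by omega) (mode_twistedRep_mem hR _ p.1 ih)

/-- `V_ℋ` is generated by the vacuum under the twisted modes, which agree with the untwisted ones up
to lower terms. -/
theorem twistedRep_cyclic (w : VHeis U) : ∃ t, twistedRep hR t (vac U) = w := by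
  have key : ∀ K : ℕ, ∀ k : ℤ, k < K → ∀ w ∈ heisFilt U k,
      ∃ t, twistedRep hR t (vac U) = w := by
    intro K
    induction K with
    | zero =>
      intro k hk w hw
      exact ⟨0, by rw [eq_zero_of_mem_filt (by exact_mod_cast hk) hw, map_zero,
        LinearMap.zero_apply]⟩
    | succ K ih =>
      intro k hk w hw
      refine filt_induction (Q := fun w => ∃ t, twistedRep hR t (vac U) = w) ?_ ?_ ?_ ?_ ?_ hw
      · exact fun _ => ⟨1, by rw [map_one]; rfl⟩
      · intro m a w hw
        have hm := m.pos
        obtain ⟨s, hs⟩ := ih _ (by omega) w hw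
        have h1 := mode_twistedRep_sub_mem hR (-((m : ℕ) : ℤ)) a hw
        obtain ⟨t, ht⟩ := ih _ (by omega) _ h1
        refine ⟨gen (-((m : ℕ) : ℤ)) a * s - t, ?_⟩
        rw [map_sub, map_mul, LinearMap.sub_apply, Module.End.mul_apply, hs, ht, ← mode_eq,
          sub_sub_cancel, mode_heisRep]
      · exact ⟨0, by rw [map_zero, LinearMap.zero_apply]⟩
      · rintro x y ⟨s, rfl⟩ ⟨t, rfl⟩
        exact ⟨s + t, by rw [map_add, LinearMap.add_apply]⟩
      · rintro c x ⟨s, rfl⟩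
        exact ⟨c • s, by rw [map_smul, LinearMap.smul_apply]⟩
  obtain ⟨k, hk⟩ := exists_mem_filt_heisRep w
  exact key (k + 1) k (by push_cast; omega) w hk

/-- The symbol map of `V_ℋ` is not affected by the twist. -/
theorem twistedRep_isSymbol : IsSymbol (twistedRep hR) (vac U) (heisSymbol U) where
  lower k w hw := heisSymbol_eq_zero (filt_twistedRep_le hR _ hw) (by omega)
  map_mode k m a w hw := by
    have h := heisSymbol_eq_zero (mode_twistedRep_sub_mem hR (-((m : ℕ) : ℤ)) a
      (filt_twistedRep_le hR _ hw)) (j := k + (m : ℕ)) (by push_cast; omega)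
    rw [map_sub, sub_eq_zero] at h
    rw [h, heisSymbol_mode, if_pos (by omega), Nat.add_sub_cancel]
  map_vac := by rw [heisSymbol_vac, if_pos rfl]

end TwistedModule

/-! ### Multiplication of distributions by `x - y` -/

section VariableDifference

variable {V : Type v} [AddCommGroup V] [Module ℂ V]

/-- Multiplication by `x - y` of the distribution `F(x,y) = ∑ F(m,n) x^(-m-1) y^(-n-1)`. -/
def subVar (V : Type v) [AddCommGroup V] [Module ℂ V] : Module.End ℂ (ℤ → ℤ → V) where
  toFun F m n := F (m + 1) n - F m (n + 1)
  map_add' F G := by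
    funext m n
    simp only [Pi.add_apply]
    abel
  map_smul' c F := by
    funext m n
    simp only [Pi.smul_apply, RingHom.id_apply, smul_sub]

theorem subVar_apply (F : ℤ → ℤ → V) (m n : ℤ) :
    subVar V F m n = F (m + 1) n - F m (n + 1) := rfl

theorem subVar_pow_succ_apply (r : ℕ) (F : ℤ → ℤ → V) (m n : ℤ) :
    (subVar V ^ (r + 1)) F m n = (subVar V ^ r) F (m + 1) n - (subVar V ^ r) F m (n + 1) := by
  rw [pow_succ', Module.End.mul_apply, subVar_apply]

/-- The binomial expansion of `(x - y)ʳF(x,y)`. -/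
theorem subVar_pow_apply (r : ℕ) (F : ℤ → ℤ → V) (m n : ℤ) :
    (subVar V ^ r) F m n = ∑ j ∈ Finset.range (r + 1),
      ((-1 : ℂ) ^ j * (r.choose j : ℂ)) • F (m + r - j) (n + j) := by
  -- multiplication by `x` and by `-y`
  let X : Module.End ℂ (ℤ → ℤ → V) :=
    { toFun := fun F m n => F (m + 1) n, map_add' := fun _ _ => rfl, map_smul' := fun _ _ => rfl }
  let Y : Module.End ℂ (ℤ → ℤ → V) :=
    { toFun := fun F m n => -F m (n + 1),
      map_add' := fun F G => by
        funext m n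
        exact neg_add _ _
      map_smul' := fun c F => by
        funext m n
        exact (smul_neg c (F m (n + 1))).symm }
  have hX : ∀ (k : ℕ) (F : ℤ → ℤ → V) (m n : ℤ), (X ^ k) F m n = F (m + k) n := by
    intro k
    induction k with
    | zero => simp
    | succ k ih =>
      intro F m n
      rw [pow_succ', Module.End.mul_apply]
      change (X ^ k) F (m + 1) n = _
      rw [ih]
      push_cast
      ring_nf
  have hY : ∀ (k : ℕ) (F : ℤ → ℤ → V) (m n : ℤ), (Y ^ k) F m n = (-1 : ℂ) ^ k • F m (n + k) := by
    intro k
    induction k with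
    | zero => simp
    | succ k ih =>
      intro F m n
      rw [pow_succ', Module.End.mul_apply]
      change -(Y ^ k) F m (n + 1) = _
      rw [ih, pow_succ, mul_neg_one, neg_smul]
      push_cast
      ring_nf
  have hXY : Commute Y X := LinearMap.ext fun F => rfl
  have hsum : subVar V = Y + X := by
    refine LinearMap.ext fun F => ?_
    funext m n
    change F (m + 1) n - F m (n + 1) = -F m (n + 1) + F (m + 1) n
    abel
  rw [hsum, hXY.add_pow, LinearMap.sum_apply, Finset.sum_apply, Finset.sum_apply]
  refine Finset.sum_congr rfl fun j hj => ?_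
  have hj : j ≤ r := by simpa [Nat.lt_succ_iff] using hj
  rw [← Nat.cast_comm, ← nsmul_eq_mul, LinearMap.smul_apply, Pi.smul_apply, Pi.smul_apply,
    Module.End.mul_apply, hY, hX, mul_comm, mul_smul, Nat.cast_smul_eq_nsmul, Nat.cast_sub hj]
  congr 3
  ring

theorem subVar_pow_eq_zero {F : ℤ → ℤ → V} {K : ℤ} (hF : ∀ m n, K < m + n → F m n = 0) (r : ℕ)
    {m n : ℤ} (h : K < m + n + r) : (subVar V ^ r) F m n = 0 := by
  rw [subVar_pow_apply]
  exact Finset.sum_eq_zero fun j _ => by rw [hF _ _ (by omega), smul_zero]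

theorem subVar_pow_swap (r : ℕ) (F : ℤ → ℤ → V) (m n : ℤ) :
    (subVar V ^ r) (fun x y => F y x) m n = (-1 : ℂ) ^ r • (subVar V ^ r) F n m := by
  induction r generalizing m n with
  | zero => simp
  | succ r ih =>
    rw [subVar_pow_succ_apply, subVar_pow_succ_apply, ih, ih, pow_succ, mul_neg_one, neg_smul,
      smul_sub]
    abel

/-- `x - y` kills the distributions of the form `g(x) δ(x - y)`. -/
theorem subVar_pow_succ_diag (r : ℕ) (g : ℤ → V) (m n : ℤ) :
    (subVar V ^ (r + 1)) (fun x y => g (x + y)) m n = 0 := by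
  have h : subVar V (fun x y => g (x + y)) = 0 := by
    funext m n
    rw [subVar_apply, add_right_comm, add_assoc, sub_self]
    rfl
  rw [pow_succ, Module.End.mul_apply, h, map_zero]
  rfl

end VariableDifference

/-! ### The relation for the twisted fields -/

section TwistedRelation

variable {U : Type u} [AddCommGroup U] [Module ℂ U] [FiniteDimensional ℂ U]
variable {R : PowerSeries (Module.End ℂ U)} (hR : PowerSeries.constantCoeff R = 1)

/-- The modes of `Y(a,x)Y(b,y)Δ^ε(x)Δ^η(y)w` for `w ∈ V_ℋ[K]`, where the signs of `a` and `b` are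
`ε` and `η`. The sums run over the ranges outside which the summands vanish. -/
def smoothProd (ε η : Bool) (K : ℤ) (w : VHeis U) (a : HSpace U) :
    HSpace U →ₗ[ℂ] ℤ → ℤ → VHeis U :=
  LinearMap.pi fun m => LinearMap.pi fun n =>
    ∑ i ∈ Finset.range ((K - m - n).toNat + 1), ∑ l ∈ Finset.range ((K - m - n).toNat + 1),
      heisMode U (m + i) a ∘ₗ (heisMode U (n + l)).flip
        (dcoeff (signDelta hR ε) i (dcoeff (signDelta hR η) l w))

variable {ε η : Bool} {K : ℤ} {w : VHeis U}

theorem smoothProd_apply (hw : w ∈ heisFilt U K) (a b : HSpace U) (m n : ℤ) {N : ℕ}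
    (hN : K < m + n + N) :
    smoothProd hR ε η K w a b m n = ∑ i ∈ Finset.range N, ∑ l ∈ Finset.range N,
      heisMode U (m + i) a (heisMode U (n + l) b
        (dcoeff (signDelta hR ε) i (dcoeff (signDelta hR η) l w))) := by
  have hz : ∀ i l : ℕ, K < m + n + (i + l : ℕ) → heisMode U (m + i) a (heisMode U (n + l) b
      (dcoeff (signDelta hR ε) i (dcoeff (signDelta hR η) l w))) = 0 := fun i l h =>
    eq_zero_of_mem_filt (k := K - (n + l) - (m + i)) (by push_cast at h; omega)
      (heisMode_mem_filt (heisMode_mem_filt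
        (dcoeff_signDelta_mem hR ε (dcoeff_signDelta_mem hR η hw l) i) b _) a _)
  have key : ∀ M : ℕ, K < m + n + M → (∑ i ∈ Finset.range M, ∑ l ∈ Finset.range M,
      heisMode U (m + i) a (heisMode U (n + l) b
        (dcoeff (signDelta hR ε) i (dcoeff (signDelta hR η) l w)))) =
      ∑ᶠ i : ℕ, ∑ᶠ l : ℕ, heisMode U (m + i) a (heisMode U (n + l) b
        (dcoeff (signDelta hR ε) i (dcoeff (signDelta hR η) l w))) := by
    intro M hM
    rw [finsum_eq_sum_range (n := M) fun i hi => finsum_eq_zero_of_forall_eq_zero fun l =>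
      hz i l (by push_cast; omega)]
    exact Finset.sum_congr rfl fun i _ => (finsum_eq_sum_range fun l hl =>
      hz i l (by push_cast; omega)).symm
  rw [key N hN, ← key ((K - m - n).toNat + 1) (by push_cast; omega)]
  simp only [smoothProd, LinearMap.pi_apply, LinearMap.sum_apply]
  rfl

theorem smoothProd_eq_zero (hw : w ∈ heisFilt U K) (a b : HSpace U) {m n : ℤ} (h : K < m + n) :
    smoothProd hR ε η K w a b m n = 0 := by
  rw [smoothProd_apply hR hw a b m n (N := 0) (by omega), Finset.sum_range_zero]

/-- The modes of `a_R(x)b_R(y)w`, where the signs of `a` and `b` are `ε` and `η`. -/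
def twistedProd (ε η : Bool) (w : VHeis U) (a b : HSpace U) (m n : ℤ) : VHeis U :=
  signMode hR ε m a (signMode hR η n b w)

theorem twistedProd_eq_zero (hw : w ∈ heisFilt U K) (a b : HSpace U) {m n : ℤ} (h : K < m + n) :
    twistedProd hR ε η w a b m n = 0 :=
  eq_zero_of_mem_filt (k := K - n - m) (by omega) (signMode_mem hR _ _ _ (signMode_mem hR _ _ _ hw))

/-- `a_R(x)b_R(y) = Y(a,x)Y(Δ^ε(x-y)b,y)Δ^ε(x)Δ^η(y)`. -/
theorem twistedProd_eq (hw : w ∈ heisFilt U K) (a b : HSpace U) (m n : ℤ) {N : ℕ}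
    (hN : K < m + n + N) :
    twistedProd hR ε η w a b m n = ∑ r ∈ Finset.range N,
      (subVar (VHeis U) ^ r) (smoothProd hR ε η K w a (signCoeff R ε r b)) m n := by
  -- both sides are the sum of `T` over the box `[0,N)⁴`, since `T` vanishes for `s + j + i + l ≥ N`
  let T : ℕ → ℕ → ℕ → ℕ → VHeis U := fun s j i l => ((-1 : ℂ) ^ j * ((s + j).choose j : ℂ)) •
    heisMode U (m + s + i) a (heisMode U (n + l + j) (signCoeff R ε (s + j) b)
      (dcoeff (signDelta hR ε) i (dcoeff (signDelta hR η) l w)))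
  have hT : ∀ s j i l, N ≤ s + j + i + l → T s j i l = 0 := by
    intro s j i l h
    simp only [T]
    rw [eq_zero_of_mem_filt (k := K - (n + l + j) - (m + s + i)) (by omega)
      (heisMode_mem_filt (heisMode_mem_filt
        (dcoeff_signDelta_mem hR ε (dcoeff_signDelta_mem hR η hw l) i) _ _) a _), smul_zero]
  have hL : twistedProd hR ε η w a b m n = ∑ l ∈ Finset.range N, ∑ i ∈ Finset.range N,
      ∑ s ∈ Finset.range N, ∑ j ∈ Finset.range N, T s j i l := by
    rw [twistedProd, signMode_apply hR η n, map_finsum_of_eventually, finsum_eq_sum_range (n := N)]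
    · refine Finset.sum_congr rfl fun l _ => ?_
      have hwl := heisMode_mem_filt (dcoeff_signDelta_mem hR η hw l) b (n + l)
      rw [signMode_eq_sum hR ε m a hwl (N := N) (by omega)]
      have h1 : ∀ t : ℕ, heisMode U (m + t) a (dcoeff (signDelta hR ε) t
          (heisMode U (n + l) b (dcoeff (signDelta hR η) l w))) =
          ∑ p ∈ antidiagonal t, ∑ j ∈ Finset.range N, T p.2 j p.1 l := by
        intro t
        rw [IsPseudoEnd.dcoeff_heisMode (Δ := signDelta hR ε) (deltaMap_isPseudoEnd _)
          (dcoeff_deltaMap_state _), map_sum, Finset.Nat.sum_antidiagonal_eq_sum_range_succ_mk]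
        refine Finset.sum_congr rfl fun i hi => ?_
        have hi : i ≤ t := by simpa [Nat.lt_succ_iff] using hi
        have hD := dcoeff_signDelta_mem hR ε (dcoeff_signDelta_mem hR η hw l) i
        rw [map_finsum_of_eventually, finsum_eq_sum_range (n := N)]
        · refine Finset.sum_congr rfl fun j _ => ?_
          simp only [T]
          rw [map_smul, show m + (t : ℤ) = m + ((t - i : ℕ) : ℤ) + i by omega]
        · intro j hj
          rw [map_smul, eq_zero_of_mem_filt (k := K - (n + l + j) - (m + t)) (by omega)
            (heisMode_mem_filt (heisMode_mem_filt hD _ _) a _), smul_zero]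
        · refine ⟨(K - n - l).toNat + 1, fun j hj => ?_⟩
          rw [eq_zero_of_mem_filt (k := K - (n + l + j)) (by omega)
            (heisMode_mem_filt hD _ _), smul_zero]
      rw [Finset.sum_congr rfl fun t _ => h1 t,
        ← sum_range_sum_range_eq_sum_antidiagonal
          (f := fun i s => ∑ j ∈ Finset.range N, T s j i l)]
      exact fun i s h => Finset.sum_eq_zero fun j _ => hT s j i l (by omega)
    · intro l hl
      exact eq_zero_of_mem_filt (k := K - (n + l) - m) (by omega) (signMode_mem hR _ _ _
        (heisMode_mem_filt (dcoeff_signDelta_mem hR η hw l) b (n + l)))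
    · refine ⟨(K - n).toNat + 1, fun l hl => ?_⟩
      exact eq_zero_of_mem_filt (k := K - (n + l)) (by omega)
        (heisMode_mem_filt (dcoeff_signDelta_mem hR η hw l) b (n + l))
  have hR' : ∀ r, (subVar (VHeis U) ^ r) (smoothProd hR ε η K w a (signCoeff R ε r b)) m n =
      ∑ p ∈ antidiagonal r, ∑ i ∈ Finset.range N, ∑ l ∈ Finset.range N, T p.2 p.1 i l := by
    intro r
    rw [subVar_pow_apply, Finset.Nat.sum_antidiagonal_eq_sum_range_succ_mk]
    refine Finset.sum_congr rfl fun j hj => ?_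
    have hj : j ≤ r := by simpa [Nat.lt_succ_iff] using hj
    rw [smoothProd_apply hR hw _ _ _ _ (N := N) (by omega), Finset.smul_sum]
    refine Finset.sum_congr rfl fun i _ => ?_
    rw [Finset.smul_sum]
    refine Finset.sum_congr rfl fun l _ => ?_
    simp only [T]
    rw [Nat.sub_add_cancel hj, Nat.cast_sub hj, add_sub_assoc, add_right_comm n]
  rw [hL, Finset.sum_congr rfl fun r _ => hR' r,
    ← sum_range_sum_range_eq_sum_antidiagonal (f := fun j s =>
      ∑ i ∈ Finset.range N, ∑ l ∈ Finset.range N, T s j i l)]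
  · rw [Finset.sum_comm]
    refine Eq.trans ?_ Finset.sum_comm
    exact (Finset.sum_congr rfl fun i _ => Finset.sum_comm.trans
      (Finset.sum_congr rfl fun s _ => Finset.sum_comm)).trans
      (Finset.sum_comm.trans (Finset.sum_congr rfl fun s _ => Finset.sum_comm))
  · exact fun j s h => Finset.sum_eq_zero fun i _ => Finset.sum_eq_zero fun l _ =>
      hT s j i l (by omega)

theorem subVar_pow_twistedProd (hw : w ∈ heisFilt U K) (a b : HSpace U) (k : ℕ) (m n : ℤ) {N : ℕ}
    (hN : K < m + n + N) :
    (subVar (VHeis U) ^ k) (twistedProd hR ε η w a b) m n = ∑ r ∈ Finset.range N,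
      (subVar (VHeis U) ^ (k + r)) (smoothProd hR ε η K w a (signCoeff R ε r b)) m n := by
  induction k generalizing m n with
  | zero => simpa using twistedProd_eq hR hw a b m n hN
  | succ k ih =>
    rw [subVar_pow_succ_apply, ih _ _ (by omega), ih _ _ (by omega), ← Finset.sum_sub_distrib]
    exact Finset.sum_congr rfl fun r _ => by rw [Nat.add_right_comm, subVar_pow_succ_apply]

/-- The part `∑ fᵢ(x-y)b⁽ⁱ⁾(x)a⁽ⁱ⁾(y)w` of the relation: the factor `Δ^ε(x-y)` coming from moving
`Δ^ε(x)` past the second field cancels against the corresponding factor of `𝒮`. -/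
theorem sum_subVar_pow_twistedProd (hw : w ∈ heisFilt U K) (a b : HSpace U) (m n : ℤ) {N : ℕ}
    (hN : K < m + n + N) :
    ∑ k ∈ Finset.range N, ∑ p ∈ antidiagonal k, (-1 : ℂ) ^ p.1 • (subVar (VHeis U) ^ k)
      (twistedProd hR ε η w (signCoeff R η p.1 a) (signCoeff R (!ε) p.2 b)) m n =
    ∑ s ∈ Finset.range N, (-1 : ℂ) ^ s •
      (subVar (VHeis U) ^ s) (smoothProd hR ε η K w (signCoeff R η s a) b) m n := by
  have hF : ∀ (c d : HSpace U) (q : ℕ), N ≤ q →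
      (subVar (VHeis U) ^ q) (smoothProd hR ε η K w c d) m n = 0 := fun c d q hq =>
    subVar_pow_eq_zero (fun x y h => smoothProd_eq_zero hR hw c d h) q (by omega)
  have h1 : ∀ k, ∑ p ∈ antidiagonal k, (-1 : ℂ) ^ p.1 • (subVar (VHeis U) ^ k)
      (twistedProd hR ε η w (signCoeff R η p.1 a) (signCoeff R (!ε) p.2 b)) m n =
      ∑ p ∈ antidiagonal k, (-1 : ℂ) ^ p.1 • (subVar (VHeis U) ^ (p.1 + p.2))
      (twistedProd hR ε η w (signCoeff R η p.1 a) (signCoeff R (!ε) p.2 b)) m n := fun k =>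
    Finset.sum_congr rfl fun p hp => by
      rw [Finset.HasAntidiagonal.mem_antidiagonal.1 hp]
  rw [Finset.sum_congr rfl fun k _ => h1 k, ← sum_range_sum_range_eq_sum_antidiagonal
    (f := fun s q => (-1 : ℂ) ^ s • (subVar (VHeis U) ^ (s + q))
      (twistedProd hR ε η w (signCoeff R η s a) (signCoeff R (!ε) q b)) m n)]
  · refine Finset.sum_congr rfl fun s _ => ?_
    rw [← Finset.smul_sum]
    congr 1
    simp only [subVar_pow_twistedProd hR hw _ _ _ _ _ hN]
    rw [sum_range_sum_range_eq_sum_antidiagonal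
      (f := fun q r => (subVar (VHeis U) ^ (s + q + r)) (smoothProd hR ε η K w (signCoeff R η s a)
        (signCoeff R ε r (signCoeff R (!ε) q b))) m n)]
    · have h2 : ∀ t, ∑ p ∈ antidiagonal t, (subVar (VHeis U) ^ (s + p.1 + p.2))
          (smoothProd hR ε η K w (signCoeff R η s a)
            (signCoeff R ε p.2 (signCoeff R (!ε) p.1 b))) m n =
          if t = 0 then (subVar (VHeis U) ^ s)
            (smoothProd hR ε η K w (signCoeff R η s a) b) m n else 0 := by
        intro t
        have h3 := LinearMap.congr_fun (sum_signCoeff_mul hR ε t) b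
        rw [← Finset.Nat.sum_antidiagonal_swap, LinearMap.sum_apply] at h3
        have h4 := congrFun (congrFun (congrArg (fun c => (subVar (VHeis U) ^ (s + t))
          (smoothProd hR ε η K w (signCoeff R η s a) c)) h3) m) n
        simp only [map_sum, Finset.sum_apply] at h4
        refine Eq.trans (Finset.sum_congr rfl fun p hp => ?_) (h4.trans ?_)
        · rw [add_assoc, Finset.HasAntidiagonal.mem_antidiagonal.1 hp]
          rfl
        · split_ifs with h0
          · rw [h0]
            rfl
          · simp
      rw [Finset.sum_congr rfl fun t _ => h2 t]
      rcases Nat.eq_zero_or_pos N with h0 | h0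
      · rw [h0, Finset.sum_range_zero, hF _ _ _ (by omega)]
      · rw [Finset.sum_ite_eq' (Finset.range N), if_pos (Finset.mem_range.2 h0)]
    · exact fun q r h => hF _ _ _ (by omega)
  · intro s q h
    rw [subVar_pow_eq_zero (fun x y h => twistedProd_eq_zero hR hw _ _ h) _ (by omega), smul_zero]

end TwistedRelation

section TwistedRelation

variable {U : Type u} [AddCommGroup U] [Module ℂ U]
variable {R : PowerSeries (Module.End ℂ U)}

theorem signPart_signCoeff (ε η : Bool) (s : ℕ) (a : HSpace U) :
    signPart U η (signCoeff R ε s a) = signCoeff R ε s (signPart U η a) := by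
  cases ε <;> cases η <;> simp [signCoeff, blockCoeff_apply]

theorem signPart_signPart (ε : Bool) (a : HSpace U) :
    signPart U ε (signPart U ε a) = signPart U ε a := by
  cases ε <;> simp

theorem signPart_not_signPart (ε : Bool) (a : HSpace U) :
    signPart U (!ε) (signPart U ε a) = 0 := by
  cases ε <;> simp

theorem sum_signPart (a : HSpace U) : ∑ ε : Bool, signPart U ε a = a := by
  rw [Fintype.sum_bool, signPart_add]

theorem symp_signPart_self (ε : Bool) (a b : HSpace U) :
    symp U (signPart U ε a) (signPart U ε b) = 0 := by
  cases ε <;> simp [symp_apply]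

/-- The coefficients of `𝒮(x)` in terms of those of `Δ_R^±`. -/
theorem coeff_SOp_tmul (k : ℕ) (b a : HSpace U) :
    PowerSeries.coeff k (SOp R) (b ⊗ₜ[ℂ] a) = ∑ p ∈ antidiagonal k, (-1 : ℂ) ^ p.1 •
      ∑ ε : Bool, ∑ η : Bool, signCoeff R ε p.1 (signPart U η b) ⊗ₜ[ℂ]
        signCoeff R (!η) p.2 (signPart U ε a) := by
  rw [SOp, PowerSeries.coeff_mk, LinearMap.sum_apply]
  refine Finset.sum_congr rfl fun p _ => ?_
  rw [LinearMap.smul_apply]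
  congr 1
  simp only [Fintype.sum_bool, LinearMap.add_apply, TensorProduct.map_tmul, onU, onDual,
    LinearMap.comp_apply, LinearMap.inl_apply, LinearMap.inr_apply, LinearMap.fst_apply,
    LinearMap.snd_apply, signPart_true, signPart_false, Bool.not_true, Bool.not_false, signCoeff,
    if_true, Bool.false_eq_true, if_false, blockCoeff_apply, map_zero]
  abel

theorem coeff_zero_SOp (hR : PowerSeries.constantCoeff R = 1) :
    PowerSeries.coeff 0 (SOp R) = 1 := by
  refine TensorProduct.ext' fun b a => ?_
  rw [coeff_SOp_tmul, Finset.Nat.antidiagonal_zero, Finset.sum_singleton]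
  simp only [signCoeff_zero hR, pow_zero, one_smul]
  rw [Finset.sum_comm]
  simp only [← TensorProduct.tmul_sum, ← TensorProduct.sum_tmul, sum_signPart]
  rfl

variable [FiniteDimensional ℂ U]
variable (hR : PowerSeries.constantCoeff R = 1)
variable {ε η : Bool} {K : ℕ} {w : VHeis U}

/-- The coefficient of `x^(-d-1)` in `Δ^ε(x)Δ^η(x)w`. The sums run over ranges that contain all
`i` and `l` with `i + l = -d - 1`. -/
def pairCoeff (hR : PowerSeries.constantCoeff R = 1) (ε η : Bool) (K : ℕ) (w : VHeis U) (d : ℤ) :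
    VHeis U :=
  ∑ i ∈ Finset.range ((K - d).toNat + 1), ∑ l ∈ Finset.range ((K - d).toNat + 1),
    if d + i + l + 1 = 0 then dcoeff (signDelta hR ε) i (dcoeff (signDelta hR η) l w) else 0

/-- `Δ^+(x)Δ^-(x) = 1`, in terms of coefficients. -/
theorem pairCoeff_not (ε : Bool) (w : VHeis U) (d : ℤ) :
    pairCoeff hR ε (!ε) K w d = if d + 1 = 0 then w else 0 := by
  rw [pairCoeff, sum_range_sum_range_eq_sum_antidiagonal (f := fun i l => if d + i + l + 1 = 0 then
    dcoeff (signDelta hR ε) i (dcoeff (signDelta hR (!ε)) l w) else 0)]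
  · have h : ∀ t : ℕ, (∑ p ∈ antidiagonal t, if d + p.1 + p.2 + 1 = 0 then
        dcoeff (signDelta hR ε) p.1 (dcoeff (signDelta hR (!ε)) p.2 w) else 0) =
        if t = 0 then (if d + 1 = 0 then w else 0) else 0 := by
      intro t
      have h1 := congrArg (PowerSeries.coeff t) (mk_dcoeff_signDelta_mul hR ε)
      rw [PowerSeries.coeff_mul, PowerSeries.coeff_one] at h1
      have h2 := LinearMap.congr_fun h1 w
      simp only [PowerSeries.coeff_mk, LinearMap.sum_apply, Module.End.mul_apply] at h2
      have h3 : ∀ p ∈ antidiagonal t, (if d + p.1 + p.2 + 1 = 0 then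
          dcoeff (signDelta hR ε) p.1 (dcoeff (signDelta hR (!ε)) p.2 w) else 0) =
          if d + t + 1 = 0 then
            dcoeff (signDelta hR ε) p.1 (dcoeff (signDelta hR (!ε)) p.2 w) else 0 := by
        intro p hp
        rw [← Finset.HasAntidiagonal.mem_antidiagonal.1 hp, Nat.cast_add, add_assoc d]
      rw [Finset.sum_congr rfl h3]
      rcases Nat.eq_zero_or_pos t with rfl | ht
      · simp only [Nat.cast_zero, add_zero, if_true] at h2 ⊢
        split_ifs
        · rw [h2]
          rfl
        · exact Finset.sum_const_zero
      · rw [if_neg ht.ne'] at h2 ⊢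
        split_ifs
        · rw [h2]
          rfl
        · exact Finset.sum_const_zero
    rw [Finset.sum_congr rfl fun t _ => h t, Finset.sum_ite_eq' (Finset.range _),
      if_pos (Finset.mem_range.2 (Nat.succ_pos _))]
  · exact fun i l h => if_neg (by omega)

/-- The commutator of `Y(a,x)` and `Y(b,y)` contributes `⟨a,b⟩ y⁻¹δ(x/y) Δ^ε(x)Δ^η(x)w`. -/
theorem smoothProd_swap (hcomm : ∀ i j : ℕ, PowerSeries.coeff i R * PowerSeries.coeff j R =
      PowerSeries.coeff j R * PowerSeries.coeff i R)
    (hw : w ∈ heisFilt U (K : ℤ)) (a b : HSpace U) (m n : ℤ) :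
    smoothProd hR ε η K w a b m n =
      smoothProd hR η ε K w b a n m + symp U a b • pairCoeff hR ε η K w (m + n) := by
  have hN : (K : ℤ) < m + n + ((K - (m + n)).toNat + 1 : ℕ) := by push_cast; omega
  have hN' : (K : ℤ) < n + m + ((K - (m + n)).toNat + 1 : ℕ) := by push_cast; omega
  rw [smoothProd_apply hR hw a b m n hN, smoothProd_apply hR hw b a n m hN']
  rw [Finset.sum_comm (s := Finset.range _) (t := Finset.range _) (f := fun i l : ℕ =>
      heisMode U (n + i) b (heisMode U (m + l) a
        (dcoeff (signDelta hR η) i (dcoeff (signDelta hR ε) l w)))),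
    pairCoeff, Finset.smul_sum, ← Finset.sum_add_distrib]
  refine Finset.sum_congr rfl fun i _ => ?_
  rw [Finset.smul_sum, ← Finset.sum_add_distrib]
  refine Finset.sum_congr rfl fun l _ => ?_
  rw [signDelta_comm hcomm hR η ε, ← sub_eq_iff_eq_add', heisMode_commutator,
    show m + (i : ℤ) + (n + l) + 1 = m + n + i + l + 1 by ring]
  split_ifs
  · rfl
  · rw [smul_zero, zero_smul]

/-- The relation for `a` and `b` of definite sign. If their signs agree, then `⟨a,b⟩ = 0`; if they are
opposite, then the two pseudo-endomorphisms cancel on the diagonal `x = y`. -/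
theorem twistedProd_relation (hcomm : ∀ i j : ℕ, PowerSeries.coeff i R * PowerSeries.coeff j R =
      PowerSeries.coeff j R * PowerSeries.coeff i R)
    (hw : w ∈ heisFilt U (K : ℤ)) (a b : HSpace U) (m n : ℤ) {N : ℕ}
    (hN : (K : ℤ) < m + n + N) (hab : η = !ε ∨ symp U a b = 0) :
    twistedProd hR ε η w a b m n =
      (∑ k ∈ Finset.range N, ∑ p ∈ antidiagonal k, (-1 : ℂ) ^ p.1 • (subVar (VHeis U) ^ k)
        (twistedProd hR η ε w (signCoeff R ε p.1 b) (signCoeff R (!η) p.2 a)) n m)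
      + symp U a b • if m + n + 1 = 0 then w else 0 := by
  -- for `s > 0` the delta function is killed by the factor `(x - y)ˢ`
  have hsw : ∀ s, (subVar (VHeis U) ^ s) (smoothProd hR ε η K w a (signCoeff R ε s b)) m n =
      (-1 : ℂ) ^ s • (subVar (VHeis U) ^ s) (smoothProd hR η ε K w (signCoeff R ε s b) a) n m
      + if s = 0 then symp U a b • (if m + n + 1 = 0 then w else 0) else 0 := by
    intro s
    have h : smoothProd hR ε η K w a (signCoeff R ε s b) =
        (fun x y => smoothProd hR η ε K w (signCoeff R ε s b) a y x) +
        symp U a (signCoeff R ε s b) • fun x y => pairCoeff hR ε η K w (x + y) := by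
      funext x y
      exact smoothProd_swap hR hcomm hw a _ x y
    rw [h, map_add, map_smul, Pi.add_apply, Pi.add_apply, subVar_pow_swap, Pi.smul_apply,
      Pi.smul_apply]
    congr 1
    rcases s with _ | s
    · rw [if_pos rfl, signCoeff_zero hR]
      rcases hab with rfl | h0
      · rw [pow_zero, Module.End.one_apply, pairCoeff_not]
      · rw [h0, zero_smul, zero_smul]
    · rw [subVar_pow_succ_diag, smul_zero, if_neg (Nat.succ_ne_zero s)]
  rw [sum_subVar_pow_twistedProd hR hw b a n m (by omega), twistedProd_eq hR hw a b m n hN,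
    Finset.sum_congr rfl fun s _ => hsw s, Finset.sum_add_distrib]
  congr 1
  rcases Nat.eq_zero_or_pos N with rfl | h0
  · rw [Finset.sum_range_zero]
    split_ifs with h1
    · have : w = 0 := eq_zero_of_mem_filt (by omega) hw
      rw [this, smul_zero]
    · rw [smul_zero]
  · rw [Finset.sum_ite_eq' (Finset.range N), if_pos (Finset.mem_range.2 h0)]

theorem mode_twistedRep_eq_sum (n : ℤ) (a : HSpace U) :
    mode (twistedRep hR) n a = ∑ ε : Bool, signMode hR ε n (signPart U ε a) := by
  rw [mode_twistedRep, Fintype.sum_bool]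

theorem mode_twistedRep_of_signPart {a : HSpace U} (ha : signPart U ε a = a) (n : ℤ) :
    mode (twistedRep hR) n a = signMode hR ε n a := by
  have h0 : signPart U (!ε) a = 0 := by rw [← ha, signPart_not_signPart]
  rw [mode_twistedRep]
  cases ε
  · rw [ha, show signPart U true a = 0 from h0, map_zero, zero_add]
  · rw [ha, show signPart U false a = 0 from h0, map_zero, add_zero]

/-- The twisted fields satisfy the relations: decompose `a` and `b` into their components in `U` and
`U*`. -/
theorem twistedRep_isHSModule (hcomm : ∀ i j : ℕ, PowerSeries.coeff i R * PowerSeries.coeff j R =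
      PowerSeries.coeff j R * PowerSeries.coeff i R) :
    IsHSModule (symp U) (SOp R) (twistedRep hR) where
  truncation a w := by
    obtain ⟨k, hk⟩ := exists_mem_filt_heisRep w
    exact ⟨k + 1, fun m hm =>
      eq_zero_of_mem_filt (k := k - m) (by omega) (mode_twistedRep_mem hR m a hk)⟩
  relation a b m n w := by
    obtain ⟨K, hw⟩ := exists_mem_filt_heisRep w
    have hmem : ∀ (x y : ℤ) (ξ : HSpace U ⊗[ℂ] HSpace U),
        modePair (twistedRep hR) x y ξ w ∈ heisFilt U (K - y - x) := by
      intro x y ξ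
      induction ξ using TensorProduct.induction_on with
      | zero =>
        rw [map_zero]
        exact Submodule.zero_mem _
      | tmul c d => exact mode_twistedRep_mem hR x c (mode_twistedRep_mem hR y d hw)
      | add ξ ζ hξ hζ =>
        rw [map_add]
        exact Submodule.add_mem _ hξ hζ
    -- the coefficients of `∑ b⁽ⁱ⁾(x)a⁽ⁱ⁾(y)w` at `(x - y)ᵏ`
    let F : ℕ → ℤ → ℤ → VHeis U := fun k x y =>
      modePair (twistedRep hR) x y (PowerSeries.coeff k (SOp R) (b ⊗ₜ[ℂ] a)) w
    have hF0 : ∀ k x y, (K : ℤ) < x + y → F k x y = 0 := fun k x y h =>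
      eq_zero_of_mem_filt (k := K - y - x) (by omega) (hmem x y _)
    have hF : ∀ k, F k = ∑ p ∈ antidiagonal k, ∑ ε : Bool, ∑ η : Bool, (-1 : ℂ) ^ p.1 •
        twistedProd hR η ε w (signCoeff R ε p.1 (signPart U η b))
          (signCoeff R (!η) p.2 (signPart U ε a)) := by
      intro k
      funext x y
      simp only [F]
      rw [coeff_SOp_tmul, map_sum, LinearMap.sum_apply, Finset.sum_apply, Finset.sum_apply]
      refine Finset.sum_congr rfl fun p _ => ?_
      simp only [map_smul, map_sum, LinearMap.smul_apply, LinearMap.sum_apply, Finset.sum_apply,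
        Finset.smul_sum, Pi.smul_apply]
      refine Finset.sum_congr rfl fun ε _ => Finset.sum_congr rfl fun η _ => ?_
      rw [modePair_tmul, Module.End.mul_apply,
        mode_twistedRep_of_signPart hR (ε := η) (by rw [signPart_signCoeff, signPart_signPart]),
        mode_twistedRep_of_signPart hR (ε := ε) (by rw [signPart_signCoeff, signPart_signPart])]
      rfl
    have hFk : ∀ k, (subVar (VHeis U) ^ k) (F k) n m =
        ∑ p ∈ antidiagonal k, ∑ ε : Bool, ∑ η : Bool, (-1 : ℂ) ^ p.1 • (subVar (VHeis U) ^ k)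
          (twistedProd hR η ε w (signCoeff R ε p.1 (signPart U η b))
            (signCoeff R (!η) p.2 (signPart U ε a))) n m := by
      intro k
      rw [hF]
      simp only [map_sum, map_smul, Finset.sum_apply, Pi.smul_apply]
    obtain ⟨N, hN⟩ : ∃ N : ℕ, (K : ℤ) < m + n + N := ⟨(K - m - n).toNat + 1, by push_cast; omega⟩
    have hS : (∑ᶠ k : ℕ, ∑ j ∈ Finset.range (k + 1), ((-1 : ℂ) ^ j * (k.choose j : ℂ)) •
        modePair (twistedRep hR) (n + k - j) (m + j)
          (PowerSeries.coeff k (SOp R) (b ⊗ₜ[ℂ] a)) w) =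
        ∑ k ∈ Finset.range N, (subVar (VHeis U) ^ k) (F k) n m := by
      rw [← finsum_eq_sum_range (f := fun k => (subVar (VHeis U) ^ k) (F k) n m)
        fun k hk => subVar_pow_eq_zero (hF0 k) k (by omega)]
      exact finsum_congr fun k => (subVar_pow_apply k (F k) n m).symm
    have hab : mode (twistedRep hR) m a (mode (twistedRep hR) n b w) =
        ∑ ε : Bool, ∑ η : Bool, twistedProd hR ε η w (signPart U ε a) (signPart U η b) m n := by
      rw [mode_twistedRep_eq_sum hR m a, LinearMap.sum_apply]
      refine Finset.sum_congr rfl fun ε _ => ?_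
      rw [mode_twistedRep_eq_sum hR n b, LinearMap.sum_apply, map_sum]
      rfl
    have hpure : ∀ ε η : Bool, η = !ε ∨ symp U (signPart U ε a) (signPart U η b) = 0 := by
      intro ε η
      by_cases h : η = ε
      · rw [h]
        exact Or.inr (symp_signPart_self ε a b)
      · exact Or.inl (by cases ε <;> cases η <;> simp_all)
    have hsymp : ∑ ε : Bool, ∑ η : Bool, symp U (signPart U ε a) (signPart U η b) =
        symp U a b := by
      conv_rhs => rw [← sum_signPart a, map_sum, LinearMap.sum_apply]
      refine Finset.sum_congr rfl fun ε _ => ?_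
      conv_rhs => rw [← sum_signPart b, map_sum]
    rw [relVec, hS, hab, sub_sub, sub_eq_zero]
    simp only [twistedProd_relation hR hcomm hw _ _ m n hN (hpure _ _), Finset.sum_add_distrib,
      ← Finset.sum_smul, hsymp]
    congr 1
    · rw [Finset.sum_congr rfl fun k _ => hFk k]
      exact (Finset.sum_congr rfl fun ε _ => Finset.sum_comm.trans
        (Finset.sum_congr rfl fun k _ => Finset.sum_comm)).trans
        (Finset.sum_comm.trans (Finset.sum_congr rfl fun k _ => Finset.sum_comm))
    · split_ifs
      · rfl
      · rw [smul_zero, zero_smul]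

theorem twistedRep_isVacuumModule (hcomm : ∀ i j : ℕ, PowerSeries.coeff i R * PowerSeries.coeff j R =
      PowerSeries.coeff j R * PowerSeries.coeff i R) :
    IsVacuumModule (symp U) (SOp R) (twistedRep hR) (vac U) where
  isHSModule := twistedRep_isHSModule hR hcomm
  vacuumLike := twistedRep_isVacuumLike hR
  cyclic := twistedRep_cyclic hR

end TwistedRelation

end ZF

end

theorem corollary4p12 (U : Type*) [AddCommGroup U] [Module ℂ U] [FiniteDimensional ℂ U]
    (R : PowerSeries (Module.End ℂ U))
    (hcomm : ∀ i j : ℕ, PowerSeries.coeff i R * PowerSeries.coeff j R =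
      PowerSeries.coeff j R * PowerSeries.coeff i R)
    (hR : PowerSeries.constantCoeff R = 1) :
    -- `V(H,𝒮)` is the universal vacuum `(H,𝒮)`-module
    ZF.IsVacuumModule (ZF.symp U) (ZF.SOp R) (ZF.vhsRep (ZF.symp U) (ZF.SOp R))
        (ZF.vhsOne (ZF.symp U) (ZF.SOp R)) ∧
    (∀ (W : Type*) [AddCommGroup W] [Module ℂ W] (ρ : ZF.LoopRep (ZF.HSpace U) W) (e : W),
      ZF.IsVacuumModule (ZF.symp U) (ZF.SOp R) ρ e →
        ∃! f : ZF.VHS (ZF.symp U) (ZF.SOp R) →ₗ[ℂ] W,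
          ZF.IsLoopHom (ZF.vhsRep (ZF.symp U) (ZF.SOp R)) ρ f ∧
            f (ZF.vhsOne (ZF.symp U) (ZF.SOp R)) = e) ∧
    -- it is of PBW type
    ZF.IsPBW (ZF.vhsRep (ZF.symp U) (ZF.SOp R)) (ZF.vhsOne (ZF.symp U) (ZF.SOp R)) ∧
    -- the vertex algebra structure of `V_ℋ`
    ∃ Y : ZF.VHeis U →ₗ[ℂ] VertexOperator ℂ (ZF.VHeis U),
      ZF.IsHeisVA U Y ∧ (∀ Y', ZF.IsHeisVA U Y' → Y' = Y) ∧
      -- the pseudo-endomorphisms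
      ∃ Δp Δm : ZF.VHeis U →ₗ[ℂ] ZF.VHeis U ⊗[ℂ] PowerSeries ℂ,
        ZF.IsDeltaPair R Y Δp Δm ∧
        (∀ Δp' Δm', ZF.IsDeltaPair R Y Δp' Δm' → Δp' = Δp ∧ Δm' = Δm) ∧
        -- `V_ℋ` is a vacuum `(H,𝒮)`-module of PBW type under the twisted fields
        ZF.IsVacuumModule (ZF.symp U) (ZF.SOp R) (ZF.twistRep Y Δp Δm) (ZF.vac U) ∧
        ZF.IsPBW (ZF.twistRep Y Δp Δm) (ZF.vac U) ∧
        -- and it is isomorphic to `V(H,𝒮)`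
        ∃ F : ZF.VHS (ZF.symp U) (ZF.SOp R) ≃ₗ[ℂ] ZF.VHeis U,
          ZF.IsLoopHom (ZF.vhsRep (ZF.symp U) (ZF.SOp R)) (ZF.twistRep Y Δp Δm)
            F.toLinearMap := by
  have hS := ZF.coeff_zero_SOp hR
  have hV := ZF.vhs_isVacuumModule (ZF.symp U) (ZF.SOp R)
  have hT := ZF.twistedRep_isVacuumModule hR hcomm
  have hθ := ZF.twistedRep_isSymbol hR
  obtain ⟨F, ⟨hF, hF1⟩, -⟩ := ZF.vhs_universal hT
  -- the symbol map of `V_ℋ`, pulled back to `V(H,𝒮)`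
  have hθF := hθ.comp hF hF1
  have hinj : Function.Injective F := (injective_iff_map_eq_zero F).2 fun w hw =>
    hθF.eq_zero hV hS fun k => by rw [LinearMap.comp_apply, hw, map_zero]
  have hsurj : Function.Surjective F := fun w => by
    obtain ⟨t, rfl⟩ := hT.cyclic w
    exact ⟨ZF.vhsRep _ _ t (ZF.vhsOne _ _), by rw [hF, hF1]⟩
  exact ⟨hV, fun W _ _ ρ e hW => ZF.vhs_universal hW, hθF.isPBW hV.isHSModule hV.vacuumLike hS,
    ZF.heisY U, ZF.heisY_isHeisVA, fun Y' hY' => ZF.isHeisVA_unique hY',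
    ZF.signDelta hR true, ZF.signDelta hR false, ZF.isDeltaPair_signDelta hcomm hR,
    fun _ _ h => ZF.IsDeltaPair.unique (ZF.isDeltaPair_signDelta hcomm hR) h,
    hT, hθ.isPBW hT.isHSModule hT.vacuumLike hS, LinearEquiv.ofBijective F ⟨hinj, hsurj⟩, hF⟩
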